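/- Let $n\ge 3$ and $m>0$, put $f(r)=1-\frac{2m}{r^{n-2}}$ and $r_m=(2m)^{1/(n-2)}$, and consider the $(n+1)$-dimensional Schwarzschild spacetime of mass $m$, that is, $\mathbb R\times\{x\in\mathbb R^n: |x|>r_m\}$ with the metric $\mathfrak g=-f(r)\,dt^2+f(r)^{-1}dr^2+r^2\Omega$, where $r=|x|$ and $\Omega$ is the standard metric of $\mathbb S^{n-1}$. A *photon surface* is an embedded timelike hypersurface $P$ such that every null geodesic that is tangent to $P$ at some parameter stays in $P$ and tangent to $P$ for all nearby parameters (so it can cease to be tangent to $P$ only by running out of $P$ over its edge). A photon surface is *spherically symmetric* if it is connected and each of its non-empty time-slices is a full round sphere $\{t_0\}\times\{|x|=r_0\}$ with $r_0>r_m$; it has *umbilicity factor* $\lambda\in\mathbb R$ if $\mathfrak g(\nabla_X\eta,Y)=\lambda\,\mathfrak g(X,Y)$ for all tangent vectors $X,Y$ to it, where $\eta$ is its outward ($dr(\eta)>0$) unit normal. (i) Let $P$ be a connected photon surface. Then either $P$ is part of (contained in) a centered vertical hyperplane $\{(t,x): |x|>r_m,\ x\cdot u=0\}$ for some Euclidean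 unit vector $u\in\mathbb R^n$, or $P$ is part of a spherically symmetric photon surface $Q$ with a constant umbilicity factor $\lambda>0$ such that - either $Q=\{(t,x): |x|=r_*\}$ for some $r_*>r_m$ with $f'(r_*)\,r_*=2f(r_*)$, and $\lambda=\sqrt{f(r_*)}/r_*$, - or $Q=\{(t,x): t\in J,\ |x|=\rho(t)\}$ for an open interval $J\subseteq\mathbb R$ and a smooth, non-constant function $\rho\colon J\to(r_m,\infty)$ with $$\left(\frac{d\rho}{dt}\right)^2=\frac{f(\rho)^2\,(\lambda^2\rho^2-f(\rho))}{\lambda^2\rho^2}.$$ (ii) Conversely, every centered vertical hyperplane as in (i) is a totally geodesic photon surface; for every $\lambda>0$, every set $Q$ of one of the two forms in (i) is a spherically symmetric photon surface with umbilicity factor $\lambda$; and every embedded timelike hypersurface that is part of a photon surface is a photon surface. -/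

import Mathlib

open scoped ContDiff Topology

namespace SchwarzschildPhoton

noncomputable section

/-- The coordinate space `ℝ × ℝⁿ`, with points `(t, x)`. Tangent vectors at any point of an open
subset of it are again elements of this space. -/
abbrev Coord (n : ℕ) : Type := ℝ × EuclideanSpace ℝ (Fin n)

/-- The function `f(r) = 1 - 2m / r^(n-2)` (the square of the static lapse). -/
def lapseSq (n : ℕ) (m r : ℝ) : ℝ := 1 - 2 * m / r ^ (n - 2)

/-- The horizon radius `r_m = (2m)^(1/(n-2))`. -/
def horizonRadius (n : ℕ) (m : ℝ) : ℝ := (2 * m) ^ (((n : ℝ) - 2)⁻¹)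

/-- The underlying manifold `ℝ × {x ∈ ℝⁿ : |x| > r_m}` of the Schwarzschild spacetime. -/
def spacetime (n : ℕ) (m : ℝ) : Set (Coord n) := {p | horizonRadius n m < ‖p.2‖}

/-- The differential `dr` of `r = |x|` at `p`, applied to the tangent vector `v`. -/
def dr {n : ℕ} (p v : Coord n) : ℝ := inner ℝ p.2 v.2 / ‖p.2‖

/-- The Schwarzschild metric `-f(r) dt² + f(r)⁻¹ dr² + r² Ω` at `p`, applied to `v` and `w`.
Since `|dx|² = dr² + r² Ω`, the last summand is the form `r² Ω`. -/
def metric (n : ℕ) (m : ℝ) (p v w : Coord n) : ℝ :=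
  -lapseSq n m ‖p.2‖ * (v.1 * w.1) + (lapseSq n m ‖p.2‖)⁻¹ * (dr p v * dr p w)
    + (inner ℝ v.2 w.2 - dr p v * dr p w)

/-- Christoffel symbols of the first kind: `g_p(∇_v W, z)` for the Levi-Civita connection `∇` and
the constant coordinate field `W = w` (the Koszul formula for constant coordinate fields). -/
def christoffel (n : ℕ) (m : ℝ) (p v w z : Coord n) : ℝ :=
  (fderiv ℝ (fun q => metric n m q w z) p v + fderiv ℝ (fun q => metric n m q v z) p w
    - fderiv ℝ (fun q => metric n m q v w) p z) / 2

/-- `g_p(∇_v W, z)` for a vector field `W`. -/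
def covDeriv (n : ℕ) (m : ℝ) (W : Coord n → Coord n) (p v z : Coord n) : ℝ :=
  metric n m p (fderiv ℝ W p v) z + christoffel n m p v (W p) z

/-- `γ` is a null geodesic defined on the open interval `I`: `g(γ', γ') = 0` and
`∇_{γ'} γ' = 0`, the latter tested against all vectors `z` (the metric is nondegenerate). -/
structure IsNullGeodesic (n : ℕ) (m : ℝ) (I : Set ℝ) (γ : ℝ → Coord n) : Prop where
  isOpen : IsOpen I
  interval : I.OrdConnected
  smooth : ContDiffOn ℝ 2 γ I
  mem : ∀ τ ∈ I, γ τ ∈ spacetime n m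
  null : ∀ τ ∈ I, metric n m (γ τ) (deriv γ τ) (deriv γ τ) = 0
  geodesic : ∀ τ ∈ I, ∀ z : Coord n,
    metric n m (γ τ) (deriv (deriv γ) τ) z
      + christoffel n m (γ τ) (deriv γ τ) (deriv γ τ) z = 0

/-- Near `p`, on the open set `U`, the set `P` is the regular zero set of the smooth function
`F`. -/
structure IsLocalDefiningFunction {n : ℕ} (P : Set (Coord n)) (p : Coord n)
    (U : Set (Coord n)) (F : Coord n → ℝ) : Prop where
  isOpen : IsOpen U
  mem : p ∈ U
  smooth : ContDiffOn ℝ ∞ F U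
  regular : ∀ q ∈ U, fderiv ℝ F q ≠ 0
  zero_iff : ∀ q ∈ U, (q ∈ P ↔ F q = 0)

/-- The tangent space of a hypersurface `P` at `p`: the kernel of the differential of a local
defining function. -/
def tangentVectors {n : ℕ} (P : Set (Coord n)) (p : Coord n) : Set (Coord n) :=
  {v | ∃ U F, IsLocalDefiningFunction P p U F ∧ fderiv ℝ F p v = 0}

/-- `P` is a smooth embedded timelike hypersurface (without boundary) of the Schwarzschild
spacetime. A hyperplane in a Lorentzian vector space is timelike if and only if it contains a
timelike vector. -/
structure IsTimelikeHypersurface (n : ℕ) (m : ℝ) (P : Set (Coord n)) : Prop where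
  subset : P ⊆ spacetime n m
  embedded : ∀ p ∈ P, ∃ U F, IsLocalDefiningFunction P p U F
  timelike : ∀ p ∈ P, ∃ v ∈ tangentVectors P p, metric n m p v v < 0

/-- A photon surface: a timelike embedded hypersurface that is null totally geodesic, that is,
every null geodesic that is tangent to `P` at some parameter remains in `P` and tangent to `P` for
all nearby parameters. (A geodesic can thus only cease to be tangent to `P` by running out of `P`
over its edge, so that open pieces of photon surfaces are photon surfaces.) -/
structure IsPhotonSurface (n : ℕ) (m : ℝ) (P : Set (Coord n)) : Prop
    extends IsTimelikeHypersurface n m P where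
  nullTotallyGeodesic : ∀ (I : Set ℝ) (γ : ℝ → Coord n), IsNullGeodesic n m I γ →
    ∀ τ₀ ∈ I, γ τ₀ ∈ P → deriv γ τ₀ ∈ tangentVectors P (γ τ₀) →
      ∀ᶠ τ in 𝓝 τ₀, γ τ ∈ P ∧ deriv γ τ ∈ tangentVectors P (γ τ)

/-- `η` restricts to a smooth unit normal field along `P` (`η` is smooth on a neighbourhood of
`P`, so that it can be differentiated; derivatives in directions tangent to `P` only depend on
the restriction). -/
structure IsUnitNormal (n : ℕ) (m : ℝ) (P : Set (Coord n)) (η : Coord n → Coord n) : Prop where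
  smooth : ∃ U, IsOpen U ∧ P ⊆ U ∧ ContDiffOn ℝ ∞ η U
  unit : ∀ p ∈ P, metric n m p (η p) (η p) = 1
  normal : ∀ p ∈ P, ∀ v ∈ tangentVectors P p, metric n m p (η p) v = 0

/-- The second fundamental form `h(X, Y) = g(∇_X η, Y)` of `P` with respect to `η` equals `lam`
times the induced metric, for the constant `lam`. -/
def IsUmbilicWithFactor (n : ℕ) (m : ℝ) (P : Set (Coord n)) (η : Coord n → Coord n)
    (lam : ℝ) : Prop :=
  ∀ p ∈ P, ∀ X ∈ tangentVectors P p, ∀ Y ∈ tangentVectors P p,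
    covDeriv n m η p X Y = lam * metric n m p X Y

/-- `P` is totally umbilic with constant umbilicity factor `lam` with respect to the outward
(`dr(η) > 0`) unit normal. -/
def HasOutwardUmbilicityFactor (n : ℕ) (m : ℝ) (P : Set (Coord n)) (lam : ℝ) : Prop :=
  ∃ η, IsUnitNormal n m P η ∧ (∀ p ∈ P, 0 < dr p (η p)) ∧ IsUmbilicWithFactor n m P η lam

/-- `P` is totally geodesic: its second fundamental form vanishes. -/
def IsTotallyGeodesic (n : ℕ) (m : ℝ) (P : Set (Coord n)) : Prop :=
  ∃ η, IsUnitNormal n m P η ∧ IsUmbilicWithFactor n m P η 0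

/-- `P` is connected and each non-empty time-slice of it is a full centered round sphere. -/
def IsSphericallySymmetric (n : ℕ) (m : ℝ) (P : Set (Coord n)) : Prop :=
  IsConnected P ∧ ∀ t₀ : ℝ, (∃ x, (t₀, x) ∈ P) →
    ∃ r₀, horizonRadius n m < r₀ ∧ {x | (t₀, x) ∈ P} = Metric.sphere 0 r₀

/-- The centered vertical hyperplane `{(t, x) : x · u = 0}` in the Schwarzschild spacetime. -/
def centeredVerticalHyperplane (n : ℕ) (m : ℝ) (u : EuclideanSpace ℝ (Fin n)) :
    Set (Coord n) :=
  {p | p ∈ spacetime n m ∧ inner ℝ p.2 u = 0}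

/-- `P` is the cylinder `{r = r_*}` over a radius at which `f'(r_*) r_* = 2 f(r_*)`, and
`lam = √f(r_*) / r_*`. -/
def IsPhotonCylinder (n : ℕ) (m : ℝ) (P : Set (Coord n)) (lam : ℝ) : Prop :=
  ∃ r, horizonRadius n m < r ∧ deriv (lapseSq n m) r * r = 2 * lapseSq n m r ∧
    lam = √(lapseSq n m r) / r ∧ P = {p | ‖p.2‖ = r}

/-- `P` is `{(t, x) : t ∈ J, |x| = ρ(t)}` for a smooth, non-constant solution `ρ` on an open
interval `J` of the photon surface equation `(dρ/dt)² = f(ρ)² (lam² ρ² - f(ρ)) / (lam² ρ²)`. -/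
def IsPhotonProfileSurface (n : ℕ) (m : ℝ) (P : Set (Coord n)) (lam : ℝ) : Prop :=
  ∃ (J : Set ℝ) (ρ : ℝ → ℝ), IsOpen J ∧ J.OrdConnected ∧ ContDiffOn ℝ ∞ ρ J ∧
    (∀ t ∈ J, horizonRadius n m < ρ t) ∧ (∃ t₁ ∈ J, ∃ t₂ ∈ J, ρ t₁ ≠ ρ t₂) ∧
    (∀ t ∈ J, deriv ρ t ^ 2 =
      lapseSq n m (ρ t) ^ 2 * (lam ^ 2 * ρ t ^ 2 - lapseSq n m (ρ t)) / (lam ^ 2 * ρ t ^ 2)) ∧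
    P = {p | p.1 ∈ J ∧ ‖p.2‖ = ρ p.1}

end

end SchwarzschildPhoton

open SchwarzschildPhoton

/-! Null totally geodesic means that the second fundamental form vanishes on null vectors
(`IsPhotonSurface.hessian_null`), and null geodesics are conformally invariant up to
parametrization. In isotropic coordinates Schwarzschild is conformal to `-N² dt² + |dy|²` with a
radial function `N`, so a photon surface may be studied through its time-slices in Euclidean space.
Each slice has a unit normal `ν` and a normal speed `c`. Testing the second fundamental form on the
null vectors `(1, cν ± ℓw)` shows that the slices are umbilic and determines all tangential
derivatives of `ν` (`IsNullGeodesicAt.fderiv_sliceNormal`).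

Equality of the mixed second derivatives of `ν` along the surface is a Codazzi equation. It yields
`c · Hess N(w, z) = 0` for orthogonal `w`, `z` tangent to the slice, and `Hess N(w, ν) = 0` where
the surface is static (`hessian_conditions`). The Hessian of `N` is a multiple of the identity plus
a nonzero multiple of `y ⊗ y`, because `m > 0`. As slices have dimension at least two, at every
point either `ν` is radial, or the surface is static with `ν` orthogonal to the position
(`radial_or_static`). The two cases exclude each other and each is an open condition along the
surface, so one of them holds on all of a connected surface.

In the static case the second fundamental form vanishes, `ν` is locally constant, and the surface
lies in a hyperplane through the center (`IsPhotonSurface.subset_hyperplane`). In the radial case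
the surface is locally `r = ρ(t)`. The null geodesics inside it share one squared impact parameter
`Λ`, because its derivative vanishes on null tangent vectors, hence on all tangent vectors
(`IsPhotonSurface.fderiv_levelSlope`). Thus `r` and `dr/dt` obey the ODE of a null profile, and
uniqueness places the surface inside the surface of a profile existing for all times
(`exists_isNullProfile`, `IsPhotonSurface.subset_profileSurface`), with `λ = Λ^(-1/2)`.

Conversely, a null geodesic tangent to a model surface satisfies the same ODE as the surface: `⟪u,
x⟫` solves a linear homogeneous equation for a hyperplane, and conservation of energy and angular
momentum turns `r` as a function of `t` into a null profile for the spherically symmetric models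
(`IsNullProfile.isPhotonSurface`). ODE uniqueness keeps the geodesic in the surface. -/

open scoped ContDiff Topology
open SchwarzschildPhoton

/-! ### Regular zero sets: straightening, tangential derivatives, Grönwall uniqueness. -/

section General

open Set Filter

variable {E : Type*} [NormedAddCommGroup E] [NormedSpace ℝ E]
variable {V : Type*} [NormedAddCommGroup V] [NormedSpace ℝ V]

/-- A smooth chart that straightens the zero set of `F` near a regular point. -/
theorem exists_straightening [CompleteSpace E] {F : E → ℝ} {p : E} (hF : ContDiffAt ℝ ∞ F p)
    (h0 : F p = 0) (hreg : fderiv ℝ F p ≠ 0) :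
    ∃ φ ψ : E → E, φ 0 = p ∧ ψ p = 0 ∧ ContDiffAt ℝ ∞ φ 0 ∧ ContDiffAt ℝ ∞ ψ p ∧
      HasFDerivAt φ (ContinuousLinearMap.id ℝ E) 0 ∧
      HasFDerivAt ψ (ContinuousLinearMap.id ℝ E) p ∧
      (∀ᶠ q in 𝓝 p, φ (ψ q) = q) ∧ (∀ᶠ z in 𝓝 0, ψ (φ z) = z) ∧
      (∀ q, fderiv ℝ F p (ψ q) = F q) := by
  obtain ⟨e, he⟩ : ∃ e, fderiv ℝ F p e = 1 := by
    obtain ⟨v, hv⟩ : ∃ v, fderiv ℝ F p v ≠ 0 := by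
      by_contra! h
      exact hreg (ContinuousLinearMap.ext h)
    exact ⟨(fderiv ℝ F p v)⁻¹ • v, by simp [hv]⟩
  set L := fderiv ℝ F p with hL
  -- The affine chart is corrected in the transversal direction `e` so that `L ∘ ψ = F` holds
  -- exactly, while the differential at `p` remains the identity.
  let ψ : E → E := fun q => q - p + (F q - L (q - p)) • e
  have hψc : ContDiffAt ℝ ∞ ψ p := by
    have : ContDiffAt ℝ ∞ (fun q => L (q - p)) p :=
      L.contDiff.contDiffAt.comp p (contDiffAt_id.sub contDiffAt_const)
    exact (contDiffAt_id.sub contDiffAt_const).add ((hF.sub this).smul contDiffAt_const)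
  have hψd : HasFDerivAt ψ ((ContinuousLinearEquiv.refl ℝ E : E ≃L[ℝ] E) : E →L[ℝ] E) p := by
    have h1 : HasFDerivAt F L p := (hF.differentiableAt (by simp)).hasFDerivAt
    have h2 : HasFDerivAt (fun q => q - p) (ContinuousLinearMap.id ℝ E) p :=
      (hasFDerivAt_id p).sub_const p
    have h3 : HasFDerivAt (fun q => L (q - p)) (L.comp (ContinuousLinearMap.id ℝ E)) p :=
      L.hasFDerivAt.comp p h2
    have h4 := h2.add ((h1.sub h3).smul_const e)
    refine h4.congr_fderiv ?_
    ext v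
    simp
  have hψ0 : ψ p = 0 := by simp [ψ, h0]
  have hn : (∞ : WithTop ℕ∞) ≠ 0 := by simp
  let Ψ := hψc.toOpenPartialHomeomorph ψ hψd hn
  have hΨ : (Ψ : E → E) = ψ := rfl
  have hps : p ∈ Ψ.source := hψc.mem_toOpenPartialHomeomorph_source hψd hn
  have h0t : (0 : E) ∈ Ψ.target := by
    have := hψc.image_mem_toOpenPartialHomeomorph_target hψd hn
    rwa [hψ0] at this
  have hφ0 : Ψ.symm 0 = p := by
    have := Ψ.left_inv hps
    rwa [hΨ, hψ0] at this
  refine ⟨Ψ.symm, ψ, hφ0, hψ0, ?_, hψc, ?_, hψd, ?_, ?_, ?_⟩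
  · refine Ψ.contDiffAt_symm h0t (f₀' := ContinuousLinearEquiv.refl ℝ E) ?_ ?_
    · rw [hφ0]; exact hψd
    · rw [hφ0]; exact hψc
  · have := Ψ.hasFDerivAt_symm (f' := ContinuousLinearEquiv.refl ℝ E) h0t
      (by rw [hφ0]; exact hψd)
    exact this
  · filter_upwards [Ψ.open_source.mem_nhds hps] with q hq using Ψ.left_inv hq
  · filter_upwards [Ψ.open_target.mem_nhds h0t] with z hz using Ψ.right_inv hz
  · intro q
    simp [ψ, he]

/-- A function that vanishes on the regular zero set of `F` has vanishing derivatives in the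
tangent directions. -/
theorem fderiv_eq_zero_of_vanishing [CompleteSpace E] {F : E → ℝ} {p : E}
    (hF : ContDiffAt ℝ ∞ F p) (h0 : F p = 0) (hreg : fderiv ℝ F p ≠ 0) {G : E → V}
    (hG : DifferentiableAt ℝ G p) (hGF : ∀ᶠ q in 𝓝 p, F q = 0 → G q = 0) {v : E}
    (hv : fderiv ℝ F p v = 0) : fderiv ℝ G p v = 0 := by
  obtain ⟨φ, ψ, hφ0, -, hφ, -, hφd, -, -, hψφ, hL⟩ := exists_straightening hF h0 hreg
  have hline : HasDerivAt (fun s : ℝ => s • v) v 0 := by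
    simpa using (hasDerivAt_id (0 : ℝ)).smul_const v
  have h1 : HasDerivAt (fun s : ℝ => φ (s • v)) v 0 := by
    have : HasFDerivAt φ (ContinuousLinearMap.id ℝ E) ((0 : ℝ) • v) := by simpa using hφd
    simpa [Function.comp_def] using this.comp_hasDerivAt (0 : ℝ) hline
  have h2 : HasDerivAt (fun s : ℝ => G (φ (s • v))) (fderiv ℝ G p v) 0 := by
    have : HasFDerivAt G (fderiv ℝ G p) (φ ((0 : ℝ) • v)) := by
      simpa [hφ0] using hG.hasFDerivAt
    exact this.comp_hasDerivAt (0 : ℝ) h1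
  have hc : Tendsto (fun s : ℝ => s • v) (𝓝 0) (𝓝 0) := by
    simpa using hline.continuousAt.tendsto
  have hc2 : Tendsto φ (𝓝 0) (𝓝 p) := by simpa [hφ0] using hφ.continuousAt.tendsto
  have h3 : (fun s : ℝ => G (φ (s • v))) =ᶠ[𝓝 0] fun _ => 0 := by
    filter_upwards [hc.eventually hψφ, hc.eventually (hc2.eventually hGF)] with s hs1 hs2
    apply hs2
    rw [← hL, hs1, map_smul, hv, smul_zero]
  exact (h2.congr_of_eventuallyEq h3.symm).unique (hasDerivAt_const _ _)

/-- A differential inequality `‖DG(v)‖ ≤ C ‖v‖ ‖G‖` in the tangent directions of the regular zero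
set of `F` forces `G` to vanish on it near a zero. -/
theorem eventually_eq_zero_of_fderiv_le [CompleteSpace E] {F : E → ℝ} {p : E}
    (hF : ContDiffAt ℝ ∞ F p) (h0 : F p = 0) (hreg : fderiv ℝ F p ≠ 0) {G : E → V}
    (hG : ∀ᶠ q in 𝓝 p, DifferentiableAt ℝ G q) {C : ℝ} (hC : 0 ≤ C)
    (hGF : ∀ᶠ q in 𝓝 p, F q = 0 → ∀ v, fderiv ℝ F q v = 0 → ‖fderiv ℝ G q v‖ ≤ C * ‖v‖ * ‖G q‖)
    (hG0 : G p = 0) : ∀ᶠ q in 𝓝 p, F q = 0 → G q = 0 := by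
  obtain ⟨φ, ψ, hφ0, hψ0, hφ, hψ, hφd, -, hφψ, hψφ, hL⟩ := exists_straightening hF h0 hreg
  have hc2 : Tendsto φ (𝓝 0) (𝓝 p) := by simpa [hφ0] using hφ.continuousAt.tendsto
  have hc3 : Tendsto ψ (𝓝 p) (𝓝 0) := by simpa [hψ0] using hψ.continuousAt.tendsto
  have hφdiff : ∀ᶠ z in 𝓝 (0 : E), DifferentiableAt ℝ φ z := by
    filter_upwards [(hφ.of_le (m := 1) (by simp)).eventually (by simp)] with z hz
    exact hz.differentiableAt (by simp)
  have hFdiff : ∀ᶠ q in 𝓝 p, DifferentiableAt ℝ F q := by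
    filter_upwards [(hF.of_le (m := 1) (by simp)).eventually (by simp)] with z hz
    exact hz.differentiableAt (by simp)
  have hbd : ∀ᶠ z in 𝓝 (0 : E), ‖fderiv ℝ φ z‖ ≤ 2 := by
    have hcont : ContinuousAt (fun z => ‖fderiv ℝ φ z‖) 0 :=
      (hφ.continuousAt_fderiv (by simp)).norm
    have : ‖fderiv ℝ φ 0‖ < 2 := by
      rw [hφd.fderiv]
      exact lt_of_le_of_lt ContinuousLinearMap.norm_id_le (by norm_num)
    filter_upwards [hcont.eventually_lt continuousAt_const this] with z hz using hz.le
  have hall := ((hψφ.eventually_nhds).and (hφdiff.and (hbd.and (hc2.eventually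
    (hG.and (hFdiff.and hGF))))))
  obtain ⟨ε, hε, hball⟩ := Metric.eventually_nhds_iff_ball.1 hall
  filter_upwards [hφψ, hc3.eventually (Metric.ball_mem_nhds 0 hε)] with q hq1 hq2 hFq
  set z := ψ q with hz
  have hLz : fderiv ℝ F p z = 0 := by rw [hL, hFq]
  have hsz : ∀ s ∈ Icc (0 : ℝ) 1, s • z ∈ Metric.ball (0 : E) ε := by
    intro s hs
    rw [mem_ball_zero_iff, norm_smul, Real.norm_of_nonneg hs.1]
    rw [dist_zero_right] at hq2
    nlinarith [hs.2, norm_nonneg z]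
  have hder : ∀ s ∈ Icc (0 : ℝ) 1, HasDerivAt (fun s : ℝ => G (φ (s • z)))
      (fderiv ℝ G (φ (s • z)) (fderiv ℝ φ (s • z) z)) s ∧
      fderiv ℝ F (φ (s • z)) (fderiv ℝ φ (s • z) z) = 0 := by
    intro s hs
    obtain ⟨e1, e2, e3, e4, e5, e6⟩ := hball _ (hsz s hs)
    have hline : HasDerivAt (fun s : ℝ => s • z) z s := by
      simpa using (hasDerivAt_id s).smul_const z
    have h1 := e2.hasFDerivAt.comp_hasDerivAt s hline
    refine ⟨e4.hasFDerivAt.comp_hasDerivAt s h1, ?_⟩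
    have h2 := e5.hasFDerivAt.comp_hasDerivAt s h1
    have hlin : Tendsto (fun s : ℝ => s • z) (𝓝 s) (𝓝 (s • z)) := hline.continuousAt.tendsto
    have h3 : (F ∘ φ ∘ fun s : ℝ => s • z) =ᶠ[𝓝 s] fun _ => 0 := by
      filter_upwards [hlin.eventually e1] with u hu
      rw [Function.comp_apply, Function.comp_apply, ← hL, hu, map_smul, hLz, smul_zero]
    exact (h2.congr_of_eventuallyEq h3.symm).unique (hasDerivAt_const _ _)
  -- Grönwall along the image under `φ` of the segment from `0` to `z`, which lies in the zero set
  -- because `z` lies in the kernel of `L`. The factor `2` bounds `‖Dφ‖` near `0`, where `Dφ` is the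
  -- identity.
  have key := eq_zero_of_abs_deriv_le_mul_abs_self_of_eq_zero_right
    (f := fun s : ℝ => G (φ (s • z)))
    (f' := fun s => fderiv ℝ G (φ (s • z)) (fderiv ℝ φ (s • z) z)) (K := C * (2 * ‖z‖))
    (a := 0) (b := 1)
    (fun s hs => (hder s hs).1.continuousAt.continuousWithinAt)
    (fun s hs => (hder s ⟨hs.1, hs.2.le⟩).1.hasDerivWithinAt)
    (by simp [hφ0, hG0]) ?_ 1 (by simp)
  · simpa [hq1] using key
  · intro s hs
    have hs' : s ∈ Icc (0 : ℝ) 1 := ⟨hs.1, hs.2.le⟩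
    obtain ⟨e1, e2, e3, e4, e5, e6⟩ := hball _ (hsz s hs')
    have hF0 : F (φ (s • z)) = 0 := by
      rw [← hL, e1.self_of_nhds, map_smul, hLz, smul_zero]
    refine (e6 hF0 _ (hder s hs').2).trans ?_
    have : ‖fderiv ℝ φ (s • z) z‖ ≤ 2 * ‖z‖ :=
      (ContinuousLinearMap.le_opNorm _ _).trans (by gcongr)
    gcongr

/-- A function with vanishing tangential derivatives is locally constant on the regular zero set
of `F`. -/
theorem eventually_eq_of_fderiv_eq_zero [CompleteSpace E] {F : E → ℝ} {p : E}
    (hF : ContDiffAt ℝ ∞ F p) (h0 : F p = 0) (hreg : fderiv ℝ F p ≠ 0) {G : E → V}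
    (hG : ∀ᶠ q in 𝓝 p, DifferentiableAt ℝ G q)
    (hGF : ∀ᶠ q in 𝓝 p, F q = 0 → ∀ v, fderiv ℝ F q v = 0 → fderiv ℝ G q v = 0) :
    ∀ᶠ q in 𝓝 p, F q = 0 → G q = G p := by
  have := eventually_eq_zero_of_fderiv_le hF h0 hreg (G := fun q => G q - G p) (C := 0)
    (hG.mono fun q hq => hq.sub_const _) le_rfl
    (hGF.mono fun q hq hFq v hv => by rw [fderiv_sub_const, hq hFq v hv]; simp) (by simp)
  exact this.mono fun q hq hFq => sub_eq_zero.1 (hq hFq)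

/-- Uniqueness for linear differential inequalities: a solution of `‖f'‖ ≤ C ‖f‖` that vanishes at
a point vanishes nearby. -/
theorem eventually_eq_zero_of_norm_deriv_le {f f' : ℝ → V} {t C : ℝ}
    (hf : ∀ᶠ s in 𝓝 t, HasDerivAt f (f' s) s) (hle : ∀ᶠ s in 𝓝 t, ‖f' s‖ ≤ C * ‖f s‖)
    (h0 : f t = 0) : ∀ᶠ s in 𝓝 t, f s = 0 := by
  obtain ⟨ε, hε, hball⟩ := Metric.eventually_nhds_iff_ball.1 (hf.and hle)
  -- The one-sided Grönwall estimate on `[0, c]`; it is applied below to `u ↦ f (t - u)` and to `u ↦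
  -- f (t + u)`.
  have hgen : ∀ (g g' : ℝ → V) (c : ℝ), 0 < c → c < ε → (∀ s ∈ Icc 0 c, HasDerivAt g (g' s) s) →
      (∀ s ∈ Icc 0 c, ‖g' s‖ ≤ C * ‖g s‖) → g 0 = 0 → g c = 0 := by
    intro g g' c hc hcε hg hgle hg0
    exact eq_zero_of_abs_deriv_le_mul_abs_self_of_eq_zero_right (a := 0) (b := c) (f' := g')
      (fun s hs => (hg s hs).continuousAt.continuousWithinAt)
      (fun s hs => (hg s ⟨hs.1, hs.2.le⟩).hasDerivWithinAt) hg0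
      (fun s hs => hgle s ⟨hs.1, hs.2.le⟩) c ⟨hc.le, le_rfl⟩
  filter_upwards [Metric.ball_mem_nhds t hε] with s hs
  rw [Metric.mem_ball, Real.dist_eq] at hs
  rcases lt_trichotomy s t with h | h | h
  · rw [abs_of_neg (by linarith)] at hs
    have := hgen (fun u => f (t - u)) (fun u => -f' (t - u)) (t - s) (by linarith) (by linarith)
      (fun u hu => by
        have hm : t - u ∈ Metric.ball t ε := by
          rw [Metric.mem_ball, Real.dist_eq, abs_of_nonpos (by linarith [hu.1])]
          linarith [hu.2]
        have := (hball _ hm).1.scomp u ((hasDerivAt_id u).const_sub t)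
        simpa [Function.comp_def] using this)
      (fun u hu => by
        have hm : t - u ∈ Metric.ball t ε := by
          rw [Metric.mem_ball, Real.dist_eq, abs_of_nonpos (by linarith [hu.1])]
          linarith [hu.2]
        simpa using (hball _ hm).2)
      (by simpa using h0)
    simpa using this
  · rw [h, h0]
  · rw [abs_of_pos (by linarith)] at hs
    have := hgen (fun u => f (t + u)) (fun u => f' (t + u)) (s - t) (by linarith) (by linarith)
      (fun u hu => by
        have hm : t + u ∈ Metric.ball t ε := by
          rw [Metric.mem_ball, Real.dist_eq, abs_of_nonneg (by linarith [hu.1])]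
          linarith [hu.2]
        have := (hball _ hm).1.scomp u ((hasDerivAt_id u).const_add t)
        simpa [Function.comp_def] using this)
      (fun u hu => by
        have hm : t + u ∈ Metric.ball t ε := by
          rw [Metric.mem_ball, Real.dist_eq, abs_of_nonneg (by linarith [hu.1])]
          linarith [hu.2]
        simpa using (hball _ hm).2)
      (by simpa using h0)
    simpa using this

/-- Two regular zero sets, one of them contained in the other, agree locally. -/
theorem eventually_zero_of_subset [CompleteSpace E] {F G : E → ℝ} {p : E}
    (hF : ContDiffAt ℝ ∞ F p) (hF0 : F p = 0) (hFreg : fderiv ℝ F p ≠ 0)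
    (hG : ContDiffAt ℝ ∞ G p) (hG0 : G p = 0) (hGreg : fderiv ℝ G p ≠ 0)
    (hFG : ∀ᶠ q in 𝓝 p, F q = 0 → G q = 0) :
    (∀ v, fderiv ℝ F p v = 0 ↔ fderiv ℝ G p v = 0) ∧ ∀ᶠ q in 𝓝 p, G q = 0 → F q = 0 := by
  have hker : ∀ v, fderiv ℝ F p v = 0 → fderiv ℝ G p v = 0 := fun v hv =>
    fderiv_eq_zero_of_vanishing hF hF0 hFreg (hG.differentiableAt (by simp)) hFG hv
  obtain ⟨e, he⟩ : ∃ e, fderiv ℝ F p e = 1 := by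
    obtain ⟨v, hv⟩ : ∃ v, fderiv ℝ F p v ≠ 0 := by
      by_contra! h
      exact hFreg (ContinuousLinearMap.ext h)
    exact ⟨(fderiv ℝ F p v)⁻¹ • v, by simp [hv]⟩
  have hGe : ∀ v, fderiv ℝ G p v = fderiv ℝ F p v * fderiv ℝ G p e := by
    intro v
    have := hker (v - fderiv ℝ F p v • e) (by simp [he])
    rw [map_sub, map_smul, smul_eq_mul, sub_eq_zero] at this
    exact this
  have hGe0 : fderiv ℝ G p e ≠ 0 := by
    intro h
    exact hGreg (ContinuousLinearMap.ext fun v => by rw [hGe, h]; simp)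
  have hker' : ∀ v, fderiv ℝ F p v = 0 ↔ fderiv ℝ G p v = 0 := by
    intro v
    rw [hGe v, mul_eq_zero, or_iff_left hGe0]
  refine ⟨hker', ?_⟩
  obtain ⟨φ, ψ, hφ0, hψ0, hφ, hψ, hφd, hψd, hφψ, hψφ, hL⟩ := exists_straightening hF hF0 hFreg
  obtain ⟨φ', ψ', hφ0', hψ0', hφ', hψ', hφd', hψd', hφψ', hψφ', hL'⟩ :=
    exists_straightening hG hG0 hGreg
  set L := fderiv ℝ F p
  have hc : Tendsto φ (𝓝 0) (𝓝 p) := by simpa [hφ0] using hφ.continuousAt.tendsto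
  have hc' : Tendsto ψ' (𝓝 p) (𝓝 0) := by simpa [hψ0'] using hψ'.continuousAt.tendsto
  -- The change of charts `ψ' ∘ φ` maps the part of `ker L` near `0` into itself. Correcting it
  -- along `e` makes `L ∘ Θ = L`, leaves it unchanged on `ker L`, and gives differential the
  -- identity. So `Θ` is locally onto, and since it preserves `L`, it maps `ker L` onto `ker L` near
  -- `0`: every zero of `G` near `p` comes from a zero of `F`.
  let Θ : E → E := fun z => ψ' (φ z) + (L z - L (ψ' (φ z))) • e
  have hΘ0 : Θ 0 = 0 := by simp [Θ, hφ0, hψ0']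
  have hstr : HasStrictFDerivAt Θ (ContinuousLinearMap.id ℝ E) 0 := by
    have h1 : HasStrictFDerivAt φ (ContinuousLinearMap.id ℝ E) 0 :=
      hφ.hasStrictFDerivAt' hφd (by simp)
    have h2 : HasStrictFDerivAt ψ' (ContinuousLinearMap.id ℝ E) (φ 0) := by
      rw [hφ0]; exact hψ'.hasStrictFDerivAt' hψd' (by simp)
    have h3 := h2.comp 0 h1
    have h4 := h3.add ((L.hasStrictFDerivAt.sub (L.hasStrictFDerivAt.comp 0 h3)).smul_const e)
    refine h4.congr_fderiv ?_
    ext v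
    simp
  have hmap := hstr.map_nhds_eq_of_surj (by
    rw [LinearMap.range_eq_top]; intro v; exact ⟨v, rfl⟩)
  rw [hΘ0] at hmap
  have hgood : ∀ᶠ z in 𝓝 (0 : E), ψ (φ z) = z ∧ φ' (ψ' (φ z)) = φ z ∧
      (F (φ z) = 0 → G (φ z) = 0) :=
    hψφ.and ((hc.eventually hφψ').and (hc.eventually hFG))
  have himg : ∀ᶠ w in 𝓝 (0 : E), ∃ z, Θ z = w ∧ ψ (φ z) = z ∧ φ' (ψ' (φ z)) = φ z ∧
      (F (φ z) = 0 → G (φ z) = 0) := by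
    rw [← hmap, eventually_map]
    exact hgood.mono fun z hz => ⟨z, rfl, hz⟩
  filter_upwards [hφψ', hc'.eventually himg] with q hq1 ⟨z, hz, hz1, hz2, hz3⟩ hGq
  have hLw : L (ψ' q) = 0 := by rw [hker', hL', hGq]
  have hLz : L z = 0 := by
    have : L (Θ z) = L z := by simp [Θ, he]
    rw [← this, hz, hLw]
  have hFz : F (φ z) = 0 := by rw [← hL, hz1, hLz]
  have hGz : L (ψ' (φ z)) = 0 := by rw [hker', hL', hz3 hFz]
  have hψq : ψ' (φ z) = ψ' q := by rw [← hz]; simp [Θ, hLz, hGz]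
  rw [← hq1, ← hψq, hz2, hFz]

end General

namespace SchwarzschildPhoton

/-! ### Tangent spaces of embedded hypersurfaces and restriction of photon surfaces. -/

section Hypersurface

open Filter

variable {n : ℕ} {m : ℝ} {P Q : Set (Coord n)} {p : Coord n} {U : Set (Coord n)} {F : Coord n → ℝ}

theorem IsLocalDefiningFunction.at_mem (h : IsLocalDefiningFunction P p U F) {q : Coord n}
    (hq : q ∈ U) : IsLocalDefiningFunction P q U F :=
  ⟨h.isOpen, hq, h.smooth, h.regular, h.zero_iff⟩

theorem IsLocalDefiningFunction.contDiffAt (h : IsLocalDefiningFunction P p U F) :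
    ContDiffAt ℝ ∞ F p :=
  h.smooth.contDiffAt (h.isOpen.mem_nhds h.mem)

theorem IsLocalDefiningFunction.mem_nhds (h : IsLocalDefiningFunction P p U F) : U ∈ 𝓝 p :=
  h.isOpen.mem_nhds h.mem

theorem IsLocalDefiningFunction.eq_zero (h : IsLocalDefiningFunction P p U F) (hp : p ∈ P) :
    F p = 0 :=
  (h.zero_iff p h.mem).1 hp

theorem IsLocalDefiningFunction.eventually_iff (h : IsLocalDefiningFunction P p U F) :
    ∀ᶠ q in 𝓝 p, (q ∈ P ↔ F q = 0) := by
  filter_upwards [h.mem_nhds] with q hq using h.zero_iff q hq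

/-- Nested hypersurfaces have the same tangent vectors and agree locally. -/
theorem IsLocalDefiningFunction.of_subset {W : Set (Coord n)} {G : Coord n → ℝ}
    (hF : IsLocalDefiningFunction P p U F) (hG : IsLocalDefiningFunction Q p W G) (hp : p ∈ P)
    (hPQ : P ⊆ Q) :
    (∀ v, fderiv ℝ F p v = 0 ↔ fderiv ℝ G p v = 0) ∧ ∀ᶠ q in 𝓝 p, q ∈ Q → q ∈ P := by
  have := eventually_zero_of_subset hF.contDiffAt (hF.eq_zero hp) (hF.regular p hF.mem)
    hG.contDiffAt (hG.eq_zero (hPQ hp)) (hG.regular p hG.mem) (by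
      filter_upwards [hF.eventually_iff, hG.eventually_iff] with q h1 h2 h3
      exact h2.1 (hPQ (h1.2 h3)))
  refine ⟨this.1, ?_⟩
  filter_upwards [this.2, hF.eventually_iff, hG.eventually_iff] with q h1 h2 h3 h4
  exact h2.2 (h1 (h3.1 h4))

/-- The tangent space does not depend on the local defining function. -/
theorem IsLocalDefiningFunction.mem_tangentVectors_iff (h : IsLocalDefiningFunction P p U F)
    (hp : p ∈ P) {v : Coord n} : v ∈ tangentVectors P p ↔ fderiv ℝ F p v = 0 := by
  constructor
  · rintro ⟨W, G, hG, hv⟩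
    exact ((h.of_subset hG hp subset_rfl).1 v).2 hv
  · exact fun hv => ⟨U, F, h, hv⟩

/-- A curve in a hypersurface is tangent to it. -/
theorem IsLocalDefiningFunction.deriv_mem_tangentVectors (h : IsLocalDefiningFunction P p U F)
    {γ : ℝ → Coord n} {τ : ℝ} (hτ : γ τ = p) (hd : DifferentiableAt ℝ γ τ)
    (hP : ∀ᶠ s in 𝓝 τ, γ s ∈ P) : fderiv ℝ F p (deriv γ τ) = 0 := by
  have hF : HasFDerivAt F (fderiv ℝ F p) (γ τ) := by
    rw [hτ]; exact (h.contDiffAt.differentiableAt (by simp)).hasFDerivAt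
  have h1 := hF.comp_hasDerivAt τ hd.hasDerivAt
  have h2 : (F ∘ γ) =ᶠ[𝓝 τ] fun _ => 0 := by
    have hc : Tendsto γ (𝓝 τ) (𝓝 p) := by rw [← hτ]; exact hd.continuousAt
    filter_upwards [hP, hc.eventually h.eventually_iff] with s hs1 hs2 using hs2.1 hs1
  exact (h1.congr_of_eventuallyEq h2.symm).unique (hasDerivAt_const _ _)

/-- For null total geodesy it suffices that tangent null geodesics stay in the hypersurface. -/
theorem IsTimelikeHypersurface.isPhotonSurface (h : IsTimelikeHypersurface n m P)
    (hg : ∀ (I : Set ℝ) (γ : ℝ → Coord n), IsNullGeodesic n m I γ → ∀ τ₀ ∈ I, γ τ₀ ∈ P →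
      deriv γ τ₀ ∈ tangentVectors P (γ τ₀) → ∀ᶠ τ in 𝓝 τ₀, γ τ ∈ P) :
    IsPhotonSurface n m P := by
  refine ⟨h, fun I γ hγ τ₀ hτ₀ hp hv => ?_⟩
  have h1 := hg I γ hγ τ₀ hτ₀ hp hv
  filter_upwards [h1, h1.eventually_nhds, hγ.isOpen.mem_nhds hτ₀] with τ h2 h3 h4
  refine ⟨h2, ?_⟩
  obtain ⟨U, F, hF⟩ := h.embedded _ h2
  exact ⟨U, F, hF, hF.deriv_mem_tangentVectors rfl
    ((hγ.smooth.contDiffAt (hγ.isOpen.mem_nhds h4)).differentiableAt (by simp)) h3⟩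

/-- A timelike hypersurface that is part of a photon surface is a photon surface. -/
theorem IsPhotonSurface.of_subset (hP : IsTimelikeHypersurface n m P)
    (hQ : IsPhotonSurface n m Q) (hPQ : P ⊆ Q) : IsPhotonSurface n m P := by
  refine hP.isPhotonSurface fun I γ hγ τ₀ hτ₀ hp hv => ?_
  obtain ⟨U, F, hF⟩ := hP.embedded _ hp
  obtain ⟨W, G, hG⟩ := hQ.embedded _ (hPQ hp)
  obtain ⟨h1, h2⟩ := hF.of_subset hG hp hPQ
  have hv' : deriv γ τ₀ ∈ tangentVectors Q (γ τ₀) :=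
    ⟨W, G, hG, (h1 _).1 ((hF.mem_tangentVectors_iff hp).1 hv)⟩
  have hc : ContinuousAt γ τ₀ :=
    (hγ.smooth.contDiffAt (hγ.isOpen.mem_nhds hτ₀)).continuousAt
  -- The geodesic stays in `Q`, and `Q` coincides with `P` near the base point.
  filter_upwards [hQ.nullTotallyGeodesic I γ hγ τ₀ hτ₀ (hPQ hp) hv', hc.eventually h2]
    with τ h3 h4 using h4 h3.1

end Hypersurface

end SchwarzschildPhoton

namespace SchwarzschildPhoton

/-! ### The metric in Cartesian form, its Christoffel symbols and the geodesic equation. -/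

section Metric

open Filter
open scoped RealInnerProductSpace

variable {n : ℕ} {m : ℝ}

theorem horizonRadius_pos (hm : 0 < m) : 0 < horizonRadius n m := by
  unfold horizonRadius
  positivity

theorem lapseSq_horizonRadius (hn : 3 ≤ n) (hm : 0 < m) :
    lapseSq n m (horizonRadius n m) = 0 := by
  have h : horizonRadius n m ^ (n - 2) = 2 * m := by
    unfold horizonRadius
    have hc : ((n : ℝ) - 2) = ((n - 2 : ℕ) : ℝ) := by
      rw [Nat.cast_sub (by omega)]; norm_num
    rw [hc, Real.rpow_inv_natCast_pow (by positivity) (by omega)]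
  rw [lapseSq, h, div_self (by positivity), sub_self]

theorem lapseSq_strictMonoOn (hn : 3 ≤ n) (hm : 0 < m) :
    StrictMonoOn (lapseSq n m) (Set.Ioi 0) := by
  intro a ha b hb hab
  have : a ^ (n - 2) < b ^ (n - 2) := pow_lt_pow_left₀ hab (le_of_lt ha) (by omega)
  have ha' : 0 < a ^ (n - 2) := pow_pos ha _
  unfold lapseSq
  have := div_lt_div_of_pos_left (by positivity : 0 < 2 * m) ha' this
  linarith

theorem lapseSq_pos (hn : 3 ≤ n) (hm : 0 < m) {r : ℝ} (hr : horizonRadius n m < r) :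
    0 < lapseSq n m r := by
  have h := lapseSq_strictMonoOn hn hm (horizonRadius_pos hm)
    (Set.mem_Ioi.2 ((horizonRadius_pos hm).trans hr)) hr
  rwa [lapseSq_horizonRadius hn hm] at h

theorem lapseSq_lt_one (hm : 0 < m) {r : ℝ} (hr : 0 < r) : lapseSq n m r < 1 := by
  unfold lapseSq
  have : 0 < 2 * m / r ^ (n - 2) := by positivity
  linarith

/-- The derivative `f'(r) = (n - 2) (1 - f(r)) / r` of `f`. -/
noncomputable def lapseSqDeriv (n : ℕ) (m r : ℝ) : ℝ := ((n : ℝ) - 2) * (1 - lapseSq n m r) / r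

theorem hasDerivAt_lapseSq (hn : 3 ≤ n) {r : ℝ} (hr : 0 < r) :
    HasDerivAt (lapseSq n m) (lapseSqDeriv n m r) r := by
  obtain ⟨k, rfl⟩ : ∃ k, n = k + 3 := ⟨n - 3, by omega⟩
  have h := ((hasDerivAt_pow (k + 1) r).inv (by positivity)).const_mul (2 * m) |>.const_sub 1
  have hfun : lapseSq (k + 3) m = fun x => 1 - 2 * m * (x ^ (k + 1))⁻¹ := by
    ext x
    simp [lapseSq, div_eq_mul_inv]
  rw [hfun]
  refine h.congr_deriv ?_
  simp only [lapseSqDeriv, lapseSq, show k + 3 - 2 = k + 1 by omega, Nat.add_sub_cancel]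
  push_cast
  field_simp
  ring

theorem contDiffOn_lapseSq : ContDiffOn ℝ ∞ (lapseSq n m) (Set.Ioi 0) := by
  unfold lapseSq
  refine contDiffOn_const.sub (contDiffOn_const.div (contDiffOn_id.pow _) ?_)
  intro x hx
  exact pow_ne_zero _ (ne_of_gt hx)

/-- The radial coefficient `(1 / f - 1) / r²` of the metric. -/
noncomputable def radialCoeff (n : ℕ) (m r : ℝ) : ℝ := ((lapseSq n m r)⁻¹ - 1) / r ^ 2

/-- The derivative of the radial coefficient. -/
noncomputable def radialCoeffDeriv (n : ℕ) (m r : ℝ) : ℝ :=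
  -lapseSqDeriv n m r / (lapseSq n m r ^ 2 * r ^ 2) - 2 * ((lapseSq n m r)⁻¹ - 1) / r ^ 3

theorem hasDerivAt_radialCoeff (hn : 3 ≤ n) {r : ℝ} (hr : 0 < r) (hf : lapseSq n m r ≠ 0) :
    HasDerivAt (radialCoeff n m) (radialCoeffDeriv n m r) r := by
  have h := (((hasDerivAt_lapseSq (m := m) hn hr).inv hf).sub_const 1).div (hasDerivAt_pow 2 r)
    (by positivity)
  refine h.congr_deriv ?_
  simp only [radialCoeffDeriv, Pi.inv_apply]
  field_simp
  push_cast
  ring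

/-- Cartesian form without `dr`, convenient for differentiation. It needs no assumption on `p`: at
`x = 0` both `dr` and `radialCoeff` are quotients by zero and hence vanish. -/
theorem metric_eq (p v w : Coord n) :
    metric n m p v w = -lapseSq n m ‖p.2‖ * (v.1 * w.1) + ⟪v.2, w.2⟫
      + radialCoeff n m ‖p.2‖ * (⟪p.2, v.2⟫ * ⟪p.2, w.2⟫) := by
  simp only [metric, dr, radialCoeff]
  rcases eq_or_ne ‖p.2‖ 0 with h | h
  · simp [h]
  · generalize (lapseSq n m ‖p.2‖)⁻¹ = c
    field_simp
    ring

theorem isOpen_spacetime : IsOpen (spacetime n m) :=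
  isOpen_lt continuous_const continuous_snd.norm

theorem norm_pos_of_mem (hm : 0 < m) {p : Coord n} (hp : p ∈ spacetime n m) : 0 < ‖p.2‖ :=
  (horizonRadius_pos hm).trans hp

theorem hasFDerivAt_radius {p : Coord n} (hp : 0 < ‖p.2‖) :
    HasFDerivAt (fun q : Coord n => ‖q.2‖)
      (‖p.2‖⁻¹ • (innerSL ℝ p.2).comp (ContinuousLinearMap.snd ℝ ℝ (EuclideanSpace ℝ (Fin n)))) p := by
  have h1 : HasFDerivAt (fun q : Coord n => q.2)
    (ContinuousLinearMap.snd ℝ ℝ (EuclideanSpace ℝ (Fin n))) p := hasFDerivAt_snd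
  have h2 := h1.norm_sq.sqrt (by positivity)
  have h3 : (fun q : Coord n => √(‖q.2‖ ^ 2)) = fun q => ‖q.2‖ := by
    ext q; exact Real.sqrt_sq (norm_nonneg _)
  rw [h3, Real.sqrt_sq (norm_nonneg _)] at h2
  refine h2.congr_fderiv ?_
  ext v <;> simp
  field_simp

theorem hasFDerivAt_metric (hn : 3 ≤ n) (hm : 0 < m) {p : Coord n} (hp : p ∈ spacetime n m)
    (w z : Coord n) :
    HasFDerivAt (fun q => metric n m q w z)
      ((-(w.1 * z.1) * lapseSqDeriv n m ‖p.2‖ / ‖p.2‖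
          + radialCoeffDeriv n m ‖p.2‖ / ‖p.2‖ * (⟪p.2, w.2⟫ * ⟪p.2, z.2⟫)) •
          (innerSL ℝ p.2).comp (ContinuousLinearMap.snd ℝ ℝ (EuclideanSpace ℝ (Fin n)))
        + (radialCoeff n m ‖p.2‖ * ⟪p.2, z.2⟫) •
          (innerSL ℝ w.2).comp (ContinuousLinearMap.snd ℝ ℝ (EuclideanSpace ℝ (Fin n)))
        + (radialCoeff n m ‖p.2‖ * ⟪p.2, w.2⟫) •
          (innerSL ℝ z.2).comp (ContinuousLinearMap.snd ℝ ℝ (EuclideanSpace ℝ (Fin n)))) p := by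
  have hr := norm_pos_of_mem hm hp
  have hf := (lapseSq_pos hn hm hp).ne'
  have h1 := (hasDerivAt_lapseSq (m := m) hn hr).comp_hasFDerivAt p (hasFDerivAt_radius hr)
  have h2 := (hasDerivAt_radialCoeff hn hr hf).comp_hasFDerivAt p (hasFDerivAt_radius hr)
  have h3 : ∀ u : Coord n, HasFDerivAt (fun q : Coord n => ⟪q.2, u.2⟫)
      ((innerSL ℝ u.2).comp (ContinuousLinearMap.snd ℝ ℝ (EuclideanSpace ℝ (Fin n)))) p := by
    intro u
    have := ((innerSL ℝ u.2).comp
      (ContinuousLinearMap.snd ℝ ℝ (EuclideanSpace ℝ (Fin n)))).hasFDerivAt (x := p)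
    refine this.congr_of_eventuallyEq (Eventually.of_forall fun q => ?_)
    simp [real_inner_comm]
  have h4 := (((h1.neg).mul_const (w.1 * z.1)).add_const ⟪w.2, z.2⟫).add
    (h2.mul ((h3 w).mul (h3 z)))
  have hfun : (fun q => metric n m q w z) = fun q : Coord n =>
      -lapseSq n m ‖q.2‖ * (w.1 * z.1) + ⟪w.2, z.2⟫
      + radialCoeff n m ‖q.2‖ * (⟪q.2, w.2⟫ * ⟪q.2, z.2⟫) := by
    ext q; exact metric_eq q w z
  rw [hfun]
  refine h4.congr_fderiv ?_
  ext v
  · simp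
  · simp
    field_simp
    ring

theorem christoffel_eq (hn : 3 ≤ n) (hm : 0 < m) {p : Coord n} (hp : p ∈ spacetime n m)
    (v w z : Coord n) :
    christoffel n m p v w z =
      lapseSqDeriv n m ‖p.2‖ / (2 * ‖p.2‖) *
          (⟪p.2, z.2⟫ * (v.1 * w.1) - (⟪p.2, v.2⟫ * w.1 + ⟪p.2, w.2⟫ * v.1) * z.1)
        + radialCoeffDeriv n m ‖p.2‖ / (2 * ‖p.2‖) * (⟪p.2, v.2⟫ * ⟪p.2, w.2⟫ * ⟪p.2, z.2⟫)
        + radialCoeff n m ‖p.2‖ * ⟪v.2, w.2⟫ * ⟪p.2, z.2⟫ := by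
  have hr := norm_pos_of_mem hm hp
  rw [christoffel, (hasFDerivAt_metric hn hm hp w z).fderiv,
    (hasFDerivAt_metric hn hm hp v z).fderiv, (hasFDerivAt_metric hn hm hp v w).fderiv]
  simp only [add_apply, smul_apply,
    ContinuousLinearMap.comp_apply, ContinuousLinearMap.coe_snd', innerSL_apply_apply, smul_eq_mul]
  rw [real_inner_comm w.2 v.2, real_inner_comm z.2 v.2, real_inner_comm z.2 w.2]
  field_simp
  ring

/-- The coefficient of the central acceleration of a geodesic with velocity `v`. -/
noncomputable def centralCoeff (n : ℕ) (m : ℝ) (p v : Coord n) : ℝ :=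
  lapseSq n m ‖p.2‖ * (lapseSqDeriv n m ‖p.2‖ / (2 * ‖p.2‖) * v.1 ^ 2
    + radialCoeffDeriv n m ‖p.2‖ / (2 * ‖p.2‖) * ⟪p.2, v.2⟫ ^ 2
    + radialCoeff n m ‖p.2‖ * ‖v.2‖ ^ 2)

/-- The acceleration of a geodesic with velocity `v` at `p`. -/
noncomputable def geodesicSpray (n : ℕ) (m : ℝ) (p v : Coord n) : Coord n :=
  (-(lapseSqDeriv n m ‖p.2‖ / (lapseSq n m ‖p.2‖ * ‖p.2‖)) * ⟪p.2, v.2⟫ * v.1,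
    -centralCoeff n m p v • p.2)

/-- The spatial metric `|dx|² + radialCoeff ⟪x, dx⟫²` has eigenvalue `1/f` in the radial direction;
this is what inverts it in the geodesic equation. -/
theorem one_add_radialCoeff {p : Coord n} (hr : 0 < ‖p.2‖) :
    1 + radialCoeff n m ‖p.2‖ * ‖p.2‖ ^ 2 = (lapseSq n m ‖p.2‖)⁻¹ := by
  unfold radialCoeff
  field_simp
  ring

/-- Nondegeneracy of the metric solves the weak geodesic equation for the acceleration: testing with
`∂_t` gives its time component, and testing with all spatial vectors shows that its spatial part is
central. -/
theorem geodesic_iff (hn : 3 ≤ n) (hm : 0 < m) {p : Coord n} (hp : p ∈ spacetime n m)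
    (v a : Coord n) :
    (∀ z, metric n m p a z + christoffel n m p v v z = 0) ↔ a = geodesicSpray n m p v := by
  have hr := norm_pos_of_mem hm hp
  have hf := lapseSq_pos hn hm hp
  have hB := one_add_radialCoeff (m := m) hr
  simp only [christoffel_eq hn hm hp, metric_eq, real_inner_self_eq_norm_sq]
  constructor
  · intro h
    have h1 := h (1, 0)
    have h2 : ∀ y : EuclideanSpace ℝ (Fin n), ⟪a.2 + (radialCoeff n m ‖p.2‖ * ⟪p.2, a.2⟫
        + centralCoeff n m p v / lapseSq n m ‖p.2‖) • p.2, y⟫ = 0 := by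
      intro y
      have := h (0, y)
      simp only [mul_zero, zero_add] at this
      rw [inner_add_left, real_inner_smul_left, centralCoeff, mul_div_cancel_left₀ _ hf.ne']
      linear_combination this
    have h3 := ext_inner_right ℝ (fun y => by rw [h2 y, inner_zero_left] :
      ∀ y : EuclideanSpace ℝ (Fin n), ⟪_, y⟫ = ⟪(0 : EuclideanSpace ℝ (Fin n)), y⟫)
    -- The equation `h3` still contains `⟪p.2, a.2⟫` on the right; pairing it with the position
    -- vector determines this number.
    have h4 : ⟪p.2, a.2⟫ = -centralCoeff n m p v * ‖p.2‖ ^ 2 := by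
      have := congrArg (fun y => ⟪p.2, y⟫) h3
      simp only [inner_add_right, real_inner_smul_right, real_inner_self_eq_norm_sq,
        inner_zero_right] at this
      have h5 : ⟪p.2, a.2⟫ * (lapseSq n m ‖p.2‖)⁻¹
          + centralCoeff n m p v * ‖p.2‖ ^ 2 * (lapseSq n m ‖p.2‖)⁻¹ = 0 := by
        rw [← hB]
        rw [div_eq_mul_inv, ← hB] at this
        linear_combination this
      have h6 := mul_eq_zero.1 ((add_mul _ _ _).trans h5)
      rcases h6 with h6 | h6
      · linarith
      · exact absurd h6 (inv_ne_zero hf.ne')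
    ext1
    · simp only [geodesicSpray]
      simp only [inner_zero_right] at h1
      field_simp
      field_simp at h1
      linarith
    · simp only [geodesicSpray]
      rw [add_eq_zero_iff_eq_neg.1 h3, ← neg_smul]
      congr 1
      rw [h4]
      rw [div_eq_mul_inv, ← hB]
      ring
  · rintro rfl z
    simp only [geodesicSpray, real_inner_smul_left, real_inner_smul_right,
      real_inner_self_eq_norm_sq]
    have h5 : radialCoeff n m ‖p.2‖ * ‖p.2‖ ^ 2 = (lapseSq n m ‖p.2‖)⁻¹ - 1 := by
      rw [← hB]; ring
    have h6 : radialCoeff n m ‖p.2‖ * (-centralCoeff n m p v * ‖p.2‖ ^ 2 * ⟪p.2, z.2⟫)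
        = -centralCoeff n m p v * ((lapseSq n m ‖p.2‖)⁻¹ - 1) * ⟪p.2, z.2⟫ := by
      rw [← h5]; ring
    rw [h6, centralCoeff]
    field_simp
    ring

/-- The squared angular momentum of the velocity `v` at `p`. -/
noncomputable def angularSq {n : ℕ} (p v : Coord n) : ℝ := ‖p.2‖ ^ 2 * ‖v.2‖ ^ 2 - ⟪p.2, v.2⟫ ^ 2

theorem metric_self_eq (p v : Coord n) (hr : 0 < ‖p.2‖) (hf : lapseSq n m ‖p.2‖ ≠ 0) :
    metric n m p v v = -lapseSq n m ‖p.2‖ * v.1 ^ 2 + ⟪p.2, v.2⟫ ^ 2 /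
      (lapseSq n m ‖p.2‖ * ‖p.2‖ ^ 2) + angularSq p v / ‖p.2‖ ^ 2 := by
  rw [metric_eq, radialCoeff, angularSq, real_inner_self_eq_norm_sq]
  field_simp
  ring

/-- The acceleration of a null geodesic is governed by its angular momentum. -/
theorem centralCoeff_of_null {p v : Coord n} (hr : 0 < ‖p.2‖) (hf : lapseSq n m ‖p.2‖ ≠ 0)
    (hv : metric n m p v v = 0) :
    centralCoeff n m p v = n * (1 - lapseSq n m ‖p.2‖) / (2 * ‖p.2‖ ^ 4) * angularSq p v := by
  rw [metric_self_eq p v hr hf] at hv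
  -- The null condition eliminates the time component; after the substitution all terms in the
  -- radial velocity cancel.
  have h1 : v.1 ^ 2 = ⟪p.2, v.2⟫ ^ 2 / (lapseSq n m ‖p.2‖ ^ 2 * ‖p.2‖ ^ 2)
      + angularSq p v / (lapseSq n m ‖p.2‖ * ‖p.2‖ ^ 2) := by
    field_simp
    field_simp at hv
    linarith
  rw [centralCoeff, h1, radialCoeffDeriv, radialCoeff, lapseSqDeriv, angularSq]
  field_simp
  ring

end Metric

end SchwarzschildPhoton

namespace SchwarzschildPhoton

/-! ### First integrals, existence of null geodesics and their radial equation. -/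

section Geodesics

open Filter Set
open scoped RealInnerProductSpace

variable {n : ℕ} {m : ℝ}

theorem HasDerivAt.coord_fst {γ : ℝ → Coord n} {v : Coord n} {τ : ℝ} (h : HasDerivAt γ v τ) :
    HasDerivAt (fun s => (γ s).1) v.1 τ :=
  (ContinuousLinearMap.fst ℝ ℝ (EuclideanSpace ℝ (Fin n))).hasFDerivAt.comp_hasDerivAt τ h

theorem HasDerivAt.coord_snd {γ : ℝ → Coord n} {v : Coord n} {τ : ℝ} (h : HasDerivAt γ v τ) :
    HasDerivAt (fun s => (γ s).2) v.2 τ :=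
  (ContinuousLinearMap.snd ℝ ℝ (EuclideanSpace ℝ (Fin n))).hasFDerivAt.comp_hasDerivAt τ h

theorem HasDerivAt.radius {γ : ℝ → Coord n} {v : Coord n} {τ : ℝ} (h : HasDerivAt γ v τ)
    (hr : 0 < ‖(γ τ).2‖) :
    HasDerivAt (fun s => ‖(γ s).2‖) (⟪(γ τ).2, v.2⟫ / ‖(γ τ).2‖) τ := by
  have := (hasFDerivAt_radius hr).comp_hasDerivAt τ h
  refine this.congr_deriv ?_
  simp
  ring

/-- Conservation of energy, the first integral belonging to the Killing field `∂_t`. -/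
theorem hasDerivAt_energy (hn : 3 ≤ n) (hm : 0 < m) {γ V : ℝ → Coord n} {τ : ℝ}
    (hp : γ τ ∈ spacetime n m) (hγ : HasDerivAt γ (V τ) τ)
    (hV : HasDerivAt V (geodesicSpray n m (γ τ) (V τ)) τ) :
    HasDerivAt (fun s => lapseSq n m ‖(γ s).2‖ * (V s).1) 0 τ := by
  have hr := norm_pos_of_mem hm hp
  have hf := lapseSq_pos hn hm hp
  have h := ((hasDerivAt_lapseSq (m := m) hn hr).comp τ (hγ.radius hr)).mul hV.coord_fst
  refine h.congr_deriv ?_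
  simp only [geodesicSpray, Function.comp_apply]
  field_simp
  ring

/-- Conservation of angular momentum: the spatial acceleration is a multiple of the position. -/
theorem hasDerivAt_angularSq {γ V : ℝ → Coord n} {τ : ℝ} (hγ : HasDerivAt γ (V τ) τ)
    (hV : HasDerivAt V (geodesicSpray n m (γ τ) (V τ)) τ) :
    HasDerivAt (fun s => angularSq (γ s) (V s)) 0 τ := by
  have h := (hγ.coord_snd.norm_sq.mul hV.coord_snd.norm_sq).sub
    ((hγ.coord_snd.inner ℝ hV.coord_snd).pow 2)
  refine h.congr_deriv ?_
  simp only [geodesicSpray, real_inner_smul_right, real_inner_self_eq_norm_sq]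
  rw [real_inner_comm (V τ).2 (γ τ).2]
  push_cast
  ring

theorem hasDerivAt_inner {γ V : ℝ → Coord n} {τ : ℝ} (hγ : HasDerivAt γ (V τ) τ)
    (hV : HasDerivAt V (geodesicSpray n m (γ τ) (V τ)) τ) :
    HasDerivAt (fun s => ⟪(γ s).2, (V s).2⟫)
      (‖(V τ).2‖ ^ 2 - centralCoeff n m (γ τ) (V τ) * ‖(γ τ).2‖ ^ 2) τ := by
  refine (hγ.coord_snd.inner ℝ hV.coord_snd).congr_deriv ?_
  simp only [geodesicSpray, real_inner_smul_right, real_inner_self_eq_norm_sq]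
  ring

theorem hasDerivAt_metric_self (hn : 3 ≤ n) (hm : 0 < m) {γ V : ℝ → Coord n} {τ : ℝ}
    (hp : γ τ ∈ spacetime n m) (hγ : HasDerivAt γ (V τ) τ)
    (hV : HasDerivAt V (geodesicSpray n m (γ τ) (V τ)) τ) :
    HasDerivAt (fun s => metric n m (γ s) (V s) (V s)) 0 τ := by
  have hr := norm_pos_of_mem hm hp
  have hf := lapseSq_pos hn hm hp
  have hfun : (fun s => metric n m (γ s) (V s) (V s)) = fun s =>
      -lapseSq n m ‖(γ s).2‖ * (V s).1 ^ 2 + ‖(V s).2‖ ^ 2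
        + radialCoeff n m ‖(γ s).2‖ * ⟪(γ s).2, (V s).2⟫ ^ 2 := by
    ext s
    rw [metric_eq, real_inner_self_eq_norm_sq]
    ring
  rw [hfun]
  have h1 := (hasDerivAt_lapseSq (m := m) hn hr).comp τ (hγ.radius hr)
  have h2 := (hasDerivAt_radialCoeff (m := m) hn hr hf.ne').comp τ (hγ.radius hr)
  have h := ((h1.neg.mul (hV.coord_fst.pow 2)).add hV.coord_snd.norm_sq).add
    (h2.mul ((hasDerivAt_inner hγ hV).pow 2))
  refine h.congr_deriv ?_
  simp only [geodesicSpray, real_inner_smul_right, Function.comp_apply, radialCoeff,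
    centralCoeff, radialCoeffDeriv]
  rw [real_inner_comm (γ τ).2 (V τ).2]
  push_cast
  simp only [Pi.neg_apply, Pi.pow_apply, Function.comp_apply]
  field_simp
  ring

theorem IsNullGeodesic.hasDerivAt {I : Set ℝ} {γ : ℝ → Coord n} (h : IsNullGeodesic n m I γ)
    {τ : ℝ} (hτ : τ ∈ I) : HasDerivAt γ (deriv γ τ) τ :=
  ((h.smooth.contDiffAt (h.isOpen.mem_nhds hτ)).differentiableAt (by simp)).hasDerivAt

theorem IsNullGeodesic.hasDerivAt_deriv (hn : 3 ≤ n) (hm : 0 < m) {I : Set ℝ} {γ : ℝ → Coord n}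
    (h : IsNullGeodesic n m I γ) {τ : ℝ} (hτ : τ ∈ I) :
    HasDerivAt (deriv γ) (geodesicSpray n m (γ τ) (deriv γ τ)) τ := by
  have h1 : DifferentiableAt ℝ (deriv γ) τ := by
    have h2 : ContDiffOn ℝ 1 (deriv γ) I := by
      have := (contDiffOn_succ_iff_deriv_of_isOpen (n := 1) h.isOpen).1
        (by simpa [one_add_one_eq_two] using h.smooth)
      exact this.2.2
    exact (h2.contDiffAt (h.isOpen.mem_nhds hτ)).differentiableAt (by simp)
  rw [← (geodesic_iff hn hm (h.mem τ hτ) _ _).1 (h.geodesic τ hτ)]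
  exact h1.hasDerivAt

theorem contDiffAt_geodesicSpray (hn : 3 ≤ n) (hm : 0 < m) {p v : Coord n}
    (hp : p ∈ spacetime n m) :
    ContDiffAt ℝ 1 (fun z : Coord n × Coord n => geodesicSpray n m z.1 z.2) (p, v) := by
  have hr := norm_pos_of_mem hm hp
  have hf := lapseSq_pos hn hm hp
  have hx : ContDiffAt ℝ 1 (fun z : Coord n × Coord n => z.1.2) (p, v) := by fun_prop
  have hv1 : ContDiffAt ℝ 1 (fun z : Coord n × Coord n => z.2.1) (p, v) := by fun_prop
  have hv2 : ContDiffAt ℝ 1 (fun z : Coord n × Coord n => z.2.2) (p, v) := by fun_prop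
  have hR : ContDiffAt ℝ 1 (fun z : Coord n × Coord n => ‖z.1.2‖) (p, v) :=
    hx.norm ℝ (norm_pos_iff.1 hr)
  have hin : ContDiffAt ℝ 1 (fun z : Coord n × Coord n => ⟪z.1.2, z.2.2⟫) (p, v) :=
    hx.inner ℝ hv2
  have hN : ContDiffAt ℝ 1 (fun z : Coord n × Coord n => ‖z.2.2‖ ^ 2) (p, v) := hv2.norm_sq ℝ
  have hF : ContDiffAt ℝ 1 (fun z : Coord n × Coord n => lapseSq n m ‖z.1.2‖) (p, v) :=
    ContDiffAt.comp (g := lapseSq n m) (p, v)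
      ((contDiffOn_lapseSq.contDiffAt (Ioi_mem_nhds hr)).of_le (by exact_mod_cast le_top)) hR
  have hF' : ContDiffAt ℝ 1 (fun z : Coord n × Coord n => lapseSqDeriv n m ‖z.1.2‖) (p, v) :=
    (contDiffAt_const.mul (contDiffAt_const.sub hF)).div hR hr.ne'
  have hB : ContDiffAt ℝ 1 (fun z : Coord n × Coord n => radialCoeff n m ‖z.1.2‖) (p, v) :=
    ((hF.inv hf.ne').sub contDiffAt_const).div (hR.pow 2) (by positivity)
  have hB' : ContDiffAt ℝ 1 (fun z : Coord n × Coord n => radialCoeffDeriv n m ‖z.1.2‖) (p, v) :=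
    (hF'.neg.div ((hF.pow 2).mul (hR.pow 2)) (by positivity)).sub
      ((contDiffAt_const.mul ((hF.inv hf.ne').sub contDiffAt_const)).div (hR.pow 3)
        (by positivity))
  have h2r : 2 * ‖((p, v) : Coord n × Coord n).1.2‖ ≠ 0 := by positivity
  have hC : ContDiffAt ℝ 1 (fun z : Coord n × Coord n => centralCoeff n m z.1 z.2) (p, v) :=
    hF.mul ((((hF'.div (contDiffAt_const.mul hR) h2r).mul (hv1.pow 2)).add
      ((hB'.div (contDiffAt_const.mul hR) h2r).mul (hin.pow 2))).add (hB.mul hN))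
  exact (((hF'.div (hF.mul hR) (by positivity)).neg.mul hin).mul hv1).prodMk (hC.neg.smul hx)

/-- There is a null geodesic with any given null initial velocity. -/
theorem exists_isNullGeodesic (hn : 3 ≤ n) (hm : 0 < m) {p v : Coord n} (hp : p ∈ spacetime n m)
    (hv : metric n m p v v = 0) :
    ∃ I γ, IsNullGeodesic n m I γ ∧ 0 ∈ I ∧ γ 0 = p ∧ deriv γ 0 = v := by
  have hX : ContDiffAt ℝ 1
      (fun z : Coord n × Coord n => (z.2, geodesicSpray n m z.1 z.2)) (p, v) :=
    contDiffAt_snd.prodMk (contDiffAt_geodesicSpray hn hm hp)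
  obtain ⟨α, hα0, ε, hε, hα⟩ :=
    hX.exists_forall_mem_closedBall_exists_eq_forall_mem_Ioo_hasDerivAt₀ 0
  have hαc : ContinuousAt α 0 := (hα 0 ⟨by linarith, by linarith⟩).continuousAt
  have hmem : ∀ᶠ s in 𝓝 (0 : ℝ), (α s).1 ∈ spacetime n m := by
    have : Tendsto (fun s => (α s).1) (𝓝 0) (𝓝 p) := by
      have := (continuous_fst.continuousAt.comp hαc : ContinuousAt (Prod.fst ∘ α) 0)
      rw [ContinuousAt, Function.comp_apply, hα0] at this
      exact this
    exact this.eventually (isOpen_spacetime.mem_nhds hp)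
  obtain ⟨δ, hδ, hball⟩ := Metric.eventually_nhds_iff_ball.1
    (hmem.and (Ioo_mem_nhds (a := 0 - ε) (b := 0 + ε) (by linarith) (by linarith)))
  rw [Real.ball_eq_Ioo] at hball
  set I := Ioo (0 - δ) (0 + δ) with hI
  have hIo : IsOpen I := isOpen_Ioo
  have h0I : (0 : ℝ) ∈ I := ⟨by linarith, by linarith⟩
  let γ : ℝ → Coord n := fun s => (α s).1
  let V : ℝ → Coord n := fun s => (α s).2
  have hγ : ∀ s ∈ I, HasDerivAt γ (V s) s := fun s hs =>
    (ContinuousLinearMap.fst ℝ (Coord n) (Coord n)).hasFDerivAt.comp_hasDerivAt s (hα s (hball s hs).2)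
  have hV : ∀ s ∈ I, HasDerivAt V (geodesicSpray n m (γ s) (V s)) s := fun s hs =>
    (ContinuousLinearMap.snd ℝ (Coord n) (Coord n)).hasFDerivAt.comp_hasDerivAt s (hα s (hball s hs).2)
  have hdγ : ∀ s ∈ I, deriv γ s = V s := fun s hs => (hγ s hs).deriv
  have hdV : ∀ s ∈ I, deriv (deriv γ) s = geodesicSpray n m (γ s) (V s) := by
    intro s hs
    have : deriv γ =ᶠ[𝓝 s] V := by
      filter_upwards [hIo.mem_nhds hs] with u hu using hdγ u hu
    rw [this.deriv_eq, (hV s hs).deriv]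
  have hVc : ContDiffOn ℝ 1 V I := by
    have hone : (1 : WithTop ℕ∞) = 0 + 1 := by simp
    rw [hone, contDiffOn_succ_iff_deriv_of_isOpen hIo]
    refine ⟨fun s hs => (hV s hs).differentiableAt.differentiableWithinAt, by simp, ?_⟩
    rw [contDiffOn_zero]
    intro s hs
    have h1 : ContinuousAt (fun z : Coord n × Coord n => geodesicSpray n m z.1 z.2) (α s) :=
      (contDiffAt_geodesicSpray (v := (α s).2) hn hm (hball s hs).1).continuousAt
    have h2 : ContinuousAt (fun u => geodesicSpray n m (γ u) (V u)) s :=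
      ContinuousAt.comp (g := fun z : Coord n × Coord n => geodesicSpray n m z.1 z.2) h1
        (hα s (hball s hs).2).continuousAt
    have h3 : deriv V =ᶠ[𝓝 s] fun u => geodesicSpray n m (γ u) (V u) := by
      filter_upwards [hIo.mem_nhds hs] with u hu using (hV u hu).deriv
    exact (h2.congr h3.symm).continuousWithinAt
  have hγc : ContDiffOn ℝ 2 γ I := by
    have htwo : (2 : WithTop ℕ∞) = 1 + 1 := by norm_num
    rw [htwo, contDiffOn_succ_iff_deriv_of_isOpen hIo]
    exact ⟨fun s hs => (hγ s hs).differentiableAt.differentiableWithinAt, by simp,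
      hVc.congr hdγ⟩
  -- The ODE solution has null velocity only initially by construction; `g(γ', γ')` is constant
  -- along it.
  have hnull : ∀ s ∈ I, metric n m (γ s) (V s) (V s) = 0 := by
    intro s hs
    have hd : ∀ u ∈ I, HasDerivAt (fun s => metric n m (γ s) (V s) (V s)) 0 u := fun u hu =>
      hasDerivAt_metric_self hn hm (hball u hu).1 (hγ u hu) (hV u hu)
    have := hIo.is_const_of_deriv_eq_zero isPreconnected_Ioo
      (fun u hu => (hd u hu).differentiableAt.differentiableWithinAt)
      (fun u hu => (hd u hu).deriv) hs h0I
    rw [this]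
    simp only [γ, V, hα0, hv]
  refine ⟨I, γ, ⟨hIo, ordConnected_Ioo, hγc, fun s hs => (hball s hs).1, ?_, ?_⟩, h0I, ?_, ?_⟩
  · intro s hs
    rw [hdγ s hs, hnull s hs]
  · intro s hs
    rw [hdγ s hs]
    exact (geodesic_iff hn hm (hball s hs).1 _ _).2 (hdV s hs)
  · simp [γ, hα0]
  · rw [hdγ 0 h0I]
    simp [V, hα0]

/-- The right-hand side `f(r)² (1 - Λ f(r) / r²)` of the equation for the squared coordinate
velocity of a null geodesic. -/
noncomputable def profileEnergy (n : ℕ) (m Λ r : ℝ) : ℝ :=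
  lapseSq n m r ^ 2 * (1 - Λ * lapseSq n m r / r ^ 2)

/-- Half the derivative of `profileEnergy`. -/
noncomputable def profileAccel (n : ℕ) (m Λ r : ℝ) : ℝ :=
  lapseSq n m r * lapseSqDeriv n m r
    - 3 / 2 * Λ * lapseSq n m r ^ 2 * lapseSqDeriv n m r / r ^ 2 + Λ * lapseSq n m r ^ 3 / r ^ 3

theorem hasDerivAt_profileEnergy (hn : 3 ≤ n) {Λ r : ℝ} (hr : 0 < r) :
    HasDerivAt (profileEnergy n m Λ) (2 * profileAccel n m Λ r) r := by
  have hf := hasDerivAt_lapseSq (m := m) hn hr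
  have h := (hf.pow 2).mul (((hf.const_mul Λ).div (hasDerivAt_pow 2 r)
    (by positivity)).const_sub 1)
  refine h.congr_deriv ?_
  simp only [profileAccel, Pi.pow_apply, Pi.div_apply]
  push_cast
  field_simp
  ring

/-- The coordinate velocity `dr/dt` of a velocity vector. -/
noncomputable def radialSlope {n : ℕ} (p v : Coord n) : ℝ := ⟪p.2, v.2⟫ / (‖p.2‖ * v.1)

/-- The squared impact parameter of a velocity vector. -/
noncomputable def impactSq (n : ℕ) (m : ℝ) (p v : Coord n) : ℝ :=
  angularSq p v / (lapseSq n m ‖p.2‖ * v.1) ^ 2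

/-- The null condition divided by the squared time component. -/
theorem radialSlope_sq_of_null {p v : Coord n} (hr : 0 < ‖p.2‖) (hf : lapseSq n m ‖p.2‖ ≠ 0)
    (hv : metric n m p v v = 0) (ht : v.1 ≠ 0) :
    radialSlope p v ^ 2 = profileEnergy n m (impactSq n m p v) ‖p.2‖ := by
  rw [metric_self_eq p v hr hf] at hv
  rw [radialSlope, profileEnergy, impactSq]
  field_simp
  field_simp at hv
  linear_combination hv

/-- The second-order equation for `r` with respect to `t`, where the factor `(V τ).1 = dt/dτ`
converts the parameter. Unlike the first-order energy equation it has a Lipschitz right-hand side,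
so uniqueness survives at turning points of `r`. -/
theorem hasDerivAt_radialSlope (hn : 3 ≤ n) (hm : 0 < m) {γ V : ℝ → Coord n} {τ : ℝ}
    (hp : γ τ ∈ spacetime n m) (hγ : HasDerivAt γ (V τ) τ)
    (hV : HasDerivAt V (geodesicSpray n m (γ τ) (V τ)) τ)
    (hnull : metric n m (γ τ) (V τ) (V τ) = 0) (ht : (V τ).1 ≠ 0) :
    HasDerivAt (fun s => radialSlope (γ s) (V s))
      ((V τ).1 * profileAccel n m (impactSq n m (γ τ) (V τ)) ‖(γ τ).2‖) τ := by
  have hr := norm_pos_of_mem hm hp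
  have hf := (lapseSq_pos hn hm hp).ne'
  have h := (hasDerivAt_inner hγ hV).div ((hγ.radius hr).mul hV.coord_fst)
    (mul_ne_zero hr.ne' ht)
  refine h.congr_deriv ?_
  rw [centralCoeff_of_null hr hf hnull]
  rw [metric_self_eq _ _ hr hf] at hnull
  have hw : ‖(V τ).2‖ ^ 2 = (angularSq (γ τ) (V τ) + ⟪(γ τ).2, (V τ).2⟫ ^ 2) / ‖(γ τ).2‖ ^ 2 := by
    rw [angularSq]
    field_simp
    ring
  have hL : angularSq (γ τ) (V τ) = lapseSq n m ‖(γ τ).2‖ * (V τ).1 ^ 2 * ‖(γ τ).2‖ ^ 2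
      - ⟪(γ τ).2, (V τ).2⟫ ^ 2 / lapseSq n m ‖(γ τ).2‖ := by
    field_simp
    field_simp at hnull
    linear_combination hnull
  rw [hw, profileAccel, impactSq, hL]
  simp only [geodesicSpray, lapseSqDeriv, Pi.mul_apply]
  field_simp
  ring

end Geodesics

end SchwarzschildPhoton

namespace SchwarzschildPhoton

/-! ### The model surfaces: hyperplanes and surfaces of null profiles. -/

section Models

open Filter Set
open scoped RealInnerProductSpace

variable {n : ℕ} {m : ℝ}

theorem angularSq_nonneg (p v : Coord n) : 0 ≤ angularSq p v := by
  have h := abs_le.1 (abs_real_inner_le_norm p.2 v.2)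
  unfold angularSq
  nlinarith [h.1, h.2]

theorem continuousAt_lapseSq (hn : 3 ≤ n) {r : ℝ} (hr : 0 < r) : ContinuousAt (lapseSq n m) r :=
  (hasDerivAt_lapseSq hn hr).continuousAt

theorem IsNullGeodesic.energy_eq (hn : 3 ≤ n) (hm : 0 < m) {I : Set ℝ} {γ : ℝ → Coord n}
    (h : IsNullGeodesic n m I γ) {τ τ₀ : ℝ} (hτ : τ ∈ I) (hτ₀ : τ₀ ∈ I) :
    lapseSq n m ‖(γ τ).2‖ * (deriv γ τ).1 = lapseSq n m ‖(γ τ₀).2‖ * (deriv γ τ₀).1 := by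
  have hd := fun u (hu : u ∈ I) => hasDerivAt_energy hn hm (h.mem u hu) (h.hasDerivAt hu)
    (h.hasDerivAt_deriv hn hm hu)
  exact h.isOpen.is_const_of_deriv_eq_zero h.interval.isPreconnected
    (fun u hu => (hd u hu).differentiableAt.differentiableWithinAt)
    (fun u hu => (hd u hu).deriv) hτ hτ₀

theorem IsNullGeodesic.angularSq_eq (hn : 3 ≤ n) (hm : 0 < m) {I : Set ℝ} {γ : ℝ → Coord n}
    (h : IsNullGeodesic n m I γ) {τ τ₀ : ℝ} (hτ : τ ∈ I) (hτ₀ : τ₀ ∈ I) :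
    angularSq (γ τ) (deriv γ τ) = angularSq (γ τ₀) (deriv γ τ₀) := by
  have hd := fun u (hu : u ∈ I) => hasDerivAt_angularSq (h.hasDerivAt hu) (h.hasDerivAt_deriv hn hm hu)
  exact h.isOpen.is_const_of_deriv_eq_zero h.interval.isPreconnected
    (fun u hu => (hd u hu).differentiableAt.differentiableWithinAt)
    (fun u hu => (hd u hu).deriv) hτ hτ₀

/-- A null vector with vanishing time component vanishes. -/
theorem eq_zero_of_null (hn : 3 ≤ n) (hm : 0 < m) {p v : Coord n} (hp : p ∈ spacetime n m)
    (hv : metric n m p v v = 0) (ht : v.1 = 0) : v = 0 := by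
  have hr := norm_pos_of_mem hm hp
  have hf := lapseSq_pos hn hm hp
  rw [metric_self_eq p v hr hf.ne', ht] at hv
  have h1 : 0 ≤ ⟪p.2, v.2⟫ ^ 2 / (lapseSq n m ‖p.2‖ * ‖p.2‖ ^ 2) := by positivity
  have h2 : 0 ≤ angularSq p v / ‖p.2‖ ^ 2 := div_nonneg (angularSq_nonneg p v) (by positivity)
  have h3 : ⟪p.2, v.2⟫ ^ 2 / (lapseSq n m ‖p.2‖ * ‖p.2‖ ^ 2) = 0 := by linarith
  have h4 : angularSq p v / ‖p.2‖ ^ 2 = 0 := by linarith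
  have h5 : ⟪p.2, v.2⟫ ^ 2 = 0 := by
    rcases div_eq_zero_iff.1 h3 with h | h
    · exact h
    · exact absurd h (by positivity)
  have h6 : angularSq p v = 0 := by
    rcases div_eq_zero_iff.1 h4 with h | h
    · exact h
    · exact absurd h (by positivity)
  rw [angularSq, h5, sub_zero, mul_eq_zero] at h6
  rcases h6 with h | h
  · exact absurd h (by positivity)
  · ext1
    · exact ht
    · simpa using h

/-- The definition of null geodesics admits constant curves. Zero energy persists, a null vector
without time component is zero, and so the curve does not move. -/
theorem IsNullGeodesic.eq_of_energy_eq_zero (hn : 3 ≤ n) (hm : 0 < m) {I : Set ℝ}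
    {γ : ℝ → Coord n} (h : IsNullGeodesic n m I γ) {τ τ₀ : ℝ} (hτ : τ ∈ I) (hτ₀ : τ₀ ∈ I)
    (h0 : (deriv γ τ₀).1 = 0) : γ τ = γ τ₀ := by
  have hd : ∀ u ∈ I, deriv γ u = 0 := by
    intro u hu
    refine eq_zero_of_null hn hm (h.mem u hu) (h.null u hu) ?_
    have := h.energy_eq hn hm hu hτ₀
    rw [h0, mul_zero] at this
    exact (mul_eq_zero.1 this).resolve_left (lapseSq_pos hn hm (h.mem u hu)).ne'
  exact h.isOpen.is_const_of_deriv_eq_zero h.interval.isPreconnected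
    (fun u hu => (h.hasDerivAt hu).differentiableAt.differentiableWithinAt) hd hτ hτ₀

theorem metric_time_neg (hn : 3 ≤ n) (hm : 0 < m) {p : Coord n} (hp : p ∈ spacetime n m) :
    metric n m p (1, 0) (1, 0) < 0 := by
  have hf := lapseSq_pos hn hm hp
  rw [metric_eq]
  simp [hf]

theorem IsNullGeodesic.continuousAt_centralCoeff (hn : 3 ≤ n) (hm : 0 < m) {I : Set ℝ}
    {γ : ℝ → Coord n} (h : IsNullGeodesic n m I γ) {τ : ℝ} (hτ : τ ∈ I) :
    ContinuousAt (fun s => centralCoeff n m (γ s) (deriv γ s)) τ := by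
  have hr := norm_pos_of_mem hm (h.mem τ hτ)
  have h1 : (fun s => centralCoeff n m (γ s) (deriv γ s)) =ᶠ[𝓝 τ] fun s =>
      n * (1 - lapseSq n m ‖(γ s).2‖) / (2 * ‖(γ s).2‖ ^ 4) * angularSq (γ τ) (deriv γ τ) := by
    filter_upwards [h.isOpen.mem_nhds hτ] with s hs
    rw [centralCoeff_of_null (norm_pos_of_mem hm (h.mem s hs))
      (lapseSq_pos hn hm (h.mem s hs)).ne' (h.null s hs), h.angularSq_eq hn hm hs hτ]
  refine ContinuousAt.congr ?_ h1.symm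
  have h2 : ContinuousAt (fun s => ‖(γ s).2‖) τ := ((h.hasDerivAt hτ).radius hr).continuousAt
  have h3 : ContinuousAt (fun s => lapseSq n m ‖(γ s).2‖) τ :=
    ContinuousAt.comp (g := lapseSq n m) (continuousAt_lapseSq hn hr) h2
  exact ((continuousAt_const.mul (continuousAt_const.sub h3)).div
    (continuousAt_const.mul (h2.pow 4)) (mul_ne_zero two_ne_zero (pow_ne_zero 4 hr.ne'))).mul
    continuousAt_const

theorem isLocalDefiningFunction_hyperplane {u : EuclideanSpace ℝ (Fin n)} (hu : ‖u‖ = 1)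
    {p : Coord n} (hp : p ∈ spacetime n m) :
    IsLocalDefiningFunction (centeredVerticalHyperplane n m u) p (spacetime n m)
      ((innerSL ℝ u).comp (ContinuousLinearMap.snd ℝ ℝ (EuclideanSpace ℝ (Fin n)))) := by
  refine ⟨isOpen_spacetime, hp, (ContinuousLinearMap.contDiff _).contDiffOn, fun q _ h => ?_,
    fun q hq => ?_⟩
  · rw [ContinuousLinearMap.fderiv] at h
    have := DFunLike.congr_fun h (0, u)
    simp [hu] at this
  · simp [centeredVerticalHyperplane, hq, real_inner_comm]

theorem mem_tangentVectors_hyperplane {u : EuclideanSpace ℝ (Fin n)} (hu : ‖u‖ = 1)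
    {p v : Coord n} (hp : p ∈ centeredVerticalHyperplane n m u) :
    v ∈ tangentVectors (centeredVerticalHyperplane n m u) p ↔ ⟪u, v.2⟫ = 0 := by
  rw [(isLocalDefiningFunction_hyperplane hu hp.1).mem_tangentVectors_iff hp,
    ContinuousLinearMap.fderiv]
  simp

/-- Since geodesic acceleration is central, `⟪u, x⟫` solves a linear homogeneous second-order
equation along a geodesic; tangency makes its initial data vanish. -/
theorem isPhotonSurface_hyperplane (hn : 3 ≤ n) (hm : 0 < m) {u : EuclideanSpace ℝ (Fin n)}
    (hu : ‖u‖ = 1) : IsPhotonSurface n m (centeredVerticalHyperplane n m u) := by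
  have hT : IsTimelikeHypersurface n m (centeredVerticalHyperplane n m u) := by
    refine ⟨fun p hp => hp.1, fun p hp => ⟨_, _, isLocalDefiningFunction_hyperplane hu hp.1⟩,
      fun p hp => ⟨(1, 0), ?_, metric_time_neg hn hm hp.1⟩⟩
    rw [mem_tangentVectors_hyperplane hu hp]
    simp
  refine hT.isPhotonSurface fun I γ hγ τ₀ hτ₀ hp hv => ?_
  rw [mem_tangentVectors_hyperplane hu hp] at hv
  have hb := (hγ.continuousAt_centralCoeff hn hm hτ₀).norm.eventually_lt continuousAt_const
    (lt_add_one ‖centralCoeff n m (γ τ₀) (deriv γ τ₀)‖)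
  set K := ‖centralCoeff n m (γ τ₀) (deriv γ τ₀)‖ + 1
  have hK : 1 ≤ K := by simp [K]
  have key := eventually_eq_zero_of_norm_deriv_le (t := τ₀) (C := K)
    (f := fun s => (⟪u, (γ s).2⟫, ⟪u, (deriv γ s).2⟫))
    (f' := fun s => (⟪u, (deriv γ s).2⟫,
      -centralCoeff n m (γ s) (deriv γ s) * ⟪u, (γ s).2⟫)) ?_ ?_ ?_
  · filter_upwards [key, hγ.isOpen.mem_nhds hτ₀] with s hs hsI
    refine ⟨hγ.mem s hsI, ?_⟩
    rw [real_inner_comm]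
    exact congrArg Prod.fst hs
  · filter_upwards [hγ.isOpen.mem_nhds hτ₀] with s hs
    have h1 := (innerSL ℝ u).hasFDerivAt.comp_hasDerivAt s (hγ.hasDerivAt hs).coord_snd
    have h2 := (innerSL ℝ u).hasFDerivAt.comp_hasDerivAt s
      (hγ.hasDerivAt_deriv hn hm hs).coord_snd
    refine (h1.prodMk h2).congr_deriv ?_
    simp [geodesicSpray, real_inner_smul_right]
  · filter_upwards [hb] with s hs
    rw [Prod.norm_def, Prod.norm_def]
    simp only [norm_mul, norm_neg]
    refine max_le ?_ ?_
    · calc _ ≤ 1 * max ‖⟪u, (γ s).2⟫‖ ‖⟪u, (deriv γ s).2⟫‖ := by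
            rw [one_mul]; exact le_max_right _ _
        _ ≤ _ := by gcongr
    · calc _ ≤ K * ‖⟪u, (γ s).2⟫‖ := by gcongr
        _ ≤ _ := by gcongr; exact le_max_left _ _
  · have := hp.2
    rw [real_inner_comm] at this
    simp [this, hv]

/-- The constant field `(0, u)` is a unit normal, and each term of its Christoffel form contains one
of the factors `u`-component of `∂_t`, `⟪x, u⟫`, `⟪X, u⟫`, all of which vanish. -/
theorem isTotallyGeodesic_hyperplane (hn : 3 ≤ n) (hm : 0 < m) {u : EuclideanSpace ℝ (Fin n)}
    (hu : ‖u‖ = 1) : IsTotallyGeodesic n m (centeredVerticalHyperplane n m u) := by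
  refine ⟨fun _ => (0, u), ⟨⟨univ, isOpen_univ, subset_univ _, contDiffOn_const⟩, ?_, ?_⟩, ?_⟩
  · intro p hp
    rw [metric_eq]
    simp [hu, hp.2]
  · intro p hp v hv
    rw [mem_tangentVectors_hyperplane hu hp] at hv
    rw [metric_eq]
    simp [hv, hp.2]
  · intro p hp X hX Y hY
    rw [mem_tangentVectors_hyperplane hu hp] at hX
    have hX' : ⟪X.2, u⟫ = 0 := by rw [real_inner_comm]; exact hX
    rw [covDeriv, christoffel_eq hn hm hp.1, metric_eq]
    simp [hX', hp.2]

/-- A rotationally symmetric hypersurface `r = ρ(t)` whose profile has the coordinate acceleration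
and velocity of a null geodesic with squared impact parameter `Λ`. -/
structure IsNullProfile (n : ℕ) (m Λ : ℝ) (J : Set ℝ) (ρ : ℝ → ℝ) : Prop where
  isOpen : IsOpen J
  smooth : ContDiffOn ℝ ∞ ρ J
  horizon_lt : ∀ t ∈ J, horizonRadius n m < ρ t
  energy : ∀ t ∈ J, deriv ρ t ^ 2 = profileEnergy n m Λ (ρ t)
  accel : ∀ t ∈ J, deriv (deriv ρ) t = profileAccel n m Λ (ρ t)

/-- The hypersurface `r = ρ(t)`. -/
def profileSurface (n : ℕ) (J : Set ℝ) (ρ : ℝ → ℝ) : Set (Coord n) :=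
  {p | p.1 ∈ J ∧ ‖p.2‖ = ρ p.1}

theorem contDiffOn_profileAccel {Λ : ℝ} : ContDiffOn ℝ ∞ (profileAccel n m Λ) (Ioi 0) := by
  have hf : ContDiffOn ℝ ∞ (lapseSq n m) (Ioi 0) := contDiffOn_lapseSq
  have hne : ∀ k : ℕ, ∀ x ∈ Ioi (0 : ℝ), x ^ k ≠ 0 := fun k x hx => pow_ne_zero _ (ne_of_gt hx)
  have hf' : ContDiffOn ℝ ∞ (lapseSqDeriv n m) (Ioi 0) :=
    (contDiffOn_const.mul (contDiffOn_const.sub hf)).div contDiffOn_id (fun x hx => ne_of_gt hx)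
  exact ((hf.mul hf').sub (((contDiffOn_const.mul (hf.pow 2)).mul hf').div
    (contDiffOn_id.pow 2) (hne 2))).add
    ((contDiffOn_const.mul (hf.pow 3)).div (contDiffOn_id.pow 3) (hne 3))

theorem hasDerivAt_zero_of_eq_zero {J : Set ℝ} (hJ : IsOpen J) {h : ℝ → ℝ} {h' t : ℝ} (ht : t ∈ J)
    (h0 : ∀ s ∈ J, h s = 0) (hd : HasDerivAt h h' t) : h' = 0 :=
  (hd.congr_of_eventuallyEq (by
    filter_upwards [hJ.mem_nhds ht] with s hs using (h0 s hs).symm)).unique (hasDerivAt_const _ _)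

/-- A non-constant solution of a first-order energy equation solves the second-order equation. -/
theorem deriv_deriv_eq_of_energy {J : Set ℝ} (hJ : IsOpen J) (hJc : J.OrdConnected)
    {ρ W A : ℝ → ℝ} {S : Set ℝ} (hρ : ContDiffOn ℝ ∞ ρ J) (hS : ∀ t ∈ J, ρ t ∈ S)
    (hW : ∀ r ∈ S, HasDerivAt W (2 * A r) r) (hA : ∀ r ∈ S, DifferentiableAt ℝ A r)
    (hen : ∀ t ∈ J, deriv ρ t ^ 2 = W (ρ t)) (hne : ∃ t₁ ∈ J, ∃ t₂ ∈ J, ρ t₁ ≠ ρ t₂) :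
    ∀ t ∈ J, deriv (deriv ρ) t = A (ρ t) := by
  have hd : ∀ {f : ℝ → ℝ}, ContDiffOn ℝ ∞ f J → ∀ t ∈ J, HasDerivAt f (deriv f t) t :=
    fun hf t ht => ((hf.contDiffAt (hJ.mem_nhds ht)).differentiableAt (by simp)).hasDerivAt
  have hsm : ∀ {f : ℝ → ℝ}, ContDiffOn ℝ ∞ f J → ContDiffOn ℝ ∞ (deriv f) J :=
    fun hf => hf.deriv_of_isOpen hJ (by simp)
  have hρ1 := hsm hρ
  have hρ2 := hsm hρ1
  -- The energy equation only gives `ρ' G = 0`. Differentiating and multiplying by `G` gives `ρ'' G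
  -- = 0` and then `ρ''' G = 0`, so `(G²)' = 0`. If `G` is nonzero at one point, it is nonzero on
  -- the whole interval, whence `ρ' = 0` there and `ρ` is constant.
  let G : ℝ → ℝ := fun t => deriv (deriv ρ) t - A (ρ t)
  have hG : ∀ t ∈ J, HasDerivAt G (deriv (deriv (deriv ρ)) t - deriv A (ρ t) * deriv ρ t) t :=
    fun t ht => (hd hρ2 t ht).sub ((hA _ (hS t ht)).hasDerivAt.comp t (hd hρ t ht))
  have e1 : ∀ t ∈ J, deriv ρ t * G t = 0 := by
    intro t ht
    have h1 := ((hd hρ1 t ht).pow 2).sub ((hW _ (hS t ht)).comp t (hd hρ t ht))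
    have h2 := hasDerivAt_zero_of_eq_zero hJ ht (fun s hs => by
      simpa using sub_eq_zero.2 (hen s hs)) h1
    simp only [Nat.cast_ofNat, Nat.add_one_sub_one, pow_one] at h2
    simp only [G]
    linear_combination h2 / 2
  have e2 : ∀ t ∈ J, deriv (deriv ρ) t * G t = 0 := by
    intro t ht
    have h2 := hasDerivAt_zero_of_eq_zero hJ ht e1 ((hd hρ1 t ht).mul (hG t ht))
    have h3 : (deriv (deriv ρ) t * G t) * G t = 0 := by
      linear_combination G t * h2
        - (deriv (deriv (deriv ρ)) t - deriv A (ρ t) * deriv ρ t) * e1 t ht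
    rcases mul_eq_zero.1 h3 with h | h
    · exact h
    · rw [h, mul_zero]
  have e3 : ∀ t ∈ J, deriv (deriv (deriv ρ)) t * G t = 0 := by
    intro t ht
    have h2 := hasDerivAt_zero_of_eq_zero hJ ht e2 ((hd hρ2 t ht).mul (hG t ht))
    have h3 : (deriv (deriv (deriv ρ)) t * G t) * G t = 0 := by
      linear_combination G t * h2
        - (deriv (deriv (deriv ρ)) t - deriv A (ρ t) * deriv ρ t) * e2 t ht
    rcases mul_eq_zero.1 h3 with h | h
    · exact h
    · rw [h, mul_zero]
  have hG2 : ∀ t ∈ J, HasDerivAt (fun s => G s ^ 2) 0 t := by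
    intro t ht
    refine ((hG t ht).pow 2).congr_deriv ?_
    simp only [Nat.cast_ofNat, Nat.add_one_sub_one, pow_one]
    linear_combination 2 * e3 t ht - 2 * deriv A (ρ t) * e1 t ht
  intro t ht
  by_contra hcon
  have hGt : G t ≠ 0 := fun h => hcon (sub_eq_zero.1 h)
  have hGs : ∀ s ∈ J, deriv ρ s = 0 := by
    intro s hs
    have := hJ.is_const_of_deriv_eq_zero hJc.isPreconnected
      (fun u hu => (hG2 u hu).differentiableAt.differentiableWithinAt)
      (fun u hu => (hG2 u hu).deriv) hs ht
    refine (mul_eq_zero.1 (e1 s hs)).resolve_right fun h => hGt ?_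
    simpa [h] using this.symm
  obtain ⟨t₁, ht₁, t₂, ht₂, h12⟩ := hne
  exact h12 (hJ.is_const_of_deriv_eq_zero hJc.isPreconnected
    (fun u hu => (hd hρ u hu).differentiableAt.differentiableWithinAt) hGs ht₁ ht₂)

namespace IsNullProfile

variable {Λ : ℝ} {J : Set ℝ} {ρ : ℝ → ℝ}

theorem hasDerivAt (h : IsNullProfile n m Λ J ρ) {t : ℝ} (ht : t ∈ J) :
    HasDerivAt ρ (deriv ρ t) t :=
  ((h.smooth.contDiffAt (h.isOpen.mem_nhds ht)).differentiableAt (by simp)).hasDerivAt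

theorem smooth_deriv (h : IsNullProfile n m Λ J ρ) : ContDiffOn ℝ ∞ (deriv ρ) J :=
  h.smooth.deriv_of_isOpen h.isOpen (by simp)

theorem hasDerivAt_deriv (h : IsNullProfile n m Λ J ρ) {t : ℝ} (ht : t ∈ J) :
    HasDerivAt (deriv ρ) (profileAccel n m Λ (ρ t)) t := by
  rw [← h.accel t ht]
  exact ((h.smooth_deriv.contDiffAt (h.isOpen.mem_nhds ht)).differentiableAt (by simp)).hasDerivAt

theorem mem_spacetime (h : IsNullProfile n m Λ J ρ) {p : Coord n} (hp : p ∈ profileSurface n J ρ) :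
    p ∈ spacetime n m := by
  rw [spacetime, mem_ofPred_eq, hp.2]
  exact h.horizon_lt _ hp.1

theorem hasFDerivAt_sub (h : IsNullProfile n m Λ J ρ) {p : Coord n} (hr : 0 < ‖p.2‖)
    (ht : p.1 ∈ J) :
    HasFDerivAt (fun q : Coord n => ‖q.2‖ - ρ q.1)
      (‖p.2‖⁻¹ • (innerSL ℝ p.2).comp (ContinuousLinearMap.snd ℝ ℝ (EuclideanSpace ℝ (Fin n)))
        - deriv ρ p.1 • ContinuousLinearMap.fst ℝ ℝ (EuclideanSpace ℝ (Fin n))) p :=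
  (hasFDerivAt_radius hr).sub ((h.hasDerivAt ht).comp_hasFDerivAt p hasFDerivAt_fst)

theorem isLocalDefiningFunction (h : IsNullProfile n m Λ J ρ) (hm : 0 < m) {p : Coord n}
    (hp : p ∈ profileSurface n J ρ) :
    IsLocalDefiningFunction (profileSurface n J ρ) p (Prod.fst ⁻¹' J ∩ spacetime n m)
      (fun q => ‖q.2‖ - ρ q.1) := by
  refine ⟨(h.isOpen.preimage continuous_fst).inter isOpen_spacetime, ⟨hp.1, h.mem_spacetime hp⟩,
    ?_, ?_, ?_⟩
  · refine ContDiffOn.sub ?_ (h.smooth.comp contDiffOn_fst fun q hq => hq.1)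
    exact contDiffOn_snd.norm ℝ fun q hq => norm_pos_iff.1 (norm_pos_of_mem hm hq.2)
  · intro q hq h0
    have hr := norm_pos_of_mem hm hq.2
    rw [(h.hasFDerivAt_sub hr hq.1).fderiv] at h0
    have := DFunLike.congr_fun h0 (0, q.2)
    simp [hr.ne'] at this
  · intro q hq
    rw [sub_eq_zero]
    exact ⟨fun h => h.2, fun h => ⟨hq.1, h⟩⟩

theorem mem_tangentVectors_iff (h : IsNullProfile n m Λ J ρ) (hm : 0 < m) {p v : Coord n}
    (hp : p ∈ profileSurface n J ρ) :
    v ∈ tangentVectors (profileSurface n J ρ) p ↔ ⟪p.2, v.2⟫ = ‖p.2‖ * deriv ρ p.1 * v.1 := by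
  have hr := norm_pos_of_mem hm (h.mem_spacetime hp)
  rw [(h.isLocalDefiningFunction hm hp).mem_tangentVectors_iff hp,
    (h.hasFDerivAt_sub hr hp.1).fderiv]
  simp only [sub_apply, smul_apply, ContinuousLinearMap.comp_apply, ContinuousLinearMap.coe_fst',
    ContinuousLinearMap.coe_snd', innerSL_apply_apply, smul_eq_mul, sub_eq_zero]
  rw [inv_mul_eq_iff_eq_mul₀ hr.ne', mul_assoc]

theorem isTimelikeHypersurface (h : IsNullProfile n m Λ J ρ) (hn : 3 ≤ n) (hm : 0 < m)
    (hΛ : 0 < Λ) : IsTimelikeHypersurface n m (profileSurface n J ρ) := by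
  refine ⟨fun p hp => h.mem_spacetime hp, fun p hp => ⟨_, _, h.isLocalDefiningFunction hm hp⟩,
    fun p hp => ⟨(1, (deriv ρ p.1 / ‖p.2‖) • p.2), ?_, ?_⟩⟩
  · have hr := norm_pos_of_mem hm (h.mem_spacetime hp)
    rw [h.mem_tangentVectors_iff hm hp, real_inner_smul_right, real_inner_self_eq_norm_sq]
    field_simp
  · have hr := norm_pos_of_mem hm (h.mem_spacetime hp)
    have hf := lapseSq_pos hn hm (h.mem_spacetime hp)
    have he := h.energy _ hp.1
    rw [← hp.2] at he
    rw [metric_self_eq _ _ hr hf.ne', angularSq, real_inner_smul_right,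
      real_inner_self_eq_norm_sq, norm_smul, mul_pow, Real.norm_eq_abs, mul_pow, sq_abs, div_pow,
      he, profileEnergy]
    have : 0 < Λ * lapseSq n m ‖p.2‖ ^ 2 / ‖p.2‖ ^ 2 := by positivity
    refine lt_of_eq_of_lt ?_ (neg_neg_of_pos this)
    field_simp
    ring

/-- Along a tangent null geodesic, `r` as a function of `t` solves the same second-order equation as
`ρ` with the same initial data. -/
theorem isPhotonSurface (h : IsNullProfile n m Λ J ρ) (hn : 3 ≤ n) (hm : 0 < m) (hΛ : 0 < Λ) :
    IsPhotonSurface n m (profileSurface n J ρ) := by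
  refine (h.isTimelikeHypersurface hn hm hΛ).isPhotonSurface fun I γ hγ τ₀ hτ₀ hp hv => ?_
  rw [h.mem_tangentVectors_iff hm hp] at hv
  rcases eq_or_ne (deriv γ τ₀).1 0 with h0 | h0
  · filter_upwards [hγ.isOpen.mem_nhds hτ₀] with τ hτ
    rwa [hγ.eq_of_energy_eq_zero hn hm hτ hτ₀ h0]
  have hr := norm_pos_of_mem hm (hγ.mem _ hτ₀)
  have hf := lapseSq_pos hn hm (hγ.mem _ hτ₀)
  have hslope : radialSlope (γ τ₀) (deriv γ τ₀) = deriv ρ (γ τ₀).1 := by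
    rw [radialSlope, hv]
    field_simp
  -- Tangency equates the slopes, and the two energy equations then force equal impact parameters,
  -- because `profileEnergy` is injective in `Λ`.
  have hΛ0 : impactSq n m (γ τ₀) (deriv γ τ₀) = Λ := by
    have h1 := radialSlope_sq_of_null hr hf.ne' (hγ.null _ hτ₀) h0
    rw [hslope, h.energy _ hp.1, ← hp.2, profileEnergy, profileEnergy] at h1
    field_simp at h1
    have h2 : lapseSq n m ‖(γ τ₀).2‖ * (impactSq n m (γ τ₀) (deriv γ τ₀) - Λ) = 0 := by
      linear_combination h1
    exact sub_eq_zero.1 ((mul_eq_zero.1 h2).resolve_left hf.ne')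
  have hΛs : ∀ s ∈ I, impactSq n m (γ s) (deriv γ s) = Λ := by
    intro s hs
    rw [← hΛ0, impactSq, impactSq, hγ.energy_eq hn hm hs hτ₀, hγ.angularSq_eq hn hm hs hτ₀]
  have h0s : ∀ s ∈ I, (deriv γ s).1 ≠ 0 := by
    intro s hs h1
    have := hγ.energy_eq hn hm hs hτ₀
    rw [h1, mul_zero] at this
    exact (mul_ne_zero hf.ne' h0) this.symm
  obtain ⟨K, S, hS, hK⟩ := ((contDiffOn_profileAccel (n := n) (m := m) (Λ := Λ)).contDiffAt
    (Ioi_mem_nhds hr)).of_le (m := 1) (by exact_mod_cast le_top) |>.exists_lipschitzOnWith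
  have hct : ContinuousAt (fun s => (γ s).1) τ₀ := (hγ.hasDerivAt hτ₀).coord_fst.continuousAt
  have hcr : ContinuousAt (fun s => ‖(γ s).2‖) τ₀ :=
    ((hγ.hasDerivAt hτ₀).radius hr).continuousAt
  have hcρ : ContinuousAt (fun s => ρ (γ s).1) τ₀ :=
    ContinuousAt.comp (g := ρ) (h.hasDerivAt hp.1).continuousAt hct
  have hS' : S ∈ 𝓝 (ρ (γ τ₀).1) := by rw [← hp.2]; exact hS
  have hcv : ContinuousAt (fun s => ‖(deriv γ s).1‖) τ₀ :=
    (hγ.hasDerivAt_deriv hn hm hτ₀).coord_fst.continuousAt.norm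
  have hvb := hcv.eventually_lt continuousAt_const (lt_add_one ‖(deriv γ τ₀).1‖)
  set M := ‖(deriv γ τ₀).1‖ + 1
  have hM : 0 ≤ M := by positivity
  -- Grönwall for the differences of radii and of slopes: `M` bounds `dt/dτ`, and `K` is a local
  -- Lipschitz constant of `profileAccel`.
  have key := eventually_eq_zero_of_norm_deriv_le (t := τ₀) (C := M * max 1 K)
    (f := fun s => (‖(γ s).2‖ - ρ (γ s).1,
      radialSlope (γ s) (deriv γ s) - deriv ρ (γ s).1))
    (f' := fun s => ((deriv γ s).1 * (radialSlope (γ s) (deriv γ s) - deriv ρ (γ s).1),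
      (deriv γ s).1 * (profileAccel n m Λ ‖(γ s).2‖ - profileAccel n m Λ (ρ (γ s).1)))) ?_ ?_ ?_
  · filter_upwards [key, hct.eventually (h.isOpen.mem_nhds hp.1)] with s hs hsJ
    exact ⟨hsJ, sub_eq_zero.1 (congrArg Prod.fst hs)⟩
  · filter_upwards [hγ.isOpen.mem_nhds hτ₀, hct.eventually (h.isOpen.mem_nhds hp.1)] with s hs hsJ
    have hrs := norm_pos_of_mem hm (hγ.mem s hs)
    have h1 := (hγ.hasDerivAt hs).radius hrs
    have h2 := (h.hasDerivAt hsJ).comp s (hγ.hasDerivAt hs).coord_fst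
    have h3 := hasDerivAt_radialSlope hn hm (hγ.mem s hs) (hγ.hasDerivAt hs)
      (hγ.hasDerivAt_deriv hn hm hs) (hγ.null s hs) (h0s s hs)
    have h4 := (h.hasDerivAt_deriv hsJ).comp s (hγ.hasDerivAt hs).coord_fst
    refine ((h1.sub h2).prodMk (h3.sub h4)).congr_deriv ?_
    rw [hΛs s hs, radialSlope]
    have := h0s s hs
    ext1
    · simp only
      field_simp
    · simp only
      ring
  · filter_upwards [hvb, hcr.eventually hS, hcρ.eventually hS'] with s hs1 hs2 hs3
    have hlip := hK.dist_le_mul _ hs2 _ hs3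
    rw [Real.dist_eq, Real.dist_eq] at hlip
    rw [Prod.norm_def, Prod.norm_def]
    simp only [norm_mul]
    have hK1 : (1 : ℝ) ≤ max 1 (K : ℝ) := le_max_left _ _
    have hK2 : (K : ℝ) ≤ max 1 (K : ℝ) := le_max_right _ _
    have hle1 := le_max_left ‖‖(γ s).2‖ - ρ (γ s).1‖
      ‖radialSlope (γ s) (deriv γ s) - deriv ρ (γ s).1‖
    have hle2 := le_max_right ‖‖(γ s).2‖ - ρ (γ s).1‖
      ‖radialSlope (γ s) (deriv γ s) - deriv ρ (γ s).1‖
    rw [mul_assoc]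
    refine max_le ?_ ?_
    · refine mul_le_mul hs1.le ?_ (norm_nonneg _) hM
      calc _ ≤ 1 * _ := by rw [one_mul]; exact hle2
        _ ≤ _ := mul_le_mul_of_nonneg_right hK1 ((norm_nonneg _).trans hle2)
    · refine mul_le_mul hs1.le ?_ (norm_nonneg _) hM
      exact hlip.trans (mul_le_mul hK2 hle1 (abs_nonneg _) (by positivity))
  · simp [hp.2, hslope]

theorem isSphericallySymmetric (h : IsNullProfile n m Λ J ρ) (hn : 3 ≤ n) (hm : 0 < m)
    (hJ : J.OrdConnected) (hne : J.Nonempty) :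
    IsSphericallySymmetric n m (profileSurface n J ρ) := by
  have hpos : ∀ t ∈ J, 0 < ρ t := fun t ht => (horizonRadius_pos hm).trans (h.horizon_lt t ht)
  refine ⟨?_, fun t₀ ⟨x, hx⟩ => ⟨ρ t₀, h.horizon_lt _ hx.1, ?_⟩⟩
  · have hrank : 1 < Module.rank ℝ (EuclideanSpace ℝ (Fin n)) := by
      rw [rank_eq_card_basis (EuclideanSpace.basisFun (Fin n) ℝ).toBasis, Fintype.card_fin]
      exact_mod_cast (by omega : 1 < n)
    have hS : IsConnected (Metric.sphere (0 : EuclideanSpace ℝ (Fin n)) 1) :=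
      isConnected_sphere hrank 0 zero_le_one
    have hJS : IsConnected (J ×ˢ Metric.sphere (0 : EuclideanSpace ℝ (Fin n)) 1) :=
      IsConnected.prod ⟨hne, hJ.isPreconnected⟩ hS
    have himg := hJS.image (fun q : Coord n => (q.1, ρ q.1 • q.2)) (by
      have hρ : ContinuousOn (fun q : Coord n => ρ q.1)
          (J ×ˢ Metric.sphere (0 : EuclideanSpace ℝ (Fin n)) 1) :=
        h.smooth.continuousOn.comp continuousOn_fst fun q hq => hq.1
      exact continuousOn_fst.prodMk (hρ.smul continuousOn_snd))
    convert himg using 1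
    ext ⟨t, x⟩
    simp only [profileSurface, mem_ofPred_eq, mem_image, mem_prod, mem_sphere_zero_iff_norm,
      Prod.mk.injEq, Prod.exists]
    constructor
    · rintro ⟨ht, hx⟩
      have := hpos t ht
      refine ⟨t, (ρ t)⁻¹ • x, ⟨ht, ?_⟩, rfl, ?_⟩
      · rw [norm_smul, hx, Real.norm_eq_abs, abs_inv, abs_of_pos this, inv_mul_cancel₀ this.ne']
      · rw [smul_smul, mul_inv_cancel₀ this.ne', one_smul]
    · rintro ⟨s, y, ⟨hs, hy⟩, rfl, rfl⟩
      exact ⟨hs, by rw [norm_smul, hy, mul_one, Real.norm_eq_abs, abs_of_pos (hpos _ hs)]⟩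
  · ext y
    simp only [profileSurface, mem_ofPred_eq, mem_sphere_zero_iff_norm]
    exact ⟨fun h => h.2, fun h => ⟨hx.1, h⟩⟩

/-- The differentiated function is the time component `k` of the unnormalized normal `(k, x)`. The
energy equation is used to remove `Λ` from the result. -/
theorem hasDerivAt_normalTime (h : IsNullProfile n m Λ J ρ) (hn : 3 ≤ n) (hm : 0 < m) {t : ℝ}
    (ht : t ∈ J) :
    HasDerivAt (fun s => ρ s * deriv ρ s / lapseSq n m (ρ s) ^ 2)
      (1 - lapseSqDeriv n m (ρ t) * ρ t / (2 * lapseSq n m (ρ t))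
        - deriv ρ t ^ 2 * lapseSqDeriv n m (ρ t) * ρ t / (2 * lapseSq n m (ρ t) ^ 3)) t := by
  have hr := (horizonRadius_pos hm).trans (h.horizon_lt t ht)
  have hf := lapseSq_pos hn hm (h.horizon_lt t ht)
  have h1 := ((h.hasDerivAt ht).mul (h.hasDerivAt_deriv ht)).div
    (((hasDerivAt_lapseSq (m := m) hn hr).comp t (h.hasDerivAt ht)).pow 2) (by
      simp only [Function.comp_apply, Pi.pow_apply]; positivity)
  refine h1.congr_deriv ?_
  have h2 := h.energy t ht
  simp only [profileEnergy] at h2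
  simp only [Pi.mul_apply, Pi.pow_apply, Function.comp_apply, profileAccel]
  have h3 : deriv ρ t ^ 2 = lapseSq n m (ρ t) ^ 2 * (1 - Λ * lapseSq n m (ρ t) / ρ t ^ 2) := h2
  field_simp
  field_simp at h3
  push_cast
  generalize lapseSq n m (ρ t) = f at *
  generalize lapseSqDeriv n m (ρ t) = f' at *
  generalize deriv ρ t = d at *
  generalize ρ t = r at *
  linear_combination f * (2 * f - 3 * r * f') * h3

/-- The field `(ρρ'/f², x)` is normal and, by the energy equation, has squared length `Λ = 1/lam²`.
Its covariant derivative along tangent vectors `X` equals `X` up to normal parts, so rescaling by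
`lam` to unit length makes `lam` the umbilicity factor. -/
theorem hasOutwardUmbilicityFactor {lam : ℝ} (h : IsNullProfile n m (1 / lam ^ 2) J ρ)
    (hn : 3 ≤ n) (hm : 0 < m) (hlam : 0 < lam) :
    HasOutwardUmbilicityFactor n m (profileSurface n J ρ) lam := by
  let k : ℝ → ℝ := fun s => ρ s * deriv ρ s / lapseSq n m (ρ s) ^ 2
  refine ⟨fun p => lam • ((k p.1, p.2) : Coord n), ⟨⟨Prod.fst ⁻¹' J,
    h.isOpen.preimage continuous_fst, fun p hp => hp.1, ?_⟩, ?_, ?_⟩, ?_, ?_⟩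
  · have hk : ContDiffOn ℝ ∞ k J := by
      refine (h.smooth.mul h.smooth_deriv).div
        ((contDiffOn_lapseSq.comp h.smooth fun t ht => ?_).pow 2) fun t ht => ?_
      · exact (horizonRadius_pos hm).trans (h.horizon_lt t ht)
      · have := lapseSq_pos hn hm (h.horizon_lt t ht)
        positivity
    exact ((hk.comp contDiffOn_fst fun q hq => hq).prodMk contDiffOn_snd).const_smul lam
  · intro p hp
    have hr := norm_pos_of_mem hm (h.mem_spacetime hp)
    have hf := lapseSq_pos hn hm (h.mem_spacetime hp)
    have he := h.energy _ hp.1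
    rw [metric_eq, radialCoeff]
    simp only [Prod.smul_fst, Prod.smul_snd, smul_eq_mul, real_inner_smul_left,
      real_inner_smul_right]
    simp only [real_inner_self_eq_norm_sq, k]
    rw [← hp.2] at he ⊢
    rw [profileEnergy] at he
    field_simp
    field_simp at he
    linear_combination -he
  · intro p hp v hv
    have hr := norm_pos_of_mem hm (h.mem_spacetime hp)
    have hf := lapseSq_pos hn hm (h.mem_spacetime hp)
    rw [h.mem_tangentVectors_iff hm hp] at hv
    rw [metric_eq, radialCoeff]
    simp only [Prod.smul_fst, Prod.smul_snd, smul_eq_mul, real_inner_smul_left,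
      real_inner_smul_right, real_inner_self_eq_norm_sq, k]
    rw [hv, ← hp.2]
    field_simp
    ring
  · intro p hp
    have hr := norm_pos_of_mem hm (h.mem_spacetime hp)
    simp only [dr, Prod.smul_snd, real_inner_smul_right, real_inner_self_eq_norm_sq]
    positivity
  · intro p hp X hX Y hY
    have hr := norm_pos_of_mem hm (h.mem_spacetime hp)
    have hf := lapseSq_pos hn hm (h.mem_spacetime hp)
    rw [h.mem_tangentVectors_iff hm hp] at hX hY
    have hfst : HasFDerivAt (fun q : Coord n => q.1)
      (ContinuousLinearMap.fst ℝ ℝ (EuclideanSpace ℝ (Fin n))) p := hasFDerivAt_fst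
    have hk : HasFDerivAt (fun q : Coord n => k q.1) _ p :=
      (h.hasDerivAt_normalTime hn hm hp.1).comp_hasFDerivAt p hfst
    have hd : HasFDerivAt (fun q : Coord n => lam • ((k q.1, q.2) : Coord n)) _ p :=
      (hk.prodMk hasFDerivAt_snd).const_smul lam
    rw [covDeriv, hd.fderiv, christoffel_eq hn hm (h.mem_spacetime hp), metric_eq, metric_eq,
      radialCoeff, radialCoeffDeriv]
    simp only [smul_apply, ContinuousLinearMap.prod_apply, ContinuousLinearMap.coe_fst',
      ContinuousLinearMap.coe_snd', smul_eq_mul,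
      real_inner_smul_left, real_inner_smul_right, real_inner_self_eq_norm_sq, k, Prod.smul_mk]
    rw [real_inner_comm p.2 X.2, hX, hY, ← hp.2]
    generalize ⟪X.2, Y.2⟫ = c
    generalize lapseSqDeriv n m ‖p.2‖ = f'
    field_simp
    ring

end IsNullProfile

theorem IsPhotonProfileSurface.isNullProfile (hn : 3 ≤ n) (hm : 0 < m) {Q : Set (Coord n)}
    {lam : ℝ} (hlam : 0 < lam) (h : IsPhotonProfileSurface n m Q lam) :
    ∃ J ρ, IsNullProfile n m (1 / lam ^ 2) J ρ ∧ J.OrdConnected ∧ J.Nonempty ∧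
      Q = profileSurface n J ρ := by
  obtain ⟨J, ρ, hJ, hJc, hρ, hrm, hne, hen, rfl⟩ := h
  have hen' : ∀ t ∈ J, deriv ρ t ^ 2 = profileEnergy n m (1 / lam ^ 2) (ρ t) := by
    intro t ht
    have hr := (horizonRadius_pos hm).trans (hrm t ht)
    rw [hen t ht, profileEnergy]
    field_simp
  refine ⟨J, ρ, ⟨hJ, hρ, hrm, hen', ?_⟩, hJc, ?_, rfl⟩
  · refine deriv_deriv_eq_of_energy (S := Ioi 0) (W := profileEnergy n m (1 / lam ^ 2)) hJ hJc hρ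
      (fun t ht => (horizonRadius_pos hm).trans (hrm t ht))
      (fun r hr => hasDerivAt_profileEnergy hn hr) (fun r hr => ?_) hen' hne
    exact (contDiffOn_profileAccel.contDiffAt (Ioi_mem_nhds hr)).differentiableAt (by simp)
  · obtain ⟨t, ht, -⟩ := hne
    exact ⟨t, ht⟩

theorem IsPhotonCylinder.isNullProfile (hn : 3 ≤ n) (hm : 0 < m) {Q : Set (Coord n)}
    {lam : ℝ} (h : IsPhotonCylinder n m Q lam) :
    ∃ J ρ, IsNullProfile n m (1 / lam ^ 2) J ρ ∧ J.OrdConnected ∧ J.Nonempty ∧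
      Q = profileSurface n J ρ := by
  obtain ⟨r, hr, hd, rfl, rfl⟩ := h
  have hr0 := (horizonRadius_pos hm).trans hr
  have hf := lapseSq_pos hn hm hr
  rw [(hasDerivAt_lapseSq hn hr0).deriv] at hd
  have hΛ : 1 / (√(lapseSq n m r) / r) ^ 2 = r ^ 2 / lapseSq n m r := by
    rw [div_pow, Real.sq_sqrt hf.le]
    field_simp
  have hd' : lapseSqDeriv n m r = 2 * lapseSq n m r / r := by
    field_simp
    exact hd
  -- For the constant profile, the value of `lam` makes `profileEnergy` vanish at `r`, and `f' r =
  -- 2f` makes `profileAccel` vanish.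
  refine ⟨univ, fun _ => r, ⟨isOpen_univ, contDiffOn_const, fun _ _ => hr, fun t _ => ?_,
    fun t _ => ?_⟩, ordConnected_univ, univ_nonempty, ?_⟩
  · rw [hΛ, profileEnergy, deriv_const]
    field_simp
    ring
  · rw [hΛ, profileAccel, hd', deriv_const', deriv_const]
    field_simp
    ring
  · ext p
    simp [profileSurface]

end Models

end SchwarzschildPhoton

/-! ### Symmetry of second derivatives along a zero set. -/

section Integrability

open Filter Set

variable {E : Type*} [NormedAddCommGroup E] [NormedSpace ℝ E]
variable {V : Type*} [NormedAddCommGroup V] [NormedSpace ℝ V]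

theorem ContDiffAt.isSymmSndFDerivAt_of_infty {f : E → V} {x : E} (hf : ContDiffAt ℝ ∞ f x) :
    IsSymmSndFDerivAt ℝ f x := by
  have h2 : ContDiffAt ℝ 2 f x := hf.of_le (WithTop.coe_le_coe.2 le_top)
  exact h2.isSymmSndFDerivAt (by simp)

theorem ContDiffAt.eventually_differentiableAt {f : E → V} {x : E} (hf : ContDiffAt ℝ ∞ f x) :
    ∀ᶠ y in 𝓝 x, DifferentiableAt ℝ f y := by
  filter_upwards [(hf.of_le (m := 1) (by simp)).eventually (by simp)] with y hy
  exact hy.differentiableAt (by simp)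

theorem HasFDerivAt.line_zero {f : E → V} {f' : E →L[ℝ] V} (hf : HasFDerivAt f f' 0) (x : E) :
    HasDerivAt (fun s : ℝ => f (s • x)) (f' x) 0 := by
  have hline : HasDerivAt (fun s : ℝ => s • x) x 0 := by
    simpa using (hasDerivAt_id (0 : ℝ)).smul_const x
  have : HasFDerivAt f f' ((0 : ℝ) • x) := by simpa using hf
  exact this.comp_hasDerivAt (0 : ℝ) hline

/-- If the differential of `A` agrees with the one-form `θ` along the regular zero set of `F`, then
the exterior derivative of `θ` vanishes on tangent vectors. -/
theorem fderiv_symm_of_eq_on_zeroSet [CompleteSpace E] {F : E → ℝ} {p : E}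
    (hF : ContDiffAt ℝ ∞ F p) (h0 : F p = 0) (hreg : fderiv ℝ F p ≠ 0) {A : E → V}
    (hA : ContDiffAt ℝ ∞ A p) {θ : E → E →L[ℝ] V} (hθ : DifferentiableAt ℝ θ p)
    (hAθ : ∀ᶠ q in 𝓝 p, F q = 0 → ∀ v, fderiv ℝ F q v = 0 → fderiv ℝ A q v = θ q v)
    {v w : E} (hv : fderiv ℝ F p v = 0) (hw : fderiv ℝ F p w = 0) :
    fderiv ℝ θ p v w = fderiv ℝ θ p w v := by
  obtain ⟨φ, ψ, hφ0, -, hφ, -, hφd, -, -, hψφ, hL⟩ := exists_straightening hF h0 hreg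
  have hφc : Tendsto φ (𝓝 0) (𝓝 p) := by simpa [hφ0] using hφ.continuousAt.tendsto
  have hB : ContDiffAt ℝ ∞ (A ∘ φ) 0 := ContDiffAt.comp 0 (by rw [hφ0]; exact hA) hφ
  have hgood : ∀ᶠ z in 𝓝 (0 : E), fderiv ℝ F p z = 0 → ∀ x, fderiv ℝ F p x = 0 →
      fderiv ℝ (A ∘ φ) z x = θ (φ z) (fderiv ℝ φ z x) := by
    filter_upwards [hψφ.eventually_nhds, hφ.eventually_differentiableAt, hφc.eventually (hF.eventually_differentiableAt),
      hφc.eventually (hA.eventually_differentiableAt), hφc.eventually hAθ] with z h1 h2 h3 h4 h5 hz x hx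
    have hFz : F (φ z) = 0 := by rw [← hL, h1.self_of_nhds, hz]
    rw [fderiv_comp z h4 h2, ContinuousLinearMap.comp_apply]
    refine h5 hFz _ ?_
    have h6 : (F ∘ φ) =ᶠ[𝓝 z] fderiv ℝ F p := by
      filter_upwards [h1] with y hy
      rw [Function.comp_apply, ← hL, hy]
    have h7 := (h3.hasFDerivAt.comp z h2.hasFDerivAt).congr_of_eventuallyEq h6.symm
    have h8 := h7.unique (fderiv ℝ F p).hasFDerivAt
    rw [← ContinuousLinearMap.comp_apply, h8, hx]
  -- In the straightened chart the zero set is a linear subspace, so `d(A ∘ φ) = θ(Dφ)` may be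
  -- differentiated along it. The second derivatives of `A ∘ φ` and of `φ` are symmetric, and only
  -- the derivative of `θ` remains to be compared.
  have key : ∀ x y, fderiv ℝ F p x = 0 → fderiv ℝ F p y = 0 →
      fderiv ℝ (fderiv ℝ (A ∘ φ)) 0 x y
        = fderiv ℝ θ p x y + θ p (fderiv ℝ (fderiv ℝ φ) 0 x y) := by
    intro x y hx hy
    have hline : HasDerivAt (fun s : ℝ => s • x) x 0 := by
      simpa using (hasDerivAt_id (0 : ℝ)).smul_const x
    have hc : Tendsto (fun s : ℝ => s • x) (𝓝 0) (𝓝 0) := by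
      simpa using hline.continuousAt.tendsto
    have h1 : HasDerivAt (fun s : ℝ => fderiv ℝ (A ∘ φ) (s • x) y)
        (fderiv ℝ (fderiv ℝ (A ∘ φ)) 0 x y) 0 := by
      have h2 : HasFDerivAt (fderiv ℝ (A ∘ φ)) (fderiv ℝ (fderiv ℝ (A ∘ φ)) 0) 0 :=
        ((hB.fderiv_right (m := ∞) (by simp)).differentiableAt
          (by simp)).hasFDerivAt
      simpa using (h2.line_zero x).clm_apply (hasDerivAt_const (0 : ℝ) y)
    have h2 : HasDerivAt (fun s : ℝ => fderiv ℝ φ (s • x) y)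
        (fderiv ℝ (fderiv ℝ φ) 0 x y) 0 := by
      have h2 : HasFDerivAt (fderiv ℝ φ) (fderiv ℝ (fderiv ℝ φ) 0) 0 :=
        ((hφ.fderiv_right (m := ∞) (by simp)).differentiableAt
          (by simp)).hasFDerivAt
      simpa using (h2.line_zero x).clm_apply (hasDerivAt_const (0 : ℝ) y)
    have h3 : HasDerivAt (fun s : ℝ => θ (φ (s • x))) (fderiv ℝ θ p x) 0 := by
      have h4 : HasFDerivAt θ (fderiv ℝ θ p) (φ 0) := by rw [hφ0]; exact hθ.hasFDerivAt
      simpa using (h4.comp 0 hφd).line_zero x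
    have h4 := h3.clm_apply h2
    have h5 : (fun s : ℝ => fderiv ℝ (A ∘ φ) (s • x) y) =ᶠ[𝓝 0]
        fun s => θ (φ (s • x)) (fderiv ℝ φ (s • x) y) := by
      filter_upwards [hc.eventually hgood] with s hs
      exact hs (by rw [map_smul, hx, smul_zero]) y hy
    have h6 := h1.unique (h4.congr_of_eventuallyEq h5)
    rw [h6]
    simp [hφd.fderiv, hφ0]
  have hsB : IsSymmSndFDerivAt ℝ (A ∘ φ) 0 := hB.isSymmSndFDerivAt_of_infty
  have hsφ : IsSymmSndFDerivAt ℝ φ 0 := hφ.isSymmSndFDerivAt_of_infty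
  have e := hsB.eq v w
  rw [key v w hv hw, key w v hw hv, hsφ.eq v w] at e
  exact add_right_cancel e

end Integrability

namespace SchwarzschildPhoton

/-! ### Euclidean unit normal and normal speed of the time-slices. -/

section Umbilic

open Filter Set
open scoped RealInnerProductSpace

variable {n : ℕ}

/-- The spatial gradient represented by a covector. -/
noncomputable def spatialGrad (n : ℕ) : (Coord n →L[ℝ] ℝ) →L[ℝ] EuclideanSpace ℝ (Fin n) :=
  ∑ i, (ContinuousLinearMap.apply ℝ ℝ
    ((0, EuclideanSpace.basisFun (Fin n) ℝ i) : Coord n)).smulRight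
      (EuclideanSpace.basisFun (Fin n) ℝ i)

theorem inner_spatialGrad (ℓ : Coord n →L[ℝ] ℝ) (w : EuclideanSpace ℝ (Fin n)) :
    ⟪spatialGrad n ℓ, w⟫ = ℓ (0, w) := by
  have h : ((0, w) : Coord n) = ∑ i, ⟪EuclideanSpace.basisFun (Fin n) ℝ i, w⟫ •
      ((0, EuclideanSpace.basisFun (Fin n) ℝ i) : Coord n) := by
    have h2 : ((0, w) : Coord n) = ContinuousLinearMap.inr ℝ ℝ (EuclideanSpace ℝ (Fin n)) w := rfl
    rw [h2]
    conv_lhs => rw [← (EuclideanSpace.basisFun (Fin n) ℝ).sum_repr' w]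
    rw [map_sum]
    simp only [map_smul, ContinuousLinearMap.inr_apply]
  rw [h, map_sum, spatialGrad]
  simp only [sum_apply, ContinuousLinearMap.smulRight_apply, ContinuousLinearMap.apply_apply,
    sum_inner, real_inner_smul_left, map_smul, smul_eq_mul]
  exact Finset.sum_congr rfl fun i _ => mul_comm _ _

/-- The Euclidean unit normal of the time-slices of the level sets of `F`. -/
noncomputable def sliceNormal (F : Coord n → ℝ) (q : Coord n) : EuclideanSpace ℝ (Fin n) :=
  ‖spatialGrad n (fderiv ℝ F q)‖⁻¹ • spatialGrad n (fderiv ℝ F q)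

/-- The normal speed of the time-slices of the level sets of `F`. -/
noncomputable def sliceSpeed (F : Coord n → ℝ) (q : Coord n) : ℝ :=
  -(fderiv ℝ F q (1, 0)) * ‖spatialGrad n (fderiv ℝ F q)‖⁻¹

theorem hasFDerivAt_spatialGrad {F : Coord n → ℝ} {q : Coord n} (hF : ContDiffAt ℝ ∞ F q) :
    HasFDerivAt (fun x => spatialGrad n (fderiv ℝ F x))
      ((spatialGrad n).comp (fderiv ℝ (fderiv ℝ F) q)) q :=
  (spatialGrad n).hasFDerivAt.comp q
    ((hF.fderiv_right (m := ∞) (by simp)).differentiableAt (by simp)).hasFDerivAt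

theorem hasFDerivAt_inv_norm_spatialGrad {F : Coord n → ℝ} {q : Coord n} (hF : ContDiffAt ℝ ∞ F q)
    (hg : spatialGrad n (fderiv ℝ F q) ≠ 0) :
    HasFDerivAt (fun x => ‖spatialGrad n (fderiv ℝ F x)‖⁻¹)
      (-(‖spatialGrad n (fderiv ℝ F q)‖ ^ 3)⁻¹ •
        (innerSL ℝ (spatialGrad n (fderiv ℝ F q))).comp
          ((spatialGrad n).comp (fderiv ℝ (fderiv ℝ F) q))) q := by
  have hpos : 0 < ‖spatialGrad n (fderiv ℝ F q)‖ := norm_pos_iff.2 hg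
  have h1 := (hasFDerivAt_spatialGrad hF).norm_sq.sqrt (by positivity)
  have h2 : (fun x => √(‖spatialGrad n (fderiv ℝ F x)‖ ^ 2)) =
      fun x => ‖spatialGrad n (fderiv ℝ F x)‖ := by
    ext x; exact Real.sqrt_sq (norm_nonneg _)
  rw [h2, Real.sqrt_sq (norm_nonneg _)] at h1
  have h3 := (hasDerivAt_inv hpos.ne').comp_hasFDerivAt q h1
  refine h3.congr_fderiv (ContinuousLinearMap.ext fun v => ?_)
  simp only [smul_apply, smul_eq_mul, nsmul_eq_mul, Nat.cast_ofNat]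
  field_simp

theorem norm_sliceNormal {F : Coord n → ℝ} {q : Coord n}
    (hg : spatialGrad n (fderiv ℝ F q) ≠ 0) : ‖sliceNormal F q‖ = 1 := by
  rw [sliceNormal, norm_smul, norm_inv, norm_norm, inv_mul_cancel₀ (norm_ne_zero_iff.2 hg)]

theorem fderiv_apply_eq {F : Coord n → ℝ} {q : Coord n}
    (hg : spatialGrad n (fderiv ℝ F q) ≠ 0) (v : Coord n) :
    fderiv ℝ F q v = ‖spatialGrad n (fderiv ℝ F q)‖ *
      (⟪sliceNormal F q, v.2⟫ - sliceSpeed F q * v.1) := by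
  have hpos : 0 < ‖spatialGrad n (fderiv ℝ F q)‖ := norm_pos_iff.2 hg
  have h : v = v.1 • ((1, 0) : Coord n) + (0, v.2) := by ext1 <;> simp
  conv_lhs => rw [h, map_add, map_smul]
  rw [sliceNormal, sliceSpeed, real_inner_smul_left, inner_spatialGrad]
  field_simp
  rw [smul_eq_mul]
  ring

/-- Normalizing the gradient projects its derivative onto the orthogonal complement of the normal;
hence the Hessian is evaluated on the tangential part of `w`. -/
theorem hasFDerivAt_sliceNormal {F : Coord n → ℝ} {q : Coord n} (hF : ContDiffAt ℝ ∞ F q)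
    (hg : spatialGrad n (fderiv ℝ F q) ≠ 0) :
    HasFDerivAt (sliceNormal F) (fderiv ℝ (sliceNormal F) q) q ∧
    ∀ (v : Coord n) (w : EuclideanSpace ℝ (Fin n)), ⟪fderiv ℝ (sliceNormal F) q v, w⟫ =
      ‖spatialGrad n (fderiv ℝ F q)‖⁻¹ *
        fderiv ℝ (fderiv ℝ F) q v (0, w - ⟪sliceNormal F q, w⟫ • sliceNormal F q) := by
  have hpos : 0 < ‖spatialGrad n (fderiv ℝ F q)‖ := norm_pos_iff.2 hg
  have h1 := (hasFDerivAt_inv_norm_spatialGrad hF hg).smul (hasFDerivAt_spatialGrad hF)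
  have h2 : HasFDerivAt (sliceNormal F) _ q := h1
  refine ⟨h2.differentiableAt.hasFDerivAt, fun v w => ?_⟩
  rw [h2.fderiv]
  have h3 : ((0, w - ⟪sliceNormal F q, w⟫ • sliceNormal F q) : Coord n)
      = (0, w) - ⟪sliceNormal F q, w⟫ • (0, sliceNormal F q) := by ext1 <;> simp
  rw [h3, map_sub, map_smul, ← inner_spatialGrad, ← inner_spatialGrad]
  simp only [add_apply, smul_apply, ContinuousLinearMap.comp_apply,
    ContinuousLinearMap.smulRight_apply, innerSL_apply_apply, inner_add_left, real_inner_smul_left,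
    smul_eq_mul, sliceNormal, real_inner_smul_right]
  rw [real_inner_comm (spatialGrad n (fderiv ℝ F q)) (spatialGrad n (fderiv ℝ (fderiv ℝ F) q v))]
  field_simp
  ring

theorem hasFDerivAt_sliceSpeed {F : Coord n → ℝ} {q : Coord n} (hF : ContDiffAt ℝ ∞ F q)
    (hg : spatialGrad n (fderiv ℝ F q) ≠ 0) :
    HasFDerivAt (sliceSpeed F) (fderiv ℝ (sliceSpeed F) q) q ∧
    ∀ v : Coord n, fderiv ℝ (sliceSpeed F) q v = -(‖spatialGrad n (fderiv ℝ F q)‖⁻¹ *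
        fderiv ℝ (fderiv ℝ F) q v (1, sliceSpeed F q • sliceNormal F q)) := by
  have hpos : 0 < ‖spatialGrad n (fderiv ℝ F q)‖ := norm_pos_iff.2 hg
  have h0 : HasFDerivAt (fderiv ℝ F) (fderiv ℝ (fderiv ℝ F) q) q :=
    ((hF.fderiv_right (m := ∞) (by simp)).differentiableAt (by simp)).hasFDerivAt
  have h1 := ((h0.clm_apply (hasFDerivAt_const ((1, 0) : Coord n) q)).neg).mul
    (hasFDerivAt_inv_norm_spatialGrad hF hg)
  have h2 : HasFDerivAt (sliceSpeed F) _ q := h1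
  refine ⟨h2.differentiableAt.hasFDerivAt, fun v => ?_⟩
  rw [h2.fderiv]
  have h3 : ((1, sliceSpeed F q • sliceNormal F q) : Coord n)
      = (1, 0) + sliceSpeed F q • (0, sliceNormal F q) := by ext1 <;> simp
  rw [h3, map_add, map_smul, ← inner_spatialGrad]
  simp [sliceSpeed, sliceNormal, real_inner_smul_right, real_inner_comm]
  field_simp
  ring

theorem contDiffAt_spatialGrad {F : Coord n → ℝ} {q : Coord n} (hF : ContDiffAt ℝ ∞ F q) :
    ContDiffAt ℝ ∞ (fun x => spatialGrad n (fderiv ℝ F x)) q :=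
  (spatialGrad n).contDiff.contDiffAt.comp q (hF.fderiv_right (by simp))

theorem contDiffAt_inv_norm_spatialGrad {F : Coord n → ℝ} {q : Coord n} (hF : ContDiffAt ℝ ∞ F q)
    (hg : spatialGrad n (fderiv ℝ F q) ≠ 0) :
    ContDiffAt ℝ ∞ (fun x => ‖spatialGrad n (fderiv ℝ F x)‖⁻¹) q :=
  ((contDiffAt_spatialGrad hF).norm ℝ hg).inv (norm_ne_zero_iff.2 hg)

theorem contDiffAt_sliceNormal {F : Coord n → ℝ} {q : Coord n} (hF : ContDiffAt ℝ ∞ F q)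
    (hg : spatialGrad n (fderiv ℝ F q) ≠ 0) : ContDiffAt ℝ ∞ (sliceNormal F) q :=
  (contDiffAt_inv_norm_spatialGrad hF hg).smul (contDiffAt_spatialGrad hF)

theorem contDiffAt_sliceSpeed {F : Coord n → ℝ} {q : Coord n} (hF : ContDiffAt ℝ ∞ F q)
    (hg : spatialGrad n (fderiv ℝ F q) ≠ 0) : ContDiffAt ℝ ∞ (sliceSpeed F) q :=
  ((hF.fderiv_right (m := ∞) (by simp)).clm_apply contDiffAt_const).neg.mul
    (contDiffAt_inv_norm_spatialGrad hF hg)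

end Umbilic

end SchwarzschildPhoton

namespace SchwarzschildPhoton

/-! ### Umbilic slices and the Codazzi conditions for the metric `-N² dt² + |dy|²`. -/

section Dichotomy

open Filter Set
open scoped RealInnerProductSpace

variable {n : ℕ} {N : EuclideanSpace ℝ (Fin n) → ℝ}
  {G : EuclideanSpace ℝ (Fin n) → EuclideanSpace ℝ (Fin n)} {F : Coord n → ℝ} {p q : Coord n}

/-- At the point `q` the level set of `F` is timelike for the metric `-N² dt² + |dy|²`, where `G` is
the gradient of `N`, and its second fundamental form vanishes on null vectors. -/
structure IsNullGeodesicAt (N : EuclideanSpace ℝ (Fin n) → ℝ)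
    (G : EuclideanSpace ℝ (Fin n) → EuclideanSpace ℝ (Fin n)) (F : Coord n → ℝ)
    (q : Coord n) : Prop where
  smooth : ContDiffAt ℝ ∞ F q
  pos : 0 < N q.2
  timelike : fderiv ℝ F q (1, 0) ^ 2 < N q.2 ^ 2 * ‖spatialGrad n (fderiv ℝ F q)‖ ^ 2
  hess : ∀ w, ‖w‖ = N q.2 → fderiv ℝ F q (1, w) = 0 →
    fderiv ℝ (fderiv ℝ F) q (1, w) (1, w) =
      2 * fderiv ℝ F q (1, 0) / N q.2 * ⟪G q.2, w⟫ + N q.2 * fderiv ℝ F q (0, G q.2)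

/-- The umbilicity factor of the time-slices. -/
noncomputable def sliceFactor (N : EuclideanSpace ℝ (Fin n) → ℝ)
    (G : EuclideanSpace ℝ (Fin n) → EuclideanSpace ℝ (Fin n)) (F : Coord n → ℝ)
    (q : Coord n) : ℝ :=
  (N q.2 * ⟪G q.2, sliceNormal F q⟫ - 2 * sliceSpeed F q ^ 2 / N q.2 * ⟪G q.2, sliceNormal F q⟫
    - ‖spatialGrad n (fderiv ℝ F q)‖⁻¹ * fderiv ℝ (fderiv ℝ F) q
      (1, sliceSpeed F q • sliceNormal F q) (1, sliceSpeed F q • sliceNormal F q))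
    / (N q.2 ^ 2 - sliceSpeed F q ^ 2)

namespace IsNullGeodesicAt

theorem grad_ne_zero (h : IsNullGeodesicAt N G F q) : spatialGrad n (fderiv ℝ F q) ≠ 0 := by
  intro h0
  have := h.timelike
  rw [h0, norm_zero] at this
  nlinarith [sq_nonneg (fderiv ℝ F q (1, 0))]

theorem grad_pos (h : IsNullGeodesicAt N G F q) : 0 < ‖spatialGrad n (fderiv ℝ F q)‖ :=
  norm_pos_iff.2 h.grad_ne_zero

theorem fderiv_time (h : IsNullGeodesicAt N G F q) :
    fderiv ℝ F q (1, 0) = -(‖spatialGrad n (fderiv ℝ F q)‖ * sliceSpeed F q) := by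
  rw [fderiv_apply_eq h.grad_ne_zero]
  simp

theorem speed_lt (h : IsNullGeodesicAt N G F q) : 0 < N q.2 ^ 2 - sliceSpeed F q ^ 2 := by
  have h1 := h.timelike
  rw [h.fderiv_time, neg_sq, mul_pow, mul_comm] at h1
  have := lt_of_mul_lt_mul_right h1 (by positivity)
  linarith

theorem tangent_iff (h : IsNullGeodesicAt N G F q) (v : Coord n) :
    fderiv ℝ F q v = 0 ↔ ⟪sliceNormal F q, v.2⟫ = sliceSpeed F q * v.1 := by
  rw [fderiv_apply_eq h.grad_ne_zero, mul_eq_zero, or_iff_right h.grad_pos.ne', sub_eq_zero]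

theorem isSymm (h : IsNullGeodesicAt N G F q) (v w : Coord n) :
    fderiv ℝ (fderiv ℝ F) q v w = fderiv ℝ (fderiv ℝ F) q w v :=
  (h.smooth.isSymmSndFDerivAt_of_infty).eq v w

/-- The vectors `(1, cν ± ℓw)` with `ℓ² = N² - c²` are null and tangent. The sum of the two null
conditions isolates the Hessian on `(w, w)`, which turns out not to depend on `w`; their difference
isolates the mixed term. -/
theorem hess_unit (h : IsNullGeodesicAt N G F q) {w : EuclideanSpace ℝ (Fin n)} (hw : ‖w‖ = 1)
    (hν : ⟪sliceNormal F q, w⟫ = 0) :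
    fderiv ℝ (fderiv ℝ F) q (0, w) (0, w) =
        ‖spatialGrad n (fderiv ℝ F q)‖ * sliceFactor N G F q ∧
    fderiv ℝ (fderiv ℝ F) q (1, sliceSpeed F q • sliceNormal F q) (0, w) =
        fderiv ℝ F q (1, 0) / N q.2 * ⟪G q.2, w⟫ := by
  have hN := h.pos
  have hg := h.grad_pos
  have hlt := h.speed_lt
  have hνn := norm_sliceNormal h.grad_ne_zero
  set ν := sliceNormal F q with hνdef
  set c := sliceSpeed F q with hc
  set g := ‖spatialGrad n (fderiv ℝ F q)‖
  set b := fderiv ℝ (fderiv ℝ F) q with hb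
  set ℓ := √(N q.2 ^ 2 - c ^ 2) with hℓ
  have hℓ2 : ℓ ^ 2 = N q.2 ^ 2 - c ^ 2 := Real.sq_sqrt hlt.le
  have hℓ0 : 0 < ℓ := Real.sqrt_pos.2 hlt
  have hνν : ⟪ν, ν⟫ = 1 := by rw [real_inner_self_eq_norm_sq, hνn, one_pow]
  have hww : ⟪w, w⟫ = 1 := by rw [real_inner_self_eq_norm_sq, hw, one_pow]
  have hwν : ⟪w, ν⟫ = 0 := by rw [real_inner_comm]; exact hν
  have key : ∀ s : ℝ, s ^ 2 = ℓ ^ 2 →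
      b (1, c • ν) (1, c • ν) + 2 * s * b (1, c • ν) (0, w) + s ^ 2 * b (0, w) (0, w) =
        2 * fderiv ℝ F q (1, 0) / N q.2 * (c * ⟪G q.2, ν⟫ + s * ⟪G q.2, w⟫)
          + N q.2 * (g * ⟪ν, G q.2⟫) := by
    intro s hs
    have hnorm : ‖c • ν + s • w‖ = N q.2 := by
      have h1 : ‖c • ν + s • w‖ ^ 2 = N q.2 ^ 2 := by
        rw [← real_inner_self_eq_norm_sq]
        simp only [inner_add_left, inner_add_right, real_inner_smul_left, real_inner_smul_right,
          hνν, hww, hν, hwν]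
        linear_combination hs + hℓ2
      exact (sq_eq_sq₀ (norm_nonneg _) hN.le).1 h1
    have htan : fderiv ℝ F q (1, c • ν + s • w) = 0 := by
      rw [h.tangent_iff]
      simp only [inner_add_right, real_inner_smul_right]
      rw [← hνdef, hνν, hν]
      ring
    have h1 := h.hess _ hnorm htan
    have hsplit : ((1, c • ν + s • w) : Coord n) = (1, c • ν) + s • (0, w) := by ext1 <;> simp
    have hG : fderiv ℝ F q (0, G q.2) = g * ⟪ν, G q.2⟫ := by
      rw [fderiv_apply_eq h.grad_ne_zero]
      simp [g, ν]
    rw [hsplit, ← hb, hG] at h1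
    simp only [map_add, map_smul, add_apply, smul_apply, smul_eq_mul, inner_add_right,
      real_inner_smul_right] at h1
    have hsym := h.isSymm (0, w) (1, c • ν)
    rw [← hb] at hsym
    rw [hsym] at h1
    linear_combination h1
  have k1 := key ℓ rfl
  have k2 := key (-ℓ) (neg_sq ℓ)
  have k3 : b (1, c • ν) (0, w) = fderiv ℝ F q (1, 0) / N q.2 * ⟪G q.2, w⟫ := by
    have : ℓ * (b (1, c • ν) (0, w) - fderiv ℝ F q (1, 0) / N q.2 * ⟪G q.2, w⟫) = 0 := by
      linear_combination (k1 - k2) / 4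
    exact sub_eq_zero.1 ((mul_eq_zero.1 this).resolve_left hℓ0.ne')
  refine ⟨?_, k3⟩
  have k4 : fderiv ℝ F q (1, 0) = -(g * c) := h.fderiv_time
  have hdef : sliceFactor N G F q = (N q.2 * ⟪G q.2, ν⟫ - 2 * c ^ 2 / N q.2 * ⟪G q.2, ν⟫
    - g⁻¹ * b (1, c • ν) (1, c • ν)) / (N q.2 ^ 2 - c ^ 2) := rfl
  rw [hdef, ← hℓ2]
  have k5 : b (0, w) (0, w) * ℓ ^ 2 = 2 * fderiv ℝ F q (1, 0) / N q.2 * (c * ⟪G q.2, ν⟫)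
      + N q.2 * (g * ⟪ν, G q.2⟫) - b (1, c • ν) (1, c • ν) := by
    linear_combination (k1 + k2) / 2
  rw [k4, real_inner_comm (G q.2) ν] at k5
  rw [← mul_div_assoc, eq_div_iff (by positivity), k5]
  field_simp
  ring

/-- Scaling and polarization of `hess_unit`: the time-slices are umbilic in Euclidean space. -/
theorem hess_space (h : IsNullGeodesicAt N G F q) {w z : EuclideanSpace ℝ (Fin n)}
    (hw : ⟪sliceNormal F q, w⟫ = 0) (hz : ⟪sliceNormal F q, z⟫ = 0) :
    fderiv ℝ (fderiv ℝ F) q (0, w) (0, z) =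
      ‖spatialGrad n (fderiv ℝ F q)‖ * sliceFactor N G F q * ⟪w, z⟫ := by
  have hdiag : ∀ u : EuclideanSpace ℝ (Fin n), ⟪sliceNormal F q, u⟫ = 0 →
      fderiv ℝ (fderiv ℝ F) q (0, u) (0, u) =
        ‖spatialGrad n (fderiv ℝ F q)‖ * sliceFactor N G F q * ‖u‖ ^ 2 := by
    intro u hu
    rcases eq_or_ne u 0 with rfl | h0
    · have : ((0, 0) : Coord n) = 0 := rfl
      simp [this]
    have hpos := norm_pos_iff.2 h0
    have h1 := (h.hess_unit (w := ‖u‖⁻¹ • u) (by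
      rw [norm_smul, norm_inv, norm_norm, inv_mul_cancel₀ hpos.ne']) (by
      rw [real_inner_smul_right, hu, mul_zero])).1
    have h2 : ((0, ‖u‖⁻¹ • u) : Coord n) = ‖u‖⁻¹ • (0, u) := by ext1 <;> simp
    rw [h2] at h1
    simp only [map_smul, smul_apply, smul_eq_mul] at h1
    rw [← h1]
    field_simp
  have hadd := hdiag (w + z) (by rw [inner_add_right, hw, hz, add_zero])
  have h2 : ((0, w + z) : Coord n) = (0, w) + (0, z) := by ext1 <;> simp
  rw [h2] at hadd
  simp only [map_add, add_apply] at hadd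
  rw [hdiag w hw, hdiag z hz, h.isSymm (0, z) (0, w), ← real_inner_self_eq_norm_sq (w + z),
    inner_add_left, inner_add_right, inner_add_right, real_inner_self_eq_norm_sq,
    real_inner_self_eq_norm_sq, real_inner_comm w z] at hadd
  linarith

theorem hess_time_space (h : IsNullGeodesicAt N G F q) {w : EuclideanSpace ℝ (Fin n)}
    (hw : ⟪sliceNormal F q, w⟫ = 0) :
    fderiv ℝ (fderiv ℝ F) q (1, sliceSpeed F q • sliceNormal F q) (0, w) =
        fderiv ℝ F q (1, 0) / N q.2 * ⟪G q.2, w⟫ := by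
  rcases eq_or_ne w 0 with rfl | h0
  · have : ((0, 0) : Coord n) = 0 := rfl
    simp [this]
  have hpos := norm_pos_iff.2 h0
  have h1 := (h.hess_unit (w := ‖w‖⁻¹ • w) (by
    rw [norm_smul, norm_inv, norm_norm, inv_mul_cancel₀ hpos.ne']) (by
    rw [real_inner_smul_right, hw, mul_zero])).2
  have h2 : ((0, ‖w‖⁻¹ • w) : Coord n) = ‖w‖⁻¹ • (0, w) := by ext1 <;> simp
  rw [h2] at h1
  simp only [map_smul, smul_eq_mul, real_inner_smul_right] at h1
  have hi : ‖w‖⁻¹ ≠ 0 := inv_ne_zero hpos.ne'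
  refine mul_left_cancel₀ hi ?_
  linear_combination h1

/-- A tangent vector splits into a multiple of `(1, cν)` and a vector tangent to the slice, and the
Hessian is known on both. Along the surface this reads `dν = κ dy + β dt`, the form to which the
integrability argument applies. -/
theorem fderiv_sliceNormal (h : IsNullGeodesicAt N G F q) {v : Coord n}
    (hv : fderiv ℝ F q v = 0) :
    fderiv ℝ (sliceNormal F) q v = sliceFactor N G F q • v.2 + v.1 •
      (-(sliceFactor N G F q * sliceSpeed F q) • sliceNormal F q
        - (sliceSpeed F q / N q.2) • (G q.2 - ⟪G q.2, sliceNormal F q⟫ • sliceNormal F q)) := by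
  have hν := norm_sliceNormal h.grad_ne_zero
  have hg := h.grad_pos
  have hN := h.pos
  rw [h.tangent_iff] at hv
  refine ext_inner_right ℝ fun w => ?_
  rw [(hasFDerivAt_sliceNormal h.smooth h.grad_ne_zero).2]
  have hνν : ⟪sliceNormal F q, sliceNormal F q⟫ = 1 := by
    rw [real_inner_self_eq_norm_sq, hν, one_pow]
  set ν := sliceNormal F q with hνdef
  set c := sliceSpeed F q with hc
  have hsplit : v = v.1 • ((1, c • ν) : Coord n) + (0, v.2 - (v.1 * c) • ν) := by
    ext1
    · simp
    · simp [smul_smul]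
  have hperp : ⟪ν, w - ⟪ν, w⟫ • ν⟫ = 0 := by
    rw [inner_sub_right, real_inner_smul_right, hνν]; ring
  have hperp2 : ⟪ν, v.2 - (v.1 * c) • ν⟫ = 0 := by
    rw [inner_sub_right, real_inner_smul_right, hνν, hv]; ring
  conv_lhs => rw [hsplit]
  rw [map_add, map_smul, add_apply, smul_apply, h.hess_space hperp2 hperp, h.hess_time_space hperp,
    h.fderiv_time, ← hc]
  simp only [inner_add_left, inner_sub_left, inner_sub_right, real_inner_smul_left,
    real_inner_smul_right, smul_eq_mul, hνν]
  rw [real_inner_comm ν v.2, hv]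
  field_simp
  ring

theorem fderiv_sliceSpeed_space (h : IsNullGeodesicAt N G F q) {w : EuclideanSpace ℝ (Fin n)}
    (hw : ⟪sliceNormal F q, w⟫ = 0) :
    fderiv ℝ (sliceSpeed F) q (0, w) = sliceSpeed F q / N q.2 * ⟪G q.2, w⟫ := by
  have hg := h.grad_pos
  have hN := h.pos
  rw [(hasFDerivAt_sliceSpeed h.smooth h.grad_ne_zero).2, h.isSymm, h.hess_time_space hw,
    h.fderiv_time]
  field_simp

/-- If the speed and its derivative along `(1, cν)` vanish, only the gradient term of the slice
factor survives. Being a relation without second derivatives of `F`, it can be differentiated once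
more. -/
theorem sliceFactor_of_static (h : IsNullGeodesicAt N G F q) (hc : sliceSpeed F q = 0)
    (hd : fderiv ℝ (sliceSpeed F) q (1, sliceSpeed F q • sliceNormal F q) = 0) :
    sliceFactor N G F q * N q.2 - ⟪G q.2, sliceNormal F q⟫ = 0 := by
  have hN := h.pos
  rw [(hasFDerivAt_sliceSpeed h.smooth h.grad_ne_zero).2, neg_eq_zero] at hd
  rw [sliceFactor, hd, hc]
  field_simp
  ring

end IsNullGeodesicAt

variable {H : EuclideanSpace ℝ (Fin n) →L[ℝ] EuclideanSpace ℝ (Fin n)}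

theorem differentiableAt_sliceFactor (h : IsNullGeodesicAt N G F p)
    (hN : DifferentiableAt ℝ N p.2) (hG : DifferentiableAt ℝ G p.2) :
    DifferentiableAt ℝ (sliceFactor N G F) p := by
  have hν := (contDiffAt_sliceNormal h.smooth h.grad_ne_zero).differentiableAt (by simp)
  have hc := (contDiffAt_sliceSpeed h.smooth h.grad_ne_zero).differentiableAt (by simp)
  have hi := (contDiffAt_inv_norm_spatialGrad h.smooth h.grad_ne_zero).differentiableAt (by simp)
  have hD : DifferentiableAt ℝ (fderiv ℝ (fderiv ℝ F)) p :=
    ((h.smooth.fderiv_right (m := ∞) (by simp)).fderiv_right (m := ∞) (by simp)).differentiableAt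
      (by simp)
  have hN' : DifferentiableAt ℝ (fun x : Coord n => N x.2) p :=
    DifferentiableAt.comp (g := N) p hN differentiableAt_snd
  have hG' : DifferentiableAt ℝ (fun x : Coord n => G x.2) p :=
    DifferentiableAt.comp (g := G) p hG differentiableAt_snd
  have hGν := hG'.inner ℝ hν
  have hT : DifferentiableAt ℝ (fun x => ((1, sliceSpeed F x • sliceNormal F x) : Coord n)) p :=
    (differentiableAt_const _).prodMk (hc.smul hν)
  have hq : DifferentiableAt ℝ (fun x => 2 * sliceSpeed F x ^ 2 / N x.2) p := by
    simp only [div_eq_mul_inv]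
    exact ((hc.pow 2).const_mul 2).mul (hN'.inv h.pos.ne')
  have hden : DifferentiableAt ℝ (fun x => N x.2 ^ 2 - sliceSpeed F x ^ 2) p :=
    (hN'.pow 2).sub (hc.pow 2)
  have h1 := (((hN'.mul hGν).sub (hq.mul hGν)).sub
    (hi.mul ((hD.clm_apply hT).clm_apply hT))).mul (hden.inv h.speed_lt.ne')
  exact h1.congr_of_eventuallyEq (Eventually.of_forall fun x => div_eq_mul_inv _ _)

/-- Integrability conditions at a point of a null totally geodesic timelike hypersurface of the
metric `-N² dt² + |dy|²`: the Hessian `H` of `N` is a multiple of the identity on the slice unless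
the slice is momentarily static, and the normal is an eigenvector of `H` if the hypersurface is
static. -/
theorem hessian_conditions (hn : 3 ≤ n) (hp : F p = 0)
    (hF : ∀ᶠ q in 𝓝 p, F q = 0 → IsNullGeodesicAt N G F q)
    (hN : ∀ᶠ y in 𝓝 p.2, HasFDerivAt N (innerSL ℝ (G y)) y) (hG : HasFDerivAt G H p.2) :
    (∀ w z, ⟪sliceNormal F p, w⟫ = 0 → ⟪sliceNormal F p, z⟫ = 0 → ⟪w, z⟫ = 0 →
      sliceSpeed F p * ⟪H w, z⟫ = 0) ∧
    ((∀ᶠ q in 𝓝 p, F q = 0 → sliceSpeed F q = 0) →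
      ∀ w, ⟪sliceNormal F p, w⟫ = 0 → ⟪H w, sliceNormal F p⟫ = 0) := by
  have h := hF.self_of_nhds hp
  have hreg : fderiv ℝ F p ≠ 0 := by
    intro h0
    exact h.grad_ne_zero (by rw [h0, map_zero])
  have hNp := hN.self_of_nhds
  have hNpos := h.pos
  have hκ := differentiableAt_sliceFactor h hNp.differentiableAt hG.differentiableAt
  have hνd := (hasFDerivAt_sliceNormal h.smooth h.grad_ne_zero).1
  have hcd := (hasFDerivAt_sliceSpeed h.smooth h.grad_ne_zero).1
  have hN' : HasFDerivAt (fun x : Coord n => N x.2)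
      ((innerSL ℝ (G p.2)).comp (ContinuousLinearMap.snd ℝ ℝ (EuclideanSpace ℝ (Fin n)))) p :=
    HasFDerivAt.comp (g := N) p hNp hasFDerivAt_snd
  have hG' : HasFDerivAt (fun x : Coord n => G x.2)
      (H.comp (ContinuousLinearMap.snd ℝ ℝ (EuclideanSpace ℝ (Fin n)))) p :=
    HasFDerivAt.comp (g := G) p hG hasFDerivAt_snd
  let β : Coord n → EuclideanSpace ℝ (Fin n) := fun q =>
    -(sliceFactor N G F q * sliceSpeed F q) • sliceNormal F q
        - (sliceSpeed F q / N q.2) • (G q.2 - ⟪G q.2, sliceNormal F q⟫ • sliceNormal F q)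
  have hquot : HasFDerivAt (fun q : Coord n => sliceSpeed F q / N q.2) _ p :=
    (hcd.mul ((hasDerivAt_inv hNpos.ne').comp_hasFDerivAt p hN')).congr_of_eventuallyEq
      (Eventually.of_forall fun q => div_eq_mul_inv _ _)
  have hβ' : HasFDerivAt β _ p :=
    (((hκ.hasFDerivAt.mul hcd).neg).smul hνd).sub
      (hquot.smul (hG'.sub ((hG'.inner ℝ hνd).smul hνd)))
  have hβ : HasFDerivAt β (fderiv ℝ β p) p := hβ'.differentiableAt.hasFDerivAt
  let θ : Coord n → Coord n →L[ℝ] EuclideanSpace ℝ (Fin n) := fun q =>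
    sliceFactor N G F q • ContinuousLinearMap.snd ℝ ℝ (EuclideanSpace ℝ (Fin n)) +
      ContinuousLinearMap.smulRightL ℝ (Coord n) (EuclideanSpace ℝ (Fin n))
        (ContinuousLinearMap.fst ℝ ℝ (EuclideanSpace ℝ (Fin n))) (β q)
  have hθ : HasFDerivAt θ _ p :=
    (hκ.hasFDerivAt.smul_const (ContinuousLinearMap.snd ℝ ℝ (EuclideanSpace ℝ (Fin n)))).add
      ((ContinuousLinearMap.smulRightL ℝ (Coord n) (EuclideanSpace ℝ (Fin n))
        (ContinuousLinearMap.fst ℝ ℝ (EuclideanSpace ℝ (Fin n)))).hasFDerivAt.comp p hβ)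
  -- The Codazzi equation: the exterior derivative of `θ = κ dy + β dt` vanishes on tangent vectors,
  -- as `θ` restricts to the differential of the normal.
  have hcod : ∀ v w : Coord n, fderiv ℝ F p v = 0 → fderiv ℝ F p w = 0 →
      fderiv ℝ (sliceFactor N G F) p v • w.2 + w.1 • fderiv ℝ β p v =
        fderiv ℝ (sliceFactor N G F) p w • v.2 + v.1 • fderiv ℝ β p w := by
    intro v w hv hw
    have := fderiv_symm_of_eq_on_zeroSet h.smooth hp hreg
      (contDiffAt_sliceNormal h.smooth h.grad_ne_zero) hθ.differentiableAt
      (hF.mono fun q hq hFq v hv => by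
        rw [(hq hFq).fderiv_sliceNormal hv]
        simp [θ, β]) hv hw
    rw [hθ.fderiv] at this
    simpa using this
  have hspace : ∀ w, ⟪sliceNormal F p, w⟫ = 0 → fderiv ℝ F p (0, w) = 0 := by
    intro w hw
    rw [h.tangent_iff, hw]
    simp
  have hνν : ⟪sliceNormal F p, sliceNormal F p⟫ = 1 := by
    rw [real_inner_self_eq_norm_sq, norm_sliceNormal h.grad_ne_zero, one_pow]
  have hDν : ∀ w, ⟪sliceNormal F p, w⟫ = 0 →
      fderiv ℝ (sliceNormal F) p (0, w) = sliceFactor N G F p • w := by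
    intro w hw
    rw [h.fderiv_sliceNormal (hspace w hw)]
    simp
  -- The factor of an umbilic slice is constant on the slice: compare with a nonzero tangent `z`
  -- orthogonal to `w`, which exists because `n ≥ 3`.
  have hκw : ∀ w, ⟪sliceNormal F p, w⟫ = 0 → fderiv ℝ (sliceFactor N G F) p (0, w) = 0 := by
    intro w hw
    rcases eq_or_ne w 0 with rfl | hw0
    · have : ((0, 0) : Coord n) = 0 := rfl
      rw [this, map_zero]
    obtain ⟨z, hz0, hz1, hz2⟩ : ∃ z : EuclideanSpace ℝ (Fin n), z ≠ 0 ∧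
        ⟪sliceNormal F p, z⟫ = 0 ∧ ⟪w, z⟫ = 0 := by
      let f : EuclideanSpace ℝ (Fin n) →ₗ[ℝ] ℝ × ℝ :=
        ((innerSL ℝ (sliceNormal F p)).prod (innerSL ℝ w)).toLinearMap
      have hker : LinearMap.ker f ≠ ⊥ := by
        apply LinearMap.ker_ne_bot_of_finrank_lt
        simp
        omega
      obtain ⟨z, hz, hz0⟩ := Submodule.exists_mem_ne_zero_of_ne_bot hker
      have hz' : (⟪sliceNormal F p, z⟫, ⟪w, z⟫) = ((0, 0) : ℝ × ℝ) := hz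
      exact ⟨z, hz0, congrArg Prod.fst hz', congrArg Prod.snd hz'⟩
    have := hcod (0, w) (0, z) (hspace w hw) (hspace z hz1)
    simp only [zero_smul, add_zero] at this
    have h2 := congrArg (fun x => ⟪x, z⟫) this
    simp only [real_inner_smul_left, hz2, mul_zero, real_inner_self_eq_norm_sq] at h2
    exact (mul_eq_zero.1 h2).resolve_right (pow_ne_zero 2 (norm_ne_zero_iff.2 hz0))
  constructor
  · intro w z hw hz hwz
    have hT : fderiv ℝ F p (1, sliceSpeed F p • sliceNormal F p) = 0 := by
      rw [h.tangent_iff, real_inner_smul_right, hνν]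
    have h1 := hcod (0, w) _ (hspace w hw) hT
    rw [hκw w hw] at h1
    simp only [zero_smul, zero_add, one_smul, add_zero] at h1
    have h2 := congrArg (fun x => ⟪x, z⟫) h1
    rw [hβ'.fderiv] at h2
    simp [hwz, hz, hDν w hw, hκw w hw, h.fderiv_sliceSpeed_space hw, real_inner_smul_left,
      inner_add_left, inner_sub_left] at h2
    -- The quotient `c/N` has zero derivative along the slice, so in the derivative of `β` paired
    -- with `z` only the Hessian of `N` is left.
    have h3 : -(sliceSpeed F p * ((N p.2 ^ 2)⁻¹ * ⟪G p.2, w⟫))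
      + (N p.2)⁻¹ * (sliceSpeed F p / N p.2 * ⟪G p.2, w⟫) = 0 := by
      field_simp
      ring
    rw [h3] at h2
    simpa [hNpos.ne'] using h2
  · intro hst w hw
    have hq : DifferentiableAt ℝ
        (fun q : Coord n => sliceFactor N G F q * N q.2 - ⟪G q.2, sliceNormal F q⟫) p :=
      (hκ.mul hN'.differentiableAt).sub (hG'.differentiableAt.inner ℝ hνd.differentiableAt)
    -- On a static surface `κN = ⟪G, ν⟫`. In its derivative along the slice the terms `κ⟪G, w⟫`
    -- cancel and `dκ(w) = 0`, leaving `⟪Hw, ν⟫ = 0`.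
    have hvan : ∀ᶠ q in 𝓝 p, F q = 0 →
        sliceFactor N G F q * N q.2 - ⟪G q.2, sliceNormal F q⟫ = 0 := by
      filter_upwards [hF, hst, hst.eventually_nhds] with q hq1 hq2 hq3 hq0
      have h1 := hq1 hq0
      have hreg1 : fderiv ℝ F q ≠ 0 := by
        intro h0
        exact h1.grad_ne_zero (by rw [h0, map_zero])
      have hνν1 : ⟪sliceNormal F q, sliceNormal F q⟫ = 1 := by
        rw [real_inner_self_eq_norm_sq, norm_sliceNormal h1.grad_ne_zero, one_pow]
      refine h1.sliceFactor_of_static (hq2 hq0) ?_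
      refine fderiv_eq_zero_of_vanishing h1.smooth hq0 hreg1
        (hasFDerivAt_sliceSpeed h1.smooth h1.grad_ne_zero).1.differentiableAt hq3 ?_
      rw [h1.tangent_iff, real_inner_smul_right, hνν1]
    have hv := fderiv_eq_zero_of_vanishing h.smooth hp hreg hq hvan (hspace w hw)
    have hq' : HasFDerivAt
        (fun q : Coord n => sliceFactor N G F q * N q.2 - ⟪G q.2, sliceNormal F q⟫) _ p :=
      (hκ.hasFDerivAt.mul hN').sub (hG'.inner ℝ hνd)
    rw [hq'.fderiv] at hv
    simp [hDν w hw, hκw w hw, real_inner_smul_right] at hv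
    exact hv

end Dichotomy

end SchwarzschildPhoton

/-! ### Second derivatives along curves and propagation over connected sets. -/

section SecondDerivative

open Filter Set

variable {E : Type*} [NormedAddCommGroup E] [NormedSpace ℝ E]
variable {V : Type*} [NormedAddCommGroup V] [NormedSpace ℝ V]

theorem ContDiffAt.hasFDerivAt_fderiv {f : E → V} {x : E} (hf : ContDiffAt ℝ ∞ f x) :
    HasFDerivAt (fderiv ℝ f) (fderiv ℝ (fderiv ℝ f) x) x :=
  ((hf.fderiv_right (m := ∞) (by simp)).differentiableAt (by simp)).hasFDerivAt

/-- The first two derivatives of a function along a curve. -/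
theorem ContDiffAt.hasDerivAt_along {F : E → ℝ} {c c' : ℝ → E} {c'' : E} {t : ℝ}
    (hF : ContDiffAt ℝ ∞ F (c t)) (hc : ∀ᶠ s in 𝓝 t, HasDerivAt c (c' s) s)
    (hc' : HasDerivAt c' c'' t) :
    (∀ᶠ s in 𝓝 t, HasDerivAt (fun s => F (c s)) (fderiv ℝ F (c s) (c' s)) s) ∧
    HasDerivAt (fun s => fderiv ℝ F (c s) (c' s))
      (fderiv ℝ (fderiv ℝ F) (c t) (c' t) (c' t) + fderiv ℝ F (c t) c'') t := by
  have hct : Tendsto c (𝓝 t) (𝓝 (c t)) := hc.self_of_nhds.continuousAt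
  constructor
  · filter_upwards [hc, hct.eventually hF.eventually_differentiableAt] with s h1 h2
    exact h2.hasFDerivAt.comp_hasDerivAt s h1
  · have h1 := hF.hasFDerivAt_fderiv.comp_hasDerivAt t hc.self_of_nhds
    exact h1.clm_apply hc'

/-- The points of `S` satisfying `A` form a clopen subset of `S`. -/
theorem IsPreconnected.forall_of_eventually {X : Type*} [TopologicalSpace X] {S : Set X}
    (hS : IsPreconnected S) {A : X → Prop} (h1 : ∀ p ∈ S, A p → ∀ᶠ q in 𝓝 p, q ∈ S → A q)
    (h2 : ∀ p ∈ S, ¬ A p → ∀ᶠ q in 𝓝 p, q ∈ S → ¬ A q) {p : X} (hp : p ∈ S) (hA : A p) :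
    ∀ q ∈ S, A q := by
  have hc : IsClopen {x : S | A x} := by
    constructor
    · rw [← isOpen_compl_iff, isOpen_iff_mem_nhds]
      intro x hx
      have := (continuous_subtype_val.tendsto x).eventually (h2 x x.2 hx)
      filter_upwards [this] with y hy using hy y.2
    · rw [isOpen_iff_mem_nhds]
      intro x hx
      have := (continuous_subtype_val.tendsto x).eventually (h1 x x.2 hx)
      filter_upwards [this] with y hy using hy y.2
  have : PreconnectedSpace S := isPreconnected_iff_preconnectedSpace.1 hS
  have := hc.eq_univ ⟨⟨p, hp⟩, hA⟩
  intro q hq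
  have h3 : (⟨q, hq⟩ : S) ∈ {x : S | A x} := by rw [this]; trivial
  exact h3

end SecondDerivative

namespace SchwarzschildPhoton

/-! ### The second fundamental form of a photon surface on null vectors. -/

section NullHessian

open Filter Set
open scoped RealInnerProductSpace

variable {n : ℕ} {m : ℝ} {P U : Set (Coord n)} {F : Coord n → ℝ} {p v : Coord n}

theorem IsNullGeodesic.eventually_hasDerivAt {I : Set ℝ} {γ : ℝ → Coord n}
    (h : IsNullGeodesic n m I γ) {τ : ℝ} (hτ : τ ∈ I) :
    ∀ᶠ s in 𝓝 τ, HasDerivAt γ (deriv γ s) s := by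
  filter_upwards [h.isOpen.mem_nhds hτ] with s hs using h.hasDerivAt hs

/-- Tangent null vectors of a photon surface integrate to null geodesics inside it. -/
theorem IsPhotonSurface.exists_geodesic (h : IsPhotonSurface n m P) (hn : 3 ≤ n) (hm : 0 < m)
    (hF : IsLocalDefiningFunction P p U F) (hp : p ∈ P) (hv : fderiv ℝ F p v = 0)
    (hnull : metric n m p v v = 0) :
    ∃ I γ, IsNullGeodesic n m I γ ∧ 0 ∈ I ∧ γ 0 = p ∧ deriv γ 0 = v ∧ ∀ᶠ τ in 𝓝 0,
      γ τ ∈ P ∧ deriv γ τ ∈ tangentVectors P (γ τ) := by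
  obtain ⟨I, γ, hγ, h0, rfl, rfl⟩ := exists_isNullGeodesic hn hm (h.subset hp) hnull
  exact ⟨I, γ, hγ, h0, rfl, rfl, h.nullTotallyGeodesic I γ hγ 0 h0 hp
    ((hF.mem_tangentVectors_iff hp).2 hv)⟩

/-- The second fundamental form of a photon surface vanishes on null vectors. -/
theorem IsPhotonSurface.hessian_null (h : IsPhotonSurface n m P) (hn : 3 ≤ n) (hm : 0 < m)
    (hF : IsLocalDefiningFunction P p U F) (hp : p ∈ P) (hv : fderiv ℝ F p v = 0)
    (hnull : metric n m p v v = 0) :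
    fderiv ℝ (fderiv ℝ F) p v v + fderiv ℝ F p (geodesicSpray n m p v) = 0 := by
  obtain ⟨I, γ, hγ, h0, rfl, rfl, hP⟩ := h.exists_geodesic hn hm hF hp hv hnull
  -- The function `F ∘ γ` vanishes near `0`, so its second derivative is zero.
  obtain ⟨h1, h2⟩ := hF.contDiffAt.hasDerivAt_along (hγ.eventually_hasDerivAt h0)
    (hγ.hasDerivAt_deriv hn hm h0)
  have hc : Tendsto γ (𝓝 0) (𝓝 (γ 0)) := (hγ.hasDerivAt h0).continuousAt
  have h3 : ∀ᶠ s in 𝓝 (0 : ℝ), F (γ s) = 0 := by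
    filter_upwards [hP, hc.eventually hF.eventually_iff] with s hs1 hs2 using hs2.1 hs1.1
  have h4 : (fun s => fderiv ℝ F (γ s) (deriv γ s)) =ᶠ[𝓝 0] fun _ => 0 := by
    filter_upwards [h1, h3.eventually_nhds] with s hs1 hs2
    have : (fun s => F (γ s)) =ᶠ[𝓝 s] fun _ => 0 := hs2
    exact hs1.unique ((hasDerivAt_const s (0 : ℝ)).congr_of_eventuallyEq this)
  exact h2.unique ((hasDerivAt_const (0 : ℝ) (0 : ℝ)).congr_of_eventuallyEq h4)

end NullHessian

/-! ### The isotropic radius. -/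

section Isotropic

open Filter Set
open scoped RealInnerProductSpace

variable {n : ℕ} {m s : ℝ}

/-- The static lapse `√f` as a function of the isotropic radius. -/
noncomputable def isoLapse (n : ℕ) (m s : ℝ) : ℝ :=
  (1 - m / (2 * s ^ (n - 2))) / (1 + m / (2 * s ^ (n - 2)))

/-- The ratio of the area radius and the isotropic radius. -/
noncomputable def isoFactor (n : ℕ) (m s : ℝ) : ℝ :=
  (1 + m / (2 * s ^ (n - 2))) ^ (2 / ((n : ℝ) - 2))

theorem isoFactor_pos (hm : 0 < m) (hs : 0 < s) : 0 < isoFactor n m s := by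
  unfold isoFactor
  positivity

theorem hasDerivAt_isoRatio (hn : 3 ≤ n) (hs : 0 < s) :
    HasDerivAt (fun s : ℝ => m / (2 * s ^ (n - 2)))
      (-((n : ℝ) - 2) * (m / (2 * s ^ (n - 2))) / s) s := by
  obtain ⟨k, rfl⟩ : ∃ k, n = k + 3 := ⟨n - 3, by omega⟩
  have h := (((hasDerivAt_pow (k + 1) s).const_mul 2).inv (by positivity)).const_mul m
  refine (h.congr_of_eventuallyEq (Eventually.of_forall fun x => div_eq_mul_inv _ _)).congr_deriv ?_
  simp only [show k + 3 - 2 = k + 1 by omega, Nat.add_sub_cancel]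
  push_cast
  field_simp
  ring

theorem hasDerivAt_isoLapse (hn : 3 ≤ n) (hm : 0 < m) (hs : 0 < s) :
    HasDerivAt (isoLapse n m) (((n : ℝ) - 2) * (1 - isoLapse n m s ^ 2) / (2 * s)) s := by
  have h := hasDerivAt_isoRatio (m := m) hn hs
  have hq : 0 < m / (2 * s ^ (n - 2)) := by positivity
  have h1 := (h.const_sub 1).div (h.const_add 1) (by positivity)
  refine h1.congr_deriv ?_
  unfold isoLapse
  generalize m / (2 * s ^ (n - 2)) = q at *
  have : 1 + q ≠ 0 := by positivity
  field_simp
  ring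

theorem hasDerivAt_isoFactor (hn : 3 ≤ n) (hm : 0 < m) (hs : 0 < s) :
    HasDerivAt (isoFactor n m) (isoFactor n m s * (isoLapse n m s - 1) / s) s := by
  have h := hasDerivAt_isoRatio (m := m) hn hs
  have hq : 0 < m / (2 * s ^ (n - 2)) := by positivity
  have h1 := (h.const_add 1).rpow_const (p := 2 / ((n : ℝ) - 2)) (Or.inl (by positivity))
  refine h1.congr_deriv ?_
  have hk : (0 : ℝ) < (n : ℝ) - 2 := by
    have : (3 : ℝ) ≤ n := by exact_mod_cast hn
    linarith
  rw [Real.rpow_sub_one (by positivity)]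
  unfold isoLapse isoFactor
  generalize m / (2 * s ^ (n - 2)) = q at *
  have : 1 + q ≠ 0 := by positivity
  field_simp
  ring

theorem contDiffAt_isoLapse (hm : 0 < m) (hs : 0 < s) : ContDiffAt ℝ ∞ (isoLapse n m) s := by
  have h1 : ContDiffAt ℝ ∞ (fun s : ℝ => m / (2 * s ^ (n - 2))) s :=
    contDiffAt_const.div (contDiffAt_const.mul (contDiffAt_id.pow _))
      (ne_of_gt (show (0 : ℝ) < 2 * s ^ (n - 2) by positivity))
  exact (contDiffAt_const.sub h1).div (contDiffAt_const.add h1) (by positivity)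

theorem contDiffAt_isoFactor (hm : 0 < m) (hs : 0 < s) : ContDiffAt ℝ ∞ (isoFactor n m) s := by
  have h1 : ContDiffAt ℝ ∞ (fun s : ℝ => m / (2 * s ^ (n - 2))) s :=
    contDiffAt_const.div (contDiffAt_const.mul (contDiffAt_id.pow _))
      (ne_of_gt (show (0 : ℝ) < 2 * s ^ (n - 2) by positivity))
  exact (contDiffAt_const.add h1).rpow_const_of_ne (by positivity)

/-- With `q = m / (2 s^(n-2))` and area radius `r`, one has `2m / r^(n-2) = 4q / (1+q)²`, and `1 -
4q / (1+q)² = ((1-q)/(1+q))²`. -/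
theorem lapseSq_isoFactor_mul (hn : 3 ≤ n) (hm : 0 < m) (hs : 0 < s) :
    lapseSq n m (isoFactor n m s * s) = isoLapse n m s ^ 2 := by
  have hk : ((n : ℝ) - 2) = ((n - 2 : ℕ) : ℝ) := by
    rw [Nat.cast_sub (by omega)]; norm_num
  have hk0 : ((n - 2 : ℕ) : ℝ) ≠ 0 := by
    have : n - 2 ≠ 0 := by omega
    exact_mod_cast this
  have h1 : isoFactor n m s ^ (n - 2) = (1 + m / (2 * s ^ (n - 2))) ^ 2 := by
    unfold isoFactor
    rw [← Real.rpow_natCast, ← Real.rpow_mul (by positivity), hk, div_mul_cancel₀ _ hk0]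
    norm_num
  rw [lapseSq, mul_pow, h1, isoLapse]
  have : 0 < s ^ (n - 2) := by positivity
  field_simp
  ring

/-- The inverse is explicit: with `g = √f(r)`, the radius `s = r ((1+g)/2)^(2/(n-2))` satisfies `m /
(2 s^(n-2)) = (1-g)/(1+g)`. -/
theorem exists_isotropic_radius (hn : 3 ≤ n) (hm : 0 < m) {r : ℝ} (hr : horizonRadius n m < r) :
    ∃ s, 0 < s ∧ 0 < isoLapse n m s ∧ isoFactor n m s * s = r := by
  have hr0 := (horizonRadius_pos hm).trans hr
  have hf := lapseSq_pos hn hm hr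
  have hk : ((n : ℝ) - 2) = ((n - 2 : ℕ) : ℝ) := by
    rw [Nat.cast_sub (by omega)]; norm_num
  have hk0 : ((n - 2 : ℕ) : ℝ) ≠ 0 := by
    have : n - 2 ≠ 0 := by omega
    exact_mod_cast this
  set g := √(lapseSq n m r) with hg
  have hg0 : 0 < g := Real.sqrt_pos.2 hf
  have hg2 : g ^ 2 = 1 - 2 * m / r ^ (n - 2) := Real.sq_sqrt hf.le
  have hs : 0 < r * ((1 + g) / 2) ^ (2 / ((n : ℝ) - 2)) := by positivity
  have hpow : (r * ((1 + g) / 2) ^ (2 / ((n : ℝ) - 2))) ^ (n - 2)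
      = r ^ (n - 2) * ((1 + g) / 2) ^ 2 := by
    rw [mul_pow, ← Real.rpow_natCast (((1 + g) / 2) ^ _), ← Real.rpow_mul (by positivity), hk,
      div_mul_cancel₀ _ hk0]
    norm_num
  have hq : m / (2 * (r * ((1 + g) / 2) ^ (2 / ((n : ℝ) - 2))) ^ (n - 2)) = (1 - g) / (1 + g) := by
    rw [hpow]
    have hR : 0 < r ^ (n - 2) := by positivity
    have h3 : 2 * m = (1 - g ^ 2) * r ^ (n - 2) := by
      rw [hg2]; field_simp; ring
    field_simp
    linear_combination h3
  refine ⟨_, hs, ?_, ?_⟩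
  · rw [isoLapse, hq]
    have : (1 - (1 - g) / (1 + g)) / (1 + (1 - g) / (1 + g)) = g := by
      have h2 : 1 + (1 - g) / (1 + g) ≠ 0 := by
        have : 1 + (1 - g) / (1 + g) = 2 / (1 + g) := by field_simp; ring
        rw [this]; positivity
      have h3 : 1 + g ≠ 0 := by positivity
      rw [div_eq_iff h2]
      field_simp
      ring
    rwa [this]
  · rw [isoFactor, hq]
    have h2 : 1 + (1 - g) / (1 + g) = ((1 + g) / 2)⁻¹ := by field_simp; ring
    rw [h2, Real.inv_rpow (by positivity)]
    have : 0 < ((1 + g) / 2) ^ (2 / ((n : ℝ) - 2)) := by positivity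
    field_simp

end Isotropic

end SchwarzschildPhoton

namespace SchwarzschildPhoton

/-! ### The conformal lapse and the isotropic coordinate map. -/

section IsotropicMap

open Filter Set
open scoped RealInnerProductSpace

variable {n : ℕ} {m s : ℝ}

theorem HasDerivAt.comp_norm {φ : ℝ → ℝ} {φ' : ℝ} {y : EuclideanSpace ℝ (Fin n)}
    (h : HasDerivAt φ φ' ‖y‖) (hy : 0 < ‖y‖) :
    HasFDerivAt (fun z : EuclideanSpace ℝ (Fin n) => φ ‖z‖) ((φ' / ‖y‖) • innerSL ℝ y) y := by
  have h1 := (hasFDerivAt_id y).norm_sq.sqrt (by simpa using hy.ne')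
  have h3 : (fun q : EuclideanSpace ℝ (Fin n) => √(‖id q‖ ^ 2)) = fun q => ‖q‖ := by
    ext q; exact Real.sqrt_sq (norm_nonneg _)
  rw [h3] at h1
  refine (h.comp_hasFDerivAt y h1).congr_fderiv ?_
  ext v
  simp
  field_simp

/-- The static lapse as a function of the isotropic position. -/
noncomputable def isoConformalLapse (n : ℕ) (m : ℝ) (y : EuclideanSpace ℝ (Fin n)) : ℝ :=
  isoLapse n m ‖y‖ / isoFactor n m ‖y‖

/-- The radial logarithmic slope of the conformal lapse. -/
noncomputable def isoSlope (n : ℕ) (m s : ℝ) : ℝ :=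
  (1 - isoLapse n m s) * (((n : ℝ) - 2) * (1 + isoLapse n m s) + 2 * isoLapse n m s)
    / (2 * isoFactor n m s * s ^ 2)

/-- The derivative of `isoSlope`. -/
noncomputable def isoSlopeDeriv (n : ℕ) (m s : ℝ) : ℝ :=
  -((1 - isoLapse n m s ^ 2) * isoLapse n m s * n * ((n : ℝ) - 1)) / (2 * isoFactor n m s * s ^ 3)

theorem hasDerivAt_isoSlope (hn : 3 ≤ n) (hm : 0 < m) (hs : 0 < s) :
    HasDerivAt (isoSlope n m) (isoSlopeDeriv n m s) s := by
  have hg := hasDerivAt_isoLapse hn hm hs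
  have hχ := hasDerivAt_isoFactor hn hm hs
  have hχ0 := isoFactor_pos (n := n) hm hs
  have h := ((hg.const_sub 1).mul (((hg.const_add 1).const_mul ((n : ℝ) - 2)).add
    (hg.const_mul 2))).div ((hχ.const_mul 2).mul (hasDerivAt_pow 2 s))
    (by simp only [Pi.mul_apply]; positivity)
  refine h.congr_deriv ?_
  simp only [Pi.mul_apply, Pi.add_apply, isoSlopeDeriv]
  push_cast
  field_simp
  ring

theorem isoLapse_lt_one (hm : 0 < m) (hs : 0 < s) : isoLapse n m s < 1 := by
  have hq : 0 < m / (2 * s ^ (n - 2)) := by positivity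
  rw [isoLapse, div_lt_one (by positivity)]
  linarith

/-- This keeps the Hessian of the conformal lapse from being a multiple of the identity. It uses
positive mass, through lapse less than one; in flat space there are further photon surfaces. -/
theorem isoSlopeDeriv_ne_zero (hn : 3 ≤ n) (hm : 0 < m) (hs : 0 < s) (hg : 0 < isoLapse n m s) :
    isoSlopeDeriv n m s ≠ 0 := by
  have h1 := isoLapse_lt_one (n := n) hm hs
  have hχ0 := isoFactor_pos (n := n) hm hs
  have h3 : (3 : ℝ) ≤ n := by exact_mod_cast hn
  have h2 : 0 < 1 - isoLapse n m s ^ 2 := by nlinarith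
  have h4 : 0 < (n : ℝ) - 1 := by linarith
  rw [isoSlopeDeriv, neg_div, neg_ne_zero]
  positivity

/-- The gradient of the conformal lapse. -/
noncomputable def isoGrad (n : ℕ) (m : ℝ) (y : EuclideanSpace ℝ (Fin n)) :
    EuclideanSpace ℝ (Fin n) := isoSlope n m ‖y‖ • y

theorem hasFDerivAt_isoConformalLapse (hn : 3 ≤ n) (hm : 0 < m) {y : EuclideanSpace ℝ (Fin n)}
    (hy : 0 < ‖y‖) :
    HasFDerivAt (isoConformalLapse n m) (innerSL ℝ (isoGrad n m y)) y := by
  have hχ0 := isoFactor_pos (n := n) hm hy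
  have h := ((hasDerivAt_isoLapse hn hm hy).div (hasDerivAt_isoFactor hn hm hy)
    hχ0.ne').comp_norm hy
  have h' : HasFDerivAt (isoConformalLapse n m) _ y := h
  refine h'.congr_fderiv ?_
  ext v
  simp only [isoGrad, isoSlope, smul_apply, innerSL_apply_apply, real_inner_smul_left,
    smul_eq_mul]
  field_simp
  ring

theorem hasFDerivAt_isoGrad (hn : 3 ≤ n) (hm : 0 < m) {y : EuclideanSpace ℝ (Fin n)}
    (hy : 0 < ‖y‖) :
    HasFDerivAt (isoGrad n m) (isoSlope n m ‖y‖ • ContinuousLinearMap.id ℝ _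
      + ((isoSlopeDeriv n m ‖y‖ / ‖y‖) • innerSL ℝ y).smulRight y) y :=
  ((hasDerivAt_isoSlope hn hm hy).comp_norm hy).smul (hasFDerivAt_id y)

/-- The map from isotropic coordinates to area-radius coordinates. -/
noncomputable def isoMap (n : ℕ) (m : ℝ) (q : Coord n) : Coord n :=
  (q.1, isoFactor n m ‖q.2‖ • q.2)

/-- The differential of `isoMap`. -/
noncomputable def isoDiff (n : ℕ) (m : ℝ) (q u : Coord n) : Coord n :=
  (u.1, isoFactor n m ‖q.2‖ • u.2
    + (isoFactor n m ‖q.2‖ * (isoLapse n m ‖q.2‖ - 1) / ‖q.2‖ ^ 2 * ⟪q.2, u.2⟫) • q.2)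

theorem contDiffAt_isoMap (hm : 0 < m) {q : Coord n} (hq : 0 < ‖q.2‖) :
    ContDiffAt ℝ ∞ (isoMap n m) q := by
  have h1 : ContDiffAt ℝ ∞ (fun q : Coord n => ‖q.2‖) q :=
    contDiffAt_snd.norm ℝ (norm_pos_iff.1 hq)
  have h2 : ContDiffAt ℝ ∞ (fun q : Coord n => isoFactor n m ‖q.2‖) q :=
    ContDiffAt.comp (g := isoFactor n m) q (contDiffAt_isoFactor hm hq) h1
  exact contDiffAt_fst.prodMk (h2.smul contDiffAt_snd)

theorem fderiv_isoMap (hn : 3 ≤ n) (hm : 0 < m) {q : Coord n} (hq : 0 < ‖q.2‖) (u : Coord n) :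
    fderiv ℝ (isoMap n m) q u = isoDiff n m q u := by
  have h1 : HasFDerivAt (fun q : Coord n => q.2) (ContinuousLinearMap.snd ℝ ℝ
    (EuclideanSpace ℝ (Fin n))) q := hasFDerivAt_snd
  have h2 := (hasDerivAt_isoFactor (n := n) hn hm hq).comp_hasFDerivAt q (hasFDerivAt_radius hq)
  have h3 : HasFDerivAt (isoMap n m) _ q := hasFDerivAt_fst.prodMk (h2.smul h1)
  rw [h3.fderiv]
  ext1
  · simp [isoDiff]
  · simp only [isoDiff, ContinuousLinearMap.prod_apply, add_apply, smul_apply,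
      ContinuousLinearMap.smulRight_apply, ContinuousLinearMap.comp_apply,
      ContinuousLinearMap.coe_snd', innerSL_apply_apply, smul_eq_mul, Function.comp_apply]
    congr 2
    field_simp

theorem hasFDerivAt_isoMap (hm : 0 < m) {q : Coord n} (hq : 0 < ‖q.2‖) :
    HasFDerivAt (isoMap n m) (fderiv ℝ (isoMap n m) q) q :=
  ((contDiffAt_isoMap hm hq).differentiableAt (by simp)).hasFDerivAt

theorem norm_isoMap (hm : 0 < m) {q : Coord n} (hq : 0 < ‖q.2‖) :
    ‖(isoMap n m q).2‖ = isoFactor n m ‖q.2‖ * ‖q.2‖ := by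
  rw [isoMap, norm_smul, Real.norm_of_nonneg (isoFactor_pos hm hq).le]

theorem inner_isoMap_isoDiff {q : Coord n} (hq : 0 < ‖q.2‖) (u : Coord n) :
    ⟪(isoMap n m q).2, (isoDiff n m q u).2⟫ =
      isoFactor n m ‖q.2‖ ^ 2 * isoLapse n m ‖q.2‖ * ⟪q.2, u.2⟫ := by
  simp only [isoMap, isoDiff, real_inner_smul_left, inner_add_right, real_inner_smul_right,
    real_inner_self_eq_norm_sq]
  field_simp
  ring

theorem norm_sq_isoDiff {q : Coord n} (hq : 0 < ‖q.2‖) (u : Coord n) :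
    ‖(isoDiff n m q u).2‖ ^ 2 = isoFactor n m ‖q.2‖ ^ 2 *
      (‖u.2‖ ^ 2 + (isoLapse n m ‖q.2‖ ^ 2 - 1) * ⟪q.2, u.2⟫ ^ 2 / ‖q.2‖ ^ 2) := by
  rw [← real_inner_self_eq_norm_sq]
  simp only [isoDiff, real_inner_smul_left, inner_add_right, real_inner_smul_right, inner_add_left]
  simp only [real_inner_self_eq_norm_sq]
  rw [real_inner_comm q.2 u.2]
  field_simp
  ring

/-- Conformality of isotropic coordinates, whence null vectors correspond to null vectors of `-N²
dt² + |dy|²`. -/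
theorem metric_isoDiff (hn : 3 ≤ n) (hm : 0 < m) {q : Coord n} (hq : 0 < ‖q.2‖)
    (hg : 0 < isoLapse n m ‖q.2‖) (u : Coord n) :
    metric n m (isoMap n m q) (isoDiff n m q u) (isoDiff n m q u) =
      isoFactor n m ‖q.2‖ ^ 2 * (‖u.2‖ ^ 2 - isoConformalLapse n m q.2 ^ 2 * u.1 ^ 2) := by
  have hχ := isoFactor_pos (n := n) hm hq
  rw [metric_eq, inner_isoMap_isoDiff hq, real_inner_self_eq_norm_sq, norm_sq_isoDiff hq,
    radialCoeff, norm_isoMap hm hq, lapseSq_isoFactor_mul hn hm hq, isoConformalLapse]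
  simp only [isoDiff]
  field_simp
  ring

/-- The acceleration of the image of a straight line under `isoMap`. -/
noncomputable def isoAccel (n : ℕ) (m : ℝ) (q u : Coord n) : Coord n :=
  (0, (2 * (isoFactor n m ‖q.2‖ * (isoLapse n m ‖q.2‖ - 1) / ‖q.2‖ ^ 2 * ⟪q.2, u.2⟫)) • u.2
    + (isoFactor n m ‖q.2‖ * ((isoLapse n m ‖q.2‖ - 1) ^ 2 * ⟪q.2, u.2⟫ ^ 2 / ‖q.2‖ ^ 4
      + ((n : ℝ) - 2) * (1 - isoLapse n m ‖q.2‖ ^ 2) * ⟪q.2, u.2⟫ ^ 2 / (2 * ‖q.2‖ ^ 4)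
      + (isoLapse n m ‖q.2‖ - 1) * ‖u.2‖ ^ 2 / ‖q.2‖ ^ 2
      - 2 * (isoLapse n m ‖q.2‖ - 1) * ⟪q.2, u.2⟫ ^ 2 / ‖q.2‖ ^ 4)) • q.2)

theorem hasDerivAt_isoDiff_line (hn : 3 ≤ n) (hm : 0 < m) {q : Coord n} (hq : 0 < ‖q.2‖)
    (u : Coord n) :
    HasDerivAt (fun τ : ℝ => isoDiff n m (q + τ • u) u) (isoAccel n m q u) 0 := by
  have hl : HasDerivAt (fun τ : ℝ => q + τ • u) u 0 := by
    simpa using ((hasDerivAt_id (0 : ℝ)).smul_const u).const_add q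
  have hl2 := hl.coord_snd
  have hq0 : 0 < ‖(q + (0 : ℝ) • u).2‖ := by simpa using hq
  have hR := hl.radius hq0
  have hχ := (hasDerivAt_isoFactor (n := n) hn hm hq0).comp (0 : ℝ) hR
  have hg := (hasDerivAt_isoLapse (n := n) hn hm hq0).comp (0 : ℝ) hR
  have ha := hl2.inner ℝ (hasDerivAt_const (0 : ℝ) u.2)
  have hb := ((hχ.mul (hg.sub_const 1)).div (hR.pow 2)
    (by simpa using hq.ne')).mul ha
  have h := (hasDerivAt_const (0 : ℝ) u.1).prodMk ((hχ.smul_const u.2).add (hb.smul hl2))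
  refine HasDerivAt.congr_deriv (f := fun τ : ℝ => isoDiff n m (q + τ • u) u) h ?_
  have e : q + (0 : ℝ) • u = q := by simp
  simp only [isoAccel, Function.comp_apply, Pi.mul_apply, Pi.pow_apply, Pi.div_apply, e,
    inner_zero_right, zero_add, real_inner_self_eq_norm_sq, Nat.cast_ofNat]
  refine Prod.ext rfl ?_
  simp only
  rw [← add_assoc, ← add_smul]
  congr 2
  · field_simp
    ring
  · field_simp
    ring

/-- Up to reparametrization, `isoMap` maps the null geodesics of `-N² dt² + |dy|²` to
Schwarzschild null geodesics. -/
theorem isoAccel_eq (hn : 3 ≤ n) (hm : 0 < m) {q : Coord n} (hq : 0 < ‖q.2‖)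
    (hg : 0 < isoLapse n m ‖q.2‖) {w : EuclideanSpace ℝ (Fin n)}
    (hw : ‖w‖ = isoConformalLapse n m q.2) :
    isoAccel n m q (1, w) = geodesicSpray n m (isoMap n m q) (isoDiff n m q (1, w))
      + (2 * (isoLapse n m ‖q.2‖ - 1) * ⟪q.2, w⟫ / ‖q.2‖ ^ 2) • isoDiff n m q (1, w)
      + isoDiff n m q (2 / isoConformalLapse n m q.2 * ⟪isoGrad n m q.2, w⟫,
          isoConformalLapse n m q.2 • isoGrad n m q.2) := by
  have hχ := isoFactor_pos (n := n) hm hq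
  have hnull : metric n m (isoMap n m q) (isoDiff n m q (1, w)) (isoDiff n m q (1, w)) = 0 := by
    rw [metric_isoDiff hn hm hq hg]
    simp [hw]
  have hR : 0 < ‖(isoMap n m q).2‖ := by rw [norm_isoMap hm hq]; positivity
  have hf : lapseSq n m ‖(isoMap n m q).2‖ = isoLapse n m ‖q.2‖ ^ 2 := by
    rw [norm_isoMap hm hq, lapseSq_isoFactor_mul hn hm hq]
  have hf0 : lapseSq n m ‖(isoMap n m q).2‖ ≠ 0 := by rw [hf]; positivity
  rw [geodesicSpray, centralCoeff_of_null hR hf0 hnull, angularSq, lapseSqDeriv, hf,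
    inner_isoMap_isoDiff hq, norm_sq_isoDiff hq, norm_isoMap hm hq]
  simp only [isoAccel, isoDiff, isoGrad, isoMap, isoSlope, isoConformalLapse, hw,
    real_inner_smul_left, real_inner_smul_right, real_inner_self_eq_norm_sq]
  refine Prod.ext ?_ ?_
  · simp only [Prod.fst_add, Prod.smul_fst, smul_eq_mul]
    field_simp
    ring
  · simp only [Prod.snd_add, Prod.smul_snd]
    set A := isoLapse n m ‖q.2‖
    set B := isoFactor n m ‖q.2‖
    simp only [smul_add, smul_smul]
    rw [← sub_eq_zero]
    generalize ⟪q.2, w⟫ = a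
    generalize ‖q.2‖ = s at *
    match_scalars
    · field_simp
      ring
    · field_simp
      ring

end IsotropicMap

end SchwarzschildPhoton

namespace SchwarzschildPhoton

/-! ### The pointwise alternative: radial normal, or static and through the center. -/

section Alternative

open Filter Set
open scoped RealInnerProductSpace

variable {n : ℕ} {m : ℝ} {P U : Set (Coord n)} {F : Coord n → ℝ} {p q : Coord n}

theorem isoDiff_surjective (hm : 0 < m) (hq : 0 < ‖q.2‖) (hg : 0 < isoLapse n m ‖q.2‖)
    (v : Coord n) : ∃ u, isoDiff n m q u = v := by
  have hχ := isoFactor_pos (n := n) hm hq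
  refine ⟨(v.1, (isoFactor n m ‖q.2‖)⁻¹ • v.2 - ((isoLapse n m ‖q.2‖ - 1) / ‖q.2‖ ^ 2 *
    (⟪q.2, v.2⟫ / (isoFactor n m ‖q.2‖ * isoLapse n m ‖q.2‖))) • q.2), Prod.ext rfl ?_⟩
  simp only [isoDiff, inner_sub_right, real_inner_smul_right, real_inner_self_eq_norm_sq]
  generalize ⟪q.2, v.2⟫ = a
  match_scalars
  · field_simp
  · field_simp
    ring

theorem fderiv_comp_isoMap (hn : 3 ≤ n) (hm : 0 < m) (hq : 0 < ‖q.2‖)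
    (hF : DifferentiableAt ℝ F (isoMap n m q)) (u : Coord n) :
    fderiv ℝ (F ∘ isoMap n m) q u = fderiv ℝ F (isoMap n m q) (isoDiff n m q u) := by
  rw [fderiv_comp q hF (hasFDerivAt_isoMap hm hq).differentiableAt,
    ContinuousLinearMap.comp_apply, fderiv_isoMap hn hm hq]

/-- Both sides are the second derivative of `F ∘ isoMap` along the straight line `q + τu`. -/
theorem fderiv_fderiv_comp_isoMap (hn : 3 ≤ n) (hm : 0 < m) (hq : 0 < ‖q.2‖)
    (hF : ContDiffAt ℝ ∞ F (isoMap n m q)) (u : Coord n) :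
    fderiv ℝ (fderiv ℝ (F ∘ isoMap n m)) q u u =
      fderiv ℝ (fderiv ℝ F) (isoMap n m q) (isoDiff n m q u) (isoDiff n m q u)
        + fderiv ℝ F (isoMap n m q) (isoAccel n m q u) := by
  have hl : ∀ t : ℝ, HasDerivAt (fun τ : ℝ => q + τ • u) u t := fun t => by
    simpa using ((hasDerivAt_id t).smul_const u).const_add q
  have e : q + (0 : ℝ) • u = q := by simp
  have hct : Tendsto (fun τ : ℝ => q + τ • u) (𝓝 0) (𝓝 q) := by
    simpa using (hl 0).continuousAt.tendsto
  have hF2 : ContDiffAt ℝ ∞ (F ∘ isoMap n m) q := hF.comp q (contDiffAt_isoMap hm hq)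
  have h1 := (ContDiffAt.hasDerivAt_along (F := F ∘ isoMap n m) (c := fun τ : ℝ => q + τ • u)
    (c' := fun _ => u) (t := 0) (by rwa [e]) (Eventually.of_forall hl)
    (hasDerivAt_const (0 : ℝ) u)).2
  have hpos : ∀ᶠ q' in 𝓝 q, 0 < ‖q'.2‖ :=
    continuous_snd.norm.continuousAt.eventually (lt_mem_nhds hq)
  have h2 := (ContDiffAt.hasDerivAt_along (F := F) (c := fun τ : ℝ => isoMap n m (q + τ • u))
    (c' := fun τ => isoDiff n m (q + τ • u) u) (t := 0) (by rwa [e]) (by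
      filter_upwards [hct.eventually hpos] with t ht
      rw [← fderiv_isoMap hn hm ht]
      exact (hasFDerivAt_isoMap hm ht).comp_hasDerivAt t (hl t))
    (hasDerivAt_isoDiff_line hn hm hq u)).2
  have h3 : (fun τ : ℝ => fderiv ℝ (F ∘ isoMap n m) (q + τ • u) u) =ᶠ[𝓝 0]
      fun τ => fderiv ℝ F (isoMap n m (q + τ • u)) (isoDiff n m (q + τ • u) u) := by
    have hd := (contDiffAt_isoMap hm hq).continuousAt.eventually hF.eventually_differentiableAt
    filter_upwards [hct.eventually hpos, hct.eventually hd] with t ht1 ht2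
    exact fderiv_comp_isoMap hn hm ht1 ht2 u
  have h4 := h1.unique (h2.congr_of_eventuallyEq h3)
  simpa [e] using h4

/-- Timelikeness of a hyperplane becomes a bound on its conormal by Cauchy–Schwarz. The condition on
null vectors transfers because `isoAccel_eq` differs from the geodesic equation only by a tangential
reparametrization term and by terms with the gradient of `N`. -/
theorem IsPhotonSurface.isNullGeodesicAt (h : IsPhotonSurface n m P) (hn : 3 ≤ n) (hm : 0 < m)
    (hq : 0 < ‖q.2‖) (hg : 0 < isoLapse n m ‖q.2‖)
    (hF : IsLocalDefiningFunction P (isoMap n m q) U F) (hp : isoMap n m q ∈ P) :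
    IsNullGeodesicAt (isoConformalLapse n m) (isoGrad n m) (F ∘ isoMap n m) q := by
  have hχ := isoFactor_pos (n := n) hm hq
  have hN : 0 < isoConformalLapse n m q.2 := div_pos hg hχ
  have hD := fun u => fderiv_comp_isoMap hn hm hq (hF.contDiffAt.differentiableAt (by simp)) u
  refine ⟨hF.contDiffAt.comp q (contDiffAt_isoMap hm hq), hN, ?_, ?_⟩
  · obtain ⟨v, hv, hneg⟩ := h.timelike _ hp
    rw [hF.mem_tangentVectors_iff hp] at hv
    obtain ⟨u, rfl⟩ := isoDiff_surjective hm hq hg v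
    rw [metric_isoDiff hn hm hq hg] at hneg
    have hu : ‖u.2‖ ^ 2 < isoConformalLapse n m q.2 ^ 2 * u.1 ^ 2 := by
      by_contra hcon
      have : 0 ≤ isoFactor n m ‖q.2‖ ^ 2 *
        (‖u.2‖ ^ 2 - isoConformalLapse n m q.2 ^ 2 * u.1 ^ 2) :=
        mul_nonneg (by positivity) (by linarith)
      linarith
    have hu1 : u.1 ≠ 0 := by
      intro h0
      rw [h0] at hu
      nlinarith [sq_nonneg ‖u.2‖]
    rw [← hD] at hv
    set ℓ := fderiv ℝ (F ∘ isoMap n m) q with hℓ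
    have hsplit : ∀ z : Coord n, ℓ z = z.1 * ℓ (1, 0) + ⟪spatialGrad n ℓ, z.2⟫ := by
      intro z
      have hz : z = z.1 • ((1, 0) : Coord n) + (0, z.2) := by ext1 <;> simp
      conv_lhs => rw [hz, map_add, map_smul]
      rw [inner_spatialGrad, smul_eq_mul]
    rw [hsplit] at hv
    have hgrad : spatialGrad n ℓ ≠ 0 := by
      intro h0
      rw [h0, inner_zero_left, add_zero, mul_eq_zero, or_iff_right hu1] at hv
      refine hF.regular _ hF.mem (ContinuousLinearMap.ext fun z => ?_)
      obtain ⟨z', rfl⟩ := isoDiff_surjective hm hq hg z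
      rw [← hD, hsplit, hv, h0]
      simp
    have hgp : 0 < ‖spatialGrad n ℓ‖ := norm_pos_iff.2 hgrad
    have hcs := abs_le.1 (abs_real_inner_le_norm (spatialGrad n ℓ) u.2)
    have h1 : (u.1 * ℓ (1, 0)) ^ 2 ≤ (‖spatialGrad n ℓ‖ * ‖u.2‖) ^ 2 := by
      rw [show u.1 * ℓ (1, 0) = -⟪spatialGrad n ℓ, u.2⟫ by linarith, neg_sq]
      exact sq_le_sq' hcs.1 hcs.2
    have h2 : u.1 ^ 2 * ℓ (1, 0) ^ 2 <
        u.1 ^ 2 * (isoConformalLapse n m q.2 ^ 2 * ‖spatialGrad n ℓ‖ ^ 2) := by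
      nlinarith [mul_lt_mul_of_pos_left hu (pow_pos hgp 2)]
    exact lt_of_mul_lt_mul_left h2 (sq_nonneg _)
  · intro w hw hFw
    have hnull : metric n m (isoMap n m q) (isoDiff n m q (1, w)) (isoDiff n m q (1, w)) = 0 := by
      rw [metric_isoDiff hn hm hq hg]
      simp [hw]
    rw [hD] at hFw
    have h1 := h.hessian_null hn hm hF hp hFw hnull
    rw [fderiv_fderiv_comp_isoMap hn hm hq hF.contDiffAt, isoAccel_eq hn hm hq hg hw, map_add,
      map_add, map_smul, hFw, ← hD]
    have h2 : ((2 / isoConformalLapse n m q.2 * ⟪isoGrad n m q.2, w⟫,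
        isoConformalLapse n m q.2 • isoGrad n m q.2) : Coord n) =
        (2 / isoConformalLapse n m q.2 * ⟪isoGrad n m q.2, w⟫) • ((1, 0) : Coord n)
        + isoConformalLapse n m q.2 • (0, isoGrad n m q.2) := by
      ext1 <;> simp
    rw [h2, map_add, map_smul, map_smul]
    simp only [smul_eq_mul]
    linear_combination h1

/-- The Hessian of the conformal lapse. -/
noncomputable def isoHess (n : ℕ) (m : ℝ) (y : EuclideanSpace ℝ (Fin n)) :
    EuclideanSpace ℝ (Fin n) →L[ℝ] EuclideanSpace ℝ (Fin n) :=
  isoSlope n m ‖y‖ • ContinuousLinearMap.id ℝ _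
    + ((isoSlopeDeriv n m ‖y‖ / ‖y‖) • innerSL ℝ y).smulRight y

theorem inner_isoHess (y w z : EuclideanSpace ℝ (Fin n)) :
    ⟪isoHess n m y w, z⟫ =
      isoSlope n m ‖y‖ * ⟪w, z⟫ + isoSlopeDeriv n m ‖y‖ / ‖y‖ * ⟪y, w⟫ * ⟪y, z⟫ := by
  simp [isoHess, inner_add_left, real_inner_smul_left]

theorem exists_ne_zero_orthogonal (hn : 3 ≤ n) (a b : EuclideanSpace ℝ (Fin n)) :
    ∃ z : EuclideanSpace ℝ (Fin n), z ≠ 0 ∧ ⟪a, z⟫ = 0 ∧ ⟪b, z⟫ = 0 := by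
  let f : EuclideanSpace ℝ (Fin n) →ₗ[ℝ] ℝ × ℝ :=
    ((innerSL ℝ a).prod (innerSL ℝ b)).toLinearMap
  have hker : LinearMap.ker f ≠ ⊥ := by
    apply LinearMap.ker_ne_bot_of_finrank_lt
    simp
    omega
  obtain ⟨z, hz, hz0⟩ := Submodule.exists_mem_ne_zero_of_ne_bot hker
  have hz' : (⟪a, z⟫, ⟪b, z⟫) = ((0, 0) : ℝ × ℝ) := hz
  exact ⟨z, hz0, congrArg Prod.fst hz', congrArg Prod.snd hz'⟩

/-- The vector `y` is the projection of the position to the slice; were it zero, the normal would be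
radial and `w` tangent. -/
theorem exists_tangential_part (hgr : spatialGrad n (fderiv ℝ F q) ≠ 0) (hq : 0 < ‖q.2‖)
    {w : EuclideanSpace ℝ (Fin n)} (hw : ⟪q.2, w⟫ = 0) (hFw : fderiv ℝ F q (0, w) ≠ 0) :
    ∃ y, y ≠ 0 ∧ ⟪sliceNormal F q, y⟫ = 0 ∧
      ∀ z, ⟪sliceNormal F q, z⟫ = 0 → ⟪q.2, z⟫ = ⟪y, z⟫ := by
  have hνν : ⟪sliceNormal F q, sliceNormal F q⟫ = 1 := by
    rw [real_inner_self_eq_norm_sq, norm_sliceNormal hgr, one_pow]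
  refine ⟨q.2 - ⟪sliceNormal F q, q.2⟫ • sliceNormal F q, ?_, ?_, ?_⟩
  · intro hy
    rw [sub_eq_zero] at hy
    have h1 : ⟪sliceNormal F q, q.2⟫ ≠ 0 := by
      intro h2
      rw [h2, zero_smul] at hy
      rw [hy, norm_zero] at hq
      exact lt_irrefl _ hq
    rw [hy, real_inner_smul_left, mul_eq_zero, or_iff_right h1] at hw
    refine hFw ?_
    rw [fderiv_apply_eq hgr]
    simp [hw]
  · rw [inner_sub_right, real_inner_smul_right, hνν]; ring
  · intro z hz
    rw [inner_sub_left, real_inner_smul_left, hz, mul_zero, sub_zero]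

theorem eventually_hasFDerivAt_isoConformalLapse (hn : 3 ≤ n) (hm : 0 < m) (hq : 0 < ‖q.2‖) :
    ∀ᶠ y in 𝓝 q.2, HasFDerivAt (isoConformalLapse n m) (innerSL ℝ (isoGrad n m y)) y := by
  filter_upwards [continuous_norm.continuousAt.eventually (lt_mem_nhds hq)] with y hy
  exact hasFDerivAt_isoConformalLapse hn hm hy

/-- Let `y` be the tangential part of the position and `z` a tangent vector orthogonal to `y`,
scaled to the length of `y`. Then `y + z` and `y - z` are orthogonal, but both have inner product
`‖y‖²` with the position, so the Hessian of `N` does not vanish on them and the Codazzi condition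
forces zero speed. -/
theorem sliceSpeed_eq_zero_of_not_radial (hn : 3 ≤ n) (hm : 0 < m) (hq : 0 < ‖q.2‖)
    (hg : 0 < isoLapse n m ‖q.2‖) (h0 : F q = 0)
    (h : ∀ᶠ x in 𝓝 q, F x = 0 → IsNullGeodesicAt (isoConformalLapse n m) (isoGrad n m) F x)
    {w : EuclideanSpace ℝ (Fin n)} (hw : ⟪q.2, w⟫ = 0) (hFw : fderiv ℝ F q (0, w) ≠ 0) :
    sliceSpeed F q = 0 := by
  obtain ⟨y, hy0, hy1, hy⟩ :=
    exists_tangential_part (h.self_of_nhds h0).grad_ne_zero hq hw hFw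
  obtain ⟨z, hz0, hz1, hz2⟩ := exists_ne_zero_orthogonal hn (sliceNormal F q) y
  have hyp := norm_pos_iff.2 hy0
  have hzp := norm_pos_iff.2 hz0
  set c := ‖y‖ / ‖z‖ with hc
  have hcz : c ^ 2 * ‖z‖ ^ 2 = ‖y‖ ^ 2 := by
    rw [hc]; field_simp
  have e3 : ⟪y + c • z, y - c • z⟫ = 0 := by
    simp only [inner_add_left, inner_sub_right, real_inner_smul_left, real_inner_smul_right,
      real_inner_comm y z, hz2]
    simp only [real_inner_self_eq_norm_sq]
    linear_combination -hcz
  have hcond := (hessian_conditions hn h0 h (eventually_hasFDerivAt_isoConformalLapse hn hm hq)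
    (H := isoHess n m q.2) (hasFDerivAt_isoGrad hn hm hq)).1 (y + c • z) (y - c • z)
    (by rw [inner_add_right, real_inner_smul_right, hy1, hz1]; ring)
    (by rw [inner_sub_right, real_inner_smul_right, hy1, hz1]; ring) e3
  have e1 : ⟪q.2, y + c • z⟫ = ‖y‖ ^ 2 := by
    rw [inner_add_right, real_inner_smul_right, hy y hy1, hy z hz1, hz2,
      real_inner_self_eq_norm_sq]
    ring
  have e2 : ⟪q.2, y - c • z⟫ = ‖y‖ ^ 2 := by
    rw [inner_sub_right, real_inner_smul_right, hy y hy1, hy z hz1, hz2,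
      real_inner_self_eq_norm_sq]
    ring
  rw [inner_isoHess, e1, e2, e3, mul_zero, zero_add] at hcond
  have hne : isoSlopeDeriv n m ‖q.2‖ / ‖q.2‖ * ‖y‖ ^ 2 * ‖y‖ ^ 2 ≠ 0 := by
    have := isoSlopeDeriv_ne_zero hn hm hq hg
    positivity
  exact (mul_eq_zero.1 hcond).resolve_right hne

/-- For the static radial metric, a null geodesic hypersurface either has radial spatial normal, or
is static with spatial normal orthogonal to the radial direction. -/
theorem radial_or_static (hn : 3 ≤ n) (hm : 0 < m) (hq : 0 < ‖q.2‖)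
    (hg : 0 < isoLapse n m ‖q.2‖) (h0 : F q = 0)
    (h : ∀ᶠ x in 𝓝 q, F x = 0 → IsNullGeodesicAt (isoConformalLapse n m) (isoGrad n m) F x) :
    (∀ w, ⟪q.2, w⟫ = 0 → fderiv ℝ F q (0, w) = 0) ∨
      (fderiv ℝ F q (1, 0) = 0 ∧ fderiv ℝ F q (0, q.2) = 0) := by
  by_cases hrad : ∀ w, ⟪q.2, w⟫ = 0 → fderiv ℝ F q (0, w) = 0
  · exact Or.inl hrad
  refine Or.inr ?_
  push Not at hrad
  obtain ⟨w, hw, hFw⟩ := hrad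
  have hq' := h.self_of_nhds h0
  -- Having a non-radial normal is an open condition, seen by projecting `w` to the orthogonal
  -- complement of the moving position. Hence the speed vanishes on a whole neighbourhood in the
  -- surface.
  have hcont : ContinuousAt
      (fun x : Coord n => fderiv ℝ F x (0, w - (⟪x.2, w⟫ / ‖x.2‖ ^ 2) • x.2)) q := by
    have h1 : ContinuousAt (fun x : Coord n => ⟪x.2, w⟫ / ‖x.2‖ ^ 2) q :=
      (continuous_snd.inner continuous_const).continuousAt.div
        (continuous_snd.norm.pow 2).continuousAt (by positivity)
    exact hq'.smooth.hasFDerivAt_fderiv.continuousAt.clm_apply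
      (continuousAt_const.prodMk (continuousAt_const.sub (h1.smul continuousAt_snd)))
  have hst : ∀ᶠ x in 𝓝 q, F x = 0 → sliceSpeed F x = 0 := by
    have hpos : ∀ᶠ x : Coord n in 𝓝 q, 0 < ‖x.2‖ :=
      continuous_snd.norm.continuousAt.eventually (lt_mem_nhds hq)
    have hlapse : ∀ᶠ x : Coord n in 𝓝 q, 0 < isoLapse n m ‖x.2‖ := by
      have h1 : ContinuousAt (fun x : Coord n => isoLapse n m ‖x.2‖) q :=
        ContinuousAt.comp (g := isoLapse n m) (contDiffAt_isoLapse hm hq).continuousAt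
          continuous_snd.norm.continuousAt
      exact h1.eventually (lt_mem_nhds hg)
    filter_upwards [h.eventually_nhds, hpos, hlapse,
      hcont.eventually_ne (show _ ≠ (0 : ℝ) by simpa [hw] using hFw)] with x h1 h2 h3 h4 h5
    refine sliceSpeed_eq_zero_of_not_radial hn hm h2 h3 h5 h1 ?_ h4
    rw [inner_sub_right, real_inner_smul_right, real_inner_self_eq_norm_sq]
    field_simp
    ring
  obtain ⟨y, hy0, hy1, hy⟩ := exists_tangential_part hq'.grad_ne_zero hq hw hFw
  -- For the tangential part `y` of the position, `⟪Hy, ν⟫` is a nonzero multiple of `⟪q.2, ν⟫`.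
  have hcond := (hessian_conditions hn h0 h (eventually_hasFDerivAt_isoConformalLapse hn hm hq)
    (H := isoHess n m q.2) (hasFDerivAt_isoGrad hn hm hq)).2 hst y hy1
  rw [inner_isoHess, real_inner_comm, hy1, mul_zero, zero_add, hy y hy1,
    real_inner_self_eq_norm_sq] at hcond
  have hne : isoSlopeDeriv n m ‖q.2‖ / ‖q.2‖ * ‖y‖ ^ 2 ≠ 0 := by
    have := isoSlopeDeriv_ne_zero hn hm hq hg
    have := norm_pos_iff.2 hy0
    positivity
  have hν := (mul_eq_zero.1 hcond).resolve_left hne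
  have hs := hst.self_of_nhds h0
  constructor
  · rw [hq'.fderiv_time, hs, mul_zero, neg_zero]
  · rw [fderiv_apply_eq hq'.grad_ne_zero, real_inner_comm, hν]
    simp

/-- The normal covector of a photon surface is either a combination of `dt` and `dr`, or it
annihilates the time direction and the radial direction. -/
theorem IsPhotonSurface.radial_or_static (h : IsPhotonSurface n m P) (hn : 3 ≤ n) (hm : 0 < m)
    (hF : IsLocalDefiningFunction P p U F) (hp : p ∈ P) :
    (∀ w, ⟪p.2, w⟫ = 0 → fderiv ℝ F p (0, w) = 0) ∨
      (fderiv ℝ F p (1, 0) = 0 ∧ fderiv ℝ F p (0, p.2) = 0) := by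
  have hr := h.subset hp
  have hr0 := norm_pos_of_mem hm hr
  obtain ⟨s, hs, hg, hsr⟩ := exists_isotropic_radius hn hm hr
  have hχ := isoFactor_pos (n := n) hm hs
  obtain ⟨q, hqs, rfl⟩ : ∃ q : Coord n, ‖q.2‖ = s ∧ isoMap n m q = p := by
    have hns : ‖(s / ‖p.2‖) • p.2‖ = s := by
      rw [norm_smul, Real.norm_of_nonneg (by positivity)]
      field_simp
    refine ⟨(p.1, (s / ‖p.2‖) • p.2), hns, Prod.ext rfl ?_⟩
    simp only [isoMap, hns, smul_smul]
    rw [mul_div_assoc', hsr, div_self hr0.ne', one_smul]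
  subst hqs
  have hpos : ∀ᶠ x : Coord n in 𝓝 q, 0 < ‖x.2‖ :=
    continuous_snd.norm.continuousAt.eventually (lt_mem_nhds hs)
  have hlapse : ∀ᶠ x : Coord n in 𝓝 q, 0 < isoLapse n m ‖x.2‖ := by
    have h1 : ContinuousAt (fun x : Coord n => isoLapse n m ‖x.2‖) q :=
      ContinuousAt.comp (g := isoLapse n m) (contDiffAt_isoLapse hm hs).continuousAt
        continuous_snd.norm.continuousAt
    exact h1.eventually (lt_mem_nhds hg)
  have hD := fun u => fderiv_comp_isoMap hn hm hs (hF.contDiffAt.differentiableAt (by simp)) u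
  have hall : ∀ᶠ x in 𝓝 q, (F ∘ isoMap n m) x = 0 →
      IsNullGeodesicAt (isoConformalLapse n m) (isoGrad n m) (F ∘ isoMap n m) x := by
    filter_upwards [hpos, hlapse, (contDiffAt_isoMap hm hs).continuousAt.eventually hF.mem_nhds]
      with x h1 h2 h3 h4
    exact h.isNullGeodesicAt hn hm h1 h2 (hF.at_mem h3) ((hF.zero_iff _ h3).2 h4)
  rcases SchwarzschildPhoton.radial_or_static hn hm hs hg (F := F ∘ isoMap n m) (hF.eq_zero hp) hall with h1 | ⟨h1, h2⟩
  · refine Or.inl fun w hw => ?_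
    have hw' : ⟪q.2, w⟫ = 0 := by
      rw [isoMap, real_inner_smul_left, mul_eq_zero, or_iff_right hχ.ne'] at hw
      exact hw
    have h3 := h1 ((isoFactor n m ‖q.2‖)⁻¹ • w) (by rw [real_inner_smul_right, hw', mul_zero])
    rw [hD] at h3
    have h4 : isoDiff n m q (0, (isoFactor n m ‖q.2‖)⁻¹ • w) = (0, w) := by
      refine Prod.ext rfl ?_
      simp [isoDiff, real_inner_smul_right, hw', smul_smul, hχ.ne']
    rwa [h4] at h3
  · refine Or.inr ⟨?_, ?_⟩
    · rw [hD] at h1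
      have h4 : isoDiff n m q (1, 0) = (1, 0) := by simp [isoDiff]
      rwa [h4] at h1
    · rw [hD] at h2
      have h4 : isoDiff n m q (0, q.2) = isoLapse n m ‖q.2‖ • (0, (isoMap n m q).2) := by
        refine Prod.ext (by simp [isoDiff]) ?_
        simp only [isoDiff, isoMap, Prod.smul_snd, real_inner_self_eq_norm_sq]
        match_scalars
        field_simp
        ring
      rw [h4, map_smul, smul_eq_mul, mul_eq_zero, or_iff_right hg.ne'] at h2
      exact h2

end Alternative

end SchwarzschildPhoton

namespace SchwarzschildPhoton

/-! ### The global alternative and the static case. -/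

section Static

open Filter Set
open scoped RealInnerProductSpace

variable {n : ℕ} {m : ℝ} {P U : Set (Coord n)} {F : Coord n → ℝ} {p q : Coord n}

theorem IsLocalDefiningFunction.continuousAt_fderiv_apply (hF : IsLocalDefiningFunction P p U F)
    {X : Coord n → Coord n} (hX : ContinuousAt X p) :
    ContinuousAt (fun q => fderiv ℝ F q (X q)) p :=
  hF.contDiffAt.hasFDerivAt_fderiv.continuousAt.clm_apply hX

/-- A covector annihilating `∂_t`, the radial vector and its orthogonal complement vanishes. -/
theorem IsLocalDefiningFunction.not_radial_and_static (hF : IsLocalDefiningFunction P p U F)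
    (hr : 0 < ‖p.2‖) (h1 : ∀ w, ⟪p.2, w⟫ = 0 → fderiv ℝ F p (0, w) = 0)
    (h2 : fderiv ℝ F p (1, 0) = 0) (h3 : fderiv ℝ F p (0, p.2) = 0) : False := by
  refine hF.regular p hF.mem (ContinuousLinearMap.ext fun v => ?_)
  have hv : v = v.1 • ((1, 0) : Coord n) + (⟪p.2, v.2⟫ / ‖p.2‖ ^ 2) • (0, p.2)
      + (0, v.2 - (⟪p.2, v.2⟫ / ‖p.2‖ ^ 2) • p.2) := by
    ext1 <;> simp
  rw [hv, map_add, map_add, map_smul, map_smul, h2, h3, h1 _ (by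
    rw [inner_sub_right, real_inner_smul_right, real_inner_self_eq_norm_sq]
    field_simp
    ring)]
  simp

/-- A connected photon surface either has radial spatial normals, or is static with spatial normals
orthogonal to the radial direction. -/
theorem IsPhotonSurface.forall_radial_or_forall_static (h : IsPhotonSurface n m P) (hn : 3 ≤ n)
    (hm : 0 < m) (hP : IsPreconnected P) :
    (∀ p ∈ P, ∀ w, ⟪p.2, w⟫ = 0 → (0, w) ∈ tangentVectors P p) ∨
      (∀ p ∈ P, (1, 0) ∈ tangentVectors P p ∧ (0, p.2) ∈ tangentVectors P p) := by
  -- Non-tangency of a continuous field is open, so the failure of either alternative is open. As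
  -- exactly one alternative holds at each point, both are open as well.
  have hopen : ∀ p ∈ P, ∀ X : Coord n → Coord n, ContinuousAt X p → X p ∉ tangentVectors P p →
      ∀ᶠ q in 𝓝 p, q ∈ P → X q ∉ tangentVectors P q := by
    intro p hp X hX hXp
    obtain ⟨U, F, hF⟩ := h.embedded p hp
    rw [hF.mem_tangentVectors_iff hp] at hXp
    filter_upwards [(hF.continuousAt_fderiv_apply hX).eventually_ne hXp, hF.mem_nhds]
      with q h1 h2 h3
    rwa [(hF.at_mem h2).mem_tangentVectors_iff h3]
  have halt : ∀ p ∈ P, (∀ w, ⟪p.2, w⟫ = 0 → (0, w) ∈ tangentVectors P p) ∨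
      ((1, 0) ∈ tangentVectors P p ∧ (0, p.2) ∈ tangentVectors P p) := by
    intro p hp
    obtain ⟨U, F, hF⟩ := h.embedded p hp
    simp only [hF.mem_tangentVectors_iff hp]
    exact h.radial_or_static hn hm hF hp
  have hexcl : ∀ p ∈ P, (∀ w, ⟪p.2, w⟫ = 0 → (0, w) ∈ tangentVectors P p) →
      ¬ ((1, 0) ∈ tangentVectors P p ∧ (0, p.2) ∈ tangentVectors P p) := by
    intro p hp h1 h2
    obtain ⟨U, F, hF⟩ := h.embedded p hp
    simp only [hF.mem_tangentVectors_iff hp] at h1 h2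
    exact hF.not_radial_and_static (norm_pos_of_mem hm (h.subset hp)) h1 h2.1 h2.2
  by_cases hex : ∃ p ∈ P, ∀ w, ⟪p.2, w⟫ = 0 → (0, w) ∈ tangentVectors P p
  · obtain ⟨p, hp, hA⟩ := hex
    refine Or.inl (hP.forall_of_eventually
      (A := fun p => ∀ w, ⟪p.2, w⟫ = 0 → (0, w) ∈ tangentVectors P p) ?_ ?_ hp hA)
    · intro p hp hA
      have := hexcl p hp hA
      rw [not_and_or] at this
      rcases this with h1 | h1
      · filter_upwards [hopen p hp (fun _ => (1, 0)) continuousAt_const h1] with q hq hqP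
        exact (halt q hqP).resolve_right fun h2 => hq hqP h2.1
      · filter_upwards [hopen p hp (fun q => (0, q.2)) (by fun_prop) h1] with q hq hqP
        exact (halt q hqP).resolve_right fun h2 => hq hqP h2.2
    · intro p hp hA
      push Not at hA
      obtain ⟨w, hw, hwP⟩ := hA
      have hr := norm_pos_of_mem hm (h.subset hp)
      have hX : ContinuousAt
          (fun x : Coord n => ((0, w - (⟪x.2, w⟫ / ‖x.2‖ ^ 2) • x.2) : Coord n)) p := by
        have h1 : ContinuousAt (fun x : Coord n => ⟪x.2, w⟫ / ‖x.2‖ ^ 2) p :=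
          (continuous_snd.inner continuous_const).continuousAt.div
            (continuous_snd.norm.pow 2).continuousAt (by positivity)
        exact continuousAt_const.prodMk (continuousAt_const.sub (h1.smul continuousAt_snd))
      filter_upwards [hopen p hp _ hX (by simpa [hw] using hwP)] with q hq hqP hcon
      have hr := norm_pos_of_mem hm (h.subset hqP)
      refine hq hqP (hcon _ ?_)
      rw [inner_sub_right, real_inner_smul_right, real_inner_self_eq_norm_sq]
      field_simp
      ring
  · push Not at hex
    refine Or.inr fun p hp => (halt p hp).resolve_left fun h1 => ?_
    obtain ⟨w, hw, hwP⟩ := hex p hp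
    exact hwP (h1 w hw)

/-- The second fundamental form of a static photon surface through the center vanishes. -/
theorem IsPhotonSurface.hessian_eq_zero_of_static (h : IsPhotonSurface n m P) (hn : 3 ≤ n)
    (hm : 0 < m) (hF : IsLocalDefiningFunction P p U F) (hp : p ∈ P)
    (hst : ∀ q ∈ P, (1, 0) ∈ tangentVectors P q ∧ (0, q.2) ∈ tangentVectors P q)
    {X Y : Coord n} (hX : fderiv ℝ F p X = 0) (hY : fderiv ℝ F p Y = 0) :
    fderiv ℝ (fderiv ℝ F) p X Y = 0 := by
  have hr := norm_pos_of_mem hm (h.subset hp)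
  have hf := lapseSq_pos hn hm (h.subset hp)
  have hD := hF.contDiffAt.hasFDerivAt_fderiv
  have hst' : ∀ᶠ q in 𝓝 p, F q = 0 → fderiv ℝ F q (1, 0) = 0 ∧ fderiv ℝ F q (0, q.2) = 0 := by
    filter_upwards [hF.mem_nhds] with q hq hFq
    have hqP := (hF.zero_iff q hq).2 hFq
    simpa only [(hF.at_mem hq).mem_tangentVectors_iff hqP] using hst q hqP
  have hst0 := hst'.self_of_nhds (hF.eq_zero hp)
  -- The identities `dF(∂_t) = 0` and, below, `dF(0, x) = 0` hold along `P` and are differentiated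
  -- in the tangent direction `Z`.
  have ht : ∀ Z, fderiv ℝ F p Z = 0 → fderiv ℝ (fderiv ℝ F) p Z (1, 0) = 0 := by
    intro Z hZ
    have h1 := hD.clm_apply (hasFDerivAt_const ((1, 0) : Coord n) p)
    have h2 := fderiv_eq_zero_of_vanishing hF.contDiffAt (hF.eq_zero hp) (hF.regular p hF.mem)
      h1.differentiableAt (hst'.mono fun q hq h0 => (hq h0).1) hZ
    rw [h1.fderiv] at h2
    simpa using h2
  have hx : ∀ Z, fderiv ℝ F p Z = 0 → fderiv ℝ (fderiv ℝ F) p Z (0, p.2) = 0 := by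
    intro Z hZ
    have hsnd : HasFDerivAt (fun q : Coord n => q.2)
      (ContinuousLinearMap.snd ℝ ℝ (EuclideanSpace ℝ (Fin n))) p := hasFDerivAt_snd
    have h0 : HasFDerivAt (fun q : Coord n => ((0, q.2) : Coord n)) _ p :=
      (hasFDerivAt_const (0 : ℝ) p).prodMk hsnd
    have h1 := hD.clm_apply h0
    have h2 := fderiv_eq_zero_of_vanishing hF.contDiffAt (hF.eq_zero hp) (hF.regular p hF.mem)
      h1.differentiableAt (hst'.mono fun q hq h0 => (hq h0).2) hZ
    rw [h1.fderiv] at h2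
    have h3 : fderiv ℝ F p (0, Z.2) = 0 := by
      have hz : Z = Z.1 • ((1, 0) : Coord n) + (0, Z.2) := by ext1 <;> simp
      rw [hz, map_add, map_smul, hst0.1, smul_zero, zero_add] at hZ
      exact hZ
    simpa [h3] using h2
  have hsymm : ∀ v w, fderiv ℝ (fderiv ℝ F) p v w = fderiv ℝ (fderiv ℝ F) p w v :=
    fun v w => (hF.contDiffAt.isSymmSndFDerivAt_of_infty).eq v w
  -- Adding the multiple `‖w‖/√f` of `∂_t` makes `(0, w)` null. The geodesic acceleration lies in
  -- the tangent span of `∂_t` and the position, so `hessian_null` reduces to the Hessian.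
  have hw : ∀ w, ⟪p.2, w⟫ = 0 → fderiv ℝ F p (0, w) = 0 →
      fderiv ℝ (fderiv ℝ F) p (0, w) (0, w) = 0 := by
    intro w hw0 hw
    have hv : (((‖w‖ / √(lapseSq n m ‖p.2‖)), w) : Coord n)
        = (‖w‖ / √(lapseSq n m ‖p.2‖)) • ((1, 0) : Coord n) + (0, w) := by ext1 <;> simp
    have hvF : fderiv ℝ F p ((‖w‖ / √(lapseSq n m ‖p.2‖)), w) = 0 := by
      rw [hv, map_add, map_smul, hst0.1, hw]; simp
    have h1 := h.hessian_null hn hm hF hp hvF (by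
      rw [metric_eq]
      simp only [real_inner_self_eq_norm_sq, hw0]
      have hs := Real.sq_sqrt hf.le
      have hs0 := Real.sqrt_pos.2 hf
      field_simp
      rw [hs]
      ring)
    have h2 : fderiv ℝ F p (geodesicSpray n m p ((‖w‖ / √(lapseSq n m ‖p.2‖)), w)) = 0 := by
      have : geodesicSpray n m p ((‖w‖ / √(lapseSq n m ‖p.2‖)), w) =
          (geodesicSpray n m p ((‖w‖ / √(lapseSq n m ‖p.2‖)), w)).1 • ((1, 0) : Coord n)
          + (-centralCoeff n m p ((‖w‖ / √(lapseSq n m ‖p.2‖)), w)) • (0, p.2) := by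
        ext1 <;> simp [geodesicSpray]
      rw [this, map_add, map_smul, map_smul, hst0.1, hst0.2]
      simp
    rw [h2, add_zero, hv] at h1
    simp only [map_add, map_smul, add_apply, smul_apply] at h1
    rw [hsymm (1, 0) (0, w), ht (0, w) hw, ht (1, 0) hst0.1] at h1
    simpa using h1
  have hdiag : ∀ Z, fderiv ℝ F p Z = 0 → fderiv ℝ (fderiv ℝ F) p Z Z = 0 := by
    intro Z hZ
    set b := ⟪p.2, Z.2⟫ / ‖p.2‖ ^ 2 with hb
    have hz : Z = Z.1 • ((1, 0) : Coord n) + b • (0, p.2) + (0, Z.2 - b • p.2) := by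
      ext1 <;> simp
    have hw1 : ⟪p.2, Z.2 - b • p.2⟫ = 0 := by
      rw [inner_sub_right, real_inner_smul_right, real_inner_self_eq_norm_sq, hb]
      field_simp
      ring
    have hw2 : fderiv ℝ F p (0, Z.2 - b • p.2) = 0 := by
      rw [hz, map_add, map_add, map_smul, map_smul, hst0.1, hst0.2] at hZ
      simpa using hZ
    conv_lhs => rw [hz]
    simp only [map_add, map_smul, add_apply, smul_apply, ht _ hst0.1, ht _ hst0.2, ht _ hw2,
      hx _ hst0.1, hx _ hst0.2, hx _ hw2, hw _ hw1 hw2, hsymm (1, 0) (0, Z.2 - b • p.2),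
      hsymm (0, p.2) (0, Z.2 - b • p.2), smul_zero, add_zero]
  have h1 := hdiag (X + Y) (by rw [map_add, hX, hY, add_zero])
  simp only [map_add, add_apply, hdiag X hX, hdiag Y hY, hsymm Y X] at h1
  linarith

/-- The derivative of the normal is the Hessian of `F` on tangent vectors, which vanishes; hence the
normal is locally constant. -/
theorem IsPhotonSurface.eventually_sliceNormal_eq (h : IsPhotonSurface n m P) (hn : 3 ≤ n)
    (hm : 0 < m) (hF : IsLocalDefiningFunction P p U F) (hp : p ∈ P)
    (hst : ∀ q ∈ P, (1, 0) ∈ tangentVectors P q ∧ (0, q.2) ∈ tangentVectors P q) :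
    (∀ q ∈ U ∩ P, ‖sliceNormal F q‖ = 1 ∧ ∀ w, (0, w) ∈ tangentVectors P q ↔
      ⟪sliceNormal F q, w⟫ = 0) ∧ ∀ᶠ q in 𝓝 p, q ∈ P → sliceNormal F q = sliceNormal F p := by
  have hgr : ∀ q ∈ U ∩ P, fderiv ℝ F q (1, 0) = 0 ∧ spatialGrad n (fderiv ℝ F q) ≠ 0 := by
    intro q ⟨hqU, hqP⟩
    have h1 := (hst q hqP).1
    rw [(hF.at_mem hqU).mem_tangentVectors_iff hqP] at h1
    refine ⟨h1, fun h0 => hF.regular q hqU (ContinuousLinearMap.ext fun v => ?_)⟩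
    have hv : v = v.1 • ((1, 0) : Coord n) + (0, v.2) := by ext1 <;> simp
    rw [hv, map_add, map_smul, h1, ← inner_spatialGrad, h0]
    simp
  have hspeed : ∀ q ∈ U ∩ P, sliceSpeed F q = 0 := fun q hq => by
    rw [sliceSpeed, (hgr q hq).1]; simp
  refine ⟨fun q hq => ⟨norm_sliceNormal (hgr q hq).2, fun w => ?_⟩, ?_⟩
  · rw [(hF.at_mem hq.1).mem_tangentVectors_iff hq.2, fderiv_apply_eq (hgr q hq).2, hspeed q hq]
    simp [(hgr q hq).2]
  · have h1 := eventually_eq_of_fderiv_eq_zero hF.contDiffAt (hF.eq_zero hp) (hF.regular p hF.mem)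
      (G := sliceNormal F)
      ((contDiffAt_sliceNormal hF.contDiffAt (hgr p ⟨hF.mem, hp⟩).2).eventually_differentiableAt)
      (by
        filter_upwards [hF.mem_nhds] with q hq hFq v hv
        have hqP := (hF.zero_iff q hq).2 hFq
        have hqF := hF.at_mem hq
        have hg := (hgr q ⟨hq, hqP⟩).2
        refine ext_inner_right ℝ fun w => ?_
        rw [(hasFDerivAt_sliceNormal hqF.contDiffAt hg).2,
          h.hessian_eq_zero_of_static hn hm hqF hqP hst hv, mul_zero, inner_zero_left]
        rw [fderiv_apply_eq hg, inner_sub_right, real_inner_smul_right,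
          real_inner_self_eq_norm_sq, norm_sliceNormal hg]
        simp)
    filter_upwards [h1, hF.eventually_iff] with q h1 h2 h3
    exact h1 (h2.1 h3)

/-- A connected static photon surface through the center is part of a hyperplane. -/
theorem IsPhotonSurface.subset_hyperplane (h : IsPhotonSurface n m P) (hn : 3 ≤ n)
    (hm : 0 < m) (hP : IsConnected P)
    (hst : ∀ q ∈ P, (1, 0) ∈ tangentVectors P q ∧ (0, q.2) ∈ tangentVectors P q) :
    ∃ u : EuclideanSpace ℝ (Fin n), ‖u‖ = 1 ∧ P ⊆ centeredVerticalHyperplane n m u := by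
  obtain ⟨p, hp⟩ := hP.nonempty
  obtain ⟨U, F, hF⟩ := h.embedded p hp
  have hl := h.eventually_sliceNormal_eq hn hm hF hp hst
  have hu := (hl.1 p ⟨hF.mem, hp⟩).1
  set u := sliceNormal F p with hudef
  have hconst : ∀ q ∈ P, ∀ᶠ x in 𝓝 q, x ∈ P →
      ∀ w, ((0, w) ∈ tangentVectors P x ↔ (0, w) ∈ tangentVectors P q) := by
    intro q hq
    obtain ⟨W, G, hG⟩ := h.embedded q hq
    have hl' := h.eventually_sliceNormal_eq hn hm hG hq hst
    filter_upwards [hl'.2, hG.mem_nhds] with x h1 h2 h3 w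
    rw [(hl'.1 x ⟨h2, h3⟩).2, (hl'.1 q ⟨hG.mem, hq⟩).2, h1 h3]
  -- Normals from different defining functions may differ in sign, so the propagated statement is
  -- about tangent spaces. The position vector is itself tangent, which puts the hyperplane through
  -- the center.
  have hall := hP.isPreconnected.forall_of_eventually
    (A := fun q => ∀ w, ⟪u, w⟫ = 0 → (0, w) ∈ tangentVectors P q)
    (fun q hq hA => (hconst q hq).mono fun x hx hxP w hw => (hx hxP w).2 (hA w hw))
    (fun q hq hA => (hconst q hq).mono fun x hx hxP hcon =>
      hA fun w hw => (hx hxP w).1 (hcon w hw))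
    hp fun w hw => ((hl.1 p ⟨hF.mem, hp⟩).2 w).2 hw
  refine ⟨u, hu, fun q hq => ⟨h.subset hq, ?_⟩⟩
  obtain ⟨W, G, hG⟩ := h.embedded q hq
  have hl' := (h.eventually_sliceNormal_eq hn hm hG hq hst).1 q ⟨hG.mem, hq⟩
  have h1 : ⟪sliceNormal G q, q.2⟫ = 0 := (hl'.2 _).1 (hst q hq).2
  have h2 : ∀ w, ⟪u, w⟫ = 0 → ⟪sliceNormal G q, w⟫ = 0 := fun w hw => (hl'.2 w).1 (hall q hq w hw)
  have huu : ⟪u, u⟫ = 1 := by rw [real_inner_self_eq_norm_sq, hu, one_pow]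
  have h3 : ∀ w, ⟪sliceNormal G q, w⟫ = ⟪u, w⟫ * ⟪sliceNormal G q, u⟫ := by
    intro w
    have := h2 (w - ⟪u, w⟫ • u) (by
      rw [inner_sub_right, real_inner_smul_right, huu]; ring)
    rw [inner_sub_right, real_inner_smul_right] at this
    linarith
  have h4 : ⟪sliceNormal G q, u⟫ ≠ 0 := by
    intro h0
    have := h3 (sliceNormal G q)
    rw [h0, mul_zero, real_inner_self_eq_norm_sq, hl'.1] at this
    norm_num at this
  have := h3 q.2
  rw [h1, eq_comm, mul_eq_zero, or_iff_left h4] at this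
  rw [real_inner_comm]
  exact this

end Static

end SchwarzschildPhoton

/-! ### Completeness of bounded vector fields. -/

section GlobalFlow

open Filter Set

variable {E : Type*} [NormedAddCommGroup E] [NormedSpace ℝ E]

/-- Bootstrapping: `α' = f ∘ α` is as regular as `α`. -/
theorem contDiff_of_hasDerivAt_comp {f : E → E} (hf : ContDiff ℝ ∞ f) {α : ℝ → E}
    (hα : ∀ t, HasDerivAt α (f (α t)) t) : ContDiff ℝ ∞ α := by
  have h1 : deriv α = f ∘ α := funext fun t => (hα t).deriv
  have h2 : Differentiable ℝ α := fun t => (hα t).differentiableAt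
  refine contDiff_infty.2 fun k => ?_
  induction k with
  | zero => exact contDiff_zero.2 h2.continuous
  | succ k ih =>
    push_cast
    refine contDiff_succ_iff_deriv.2 ⟨h2, by simp, ?_⟩
    rw [h1]
    exact (hf.of_le (by exact_mod_cast le_top)).comp ih

/-- A bounded smooth vector field on a finite-dimensional space has global solutions. -/
theorem exists_forall_hasDerivAt_of_bounded [FiniteDimensional ℝ E] {f : E → E}
    (hf : ContDiff ℝ ∞ f) {L : ℝ} (hL : ∀ x, ‖f x‖ ≤ L) (x : E) :
    ∃ α : ℝ → E, α 0 = x ∧ ContDiff ℝ ∞ α ∧ ∀ t, HasDerivAt α (f (α t)) t := by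
  have : ProperSpace E := FiniteDimensional.proper ℝ E
  have hL0 : 0 ≤ L := (norm_nonneg _).trans (hL x)
  have hv : ContMDiff (modelWithCornersSelf ℝ E) (modelWithCornersSelf ℝ E).tangent 1
      (fun x : E => (⟨x, f x⟩ : TangentBundle (modelWithCornersSelf ℝ E) E)) :=
    contMDiff_vectorSpace_iff_contDiff.2 (hf.of_le (by simp))
  obtain ⟨α, hα0, hα⟩ :=
    (exists_isMIntegralCurve_iff_exists_isMIntegralCurveOn_Ioo hv x).2 (by
      intro a
      rcases le_or_gt a 0 with ha | ha
      · exact ⟨fun _ => x, rfl, fun t ht => absurd (ht.1.trans ht.2) (by linarith)⟩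
      -- At speed at most `L`, a solution stays in the ball of radius `L * a` during `[-a, a]`. Thus
      -- Picard–Lindelöf applies on intervals of any length.
      obtain ⟨K, hK⟩ := (hf.of_le (m := 1) (by simp)).contDiffOn.exists_lipschitzOnWith one_ne_zero
        (convex_closedBall x (L * a)) (isCompact_closedBall x (L * a))
      have hP : IsPicardLindelof (fun _ : ℝ => f) (tmin := -a) (tmax := a)
          ⟨0, by linarith, ha.le⟩ x ⟨L * a, by positivity⟩ 0 ⟨L, hL0⟩ K :=
        IsPicardLindelof.of_time_independent (fun y _ => hL y) hK (by simp; rfl)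
      obtain ⟨α, h0, hα⟩ := hP.exists_eq_forall_mem_Icc_hasDerivWithinAt₀
      refine ⟨α, h0, fun t ht => ?_⟩
      have h1 := (hα t ⟨ht.1.le, ht.2.le⟩).hasDerivAt (Icc_mem_nhds ht.1 ht.2)
      exact h1.hasFDerivAt.hasMFDerivAt.hasMFDerivWithinAt)
  have h1 : ∀ t, HasDerivAt α (f (α t)) t := fun t => by
    have h2 : HasFDerivAt α ((1 : ℝ →L[ℝ] ℝ).smulRight (f (α t))) t :=
      hasMFDerivAt_iff_hasFDerivAt.1 (hα t)
    simpa using h2.hasDerivAt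
  exact ⟨α, hα0, contDiff_of_hasDerivAt_comp hf h1, h1⟩

end GlobalFlow

namespace SchwarzschildPhoton

/-! ### Null profiles exist for all times. -/

section GlobalProfile

open Filter Set

variable {n : ℕ} {m Λ : ℝ}

/-- The radius as a function of the logarithmic distance to the horizon. -/
noncomputable def logRadius (n : ℕ) (m z : ℝ) : ℝ := horizonRadius n m + Real.exp z

/-- The vector field of the null profiles in terms of the logarithmic distance to the horizon and
of the angle to the radial direction. -/
noncomputable def profileField (n : ℕ) (m Λ : ℝ) (y : ℝ × ℝ) : ℝ × ℝ :=
  (Real.cos y.2 * (lapseSq n m (logRadius n m y.1) / Real.exp y.1),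
    -(√Λ * √(lapseSq n m (logRadius n m y.1)) *
      (2 * lapseSq n m (logRadius n m y.1)
        - ((n : ℝ) - 2) * (1 - lapseSq n m (logRadius n m y.1)))
        / (2 * logRadius n m y.1 ^ 2)))

theorem horizonRadius_lt_logRadius (z : ℝ) : horizonRadius n m < logRadius n m z :=
  lt_add_of_pos_right _ (Real.exp_pos z)

theorem contDiff_profileField (hn : 3 ≤ n) (hm : 0 < m) : ContDiff ℝ ∞ (profileField n m Λ) := by
  have hR : ContDiff ℝ ∞ (fun y : ℝ × ℝ => logRadius n m y.1) :=
    contDiff_const.add (Real.contDiff_exp.comp contDiff_fst)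
  have hpos : ∀ z, 0 < logRadius n m z := fun z =>
    (horizonRadius_pos hm).trans (horizonRadius_lt_logRadius z)
  have hf : ContDiff ℝ ∞ (fun y : ℝ × ℝ => lapseSq n m (logRadius n m y.1)) :=
    contDiffOn_lapseSq.comp_contDiff hR fun y => hpos _
  have hf0 : ∀ y : ℝ × ℝ, lapseSq n m (logRadius n m y.1) ≠ 0 := fun y =>
    (lapseSq_pos hn hm (horizonRadius_lt_logRadius _)).ne'
  refine ((Real.contDiff_cos.comp contDiff_snd).mul (hf.div (Real.contDiff_exp.comp contDiff_fst)
    fun y => (Real.exp_pos _).ne')).prodMk ?_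
  exact (((contDiff_const.mul (hf.sqrt hf0)).mul ((contDiff_const.mul hf).sub
    (contDiff_const.mul (contDiff_const.sub hf)))).div (contDiff_const.mul (hR.pow 2))
    fun y => by have := hpos y.1; positivity).neg

/-- Bernoulli's inequality for `f = 1 - (r_m/r)^(n-2)`. The linear vanishing at the horizon bounds
the rate of change of `log (r - r_m)`, so the horizon is not reached in finite coordinate time. -/
theorem lapseSq_le_mul_sub (hn : 3 ≤ n) (hm : 0 < m) {r : ℝ} (hr : horizonRadius n m < r) :
    lapseSq n m r ≤ (n : ℝ) / horizonRadius n m * (r - horizonRadius n m) := by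
  have h0 := horizonRadius_pos (n := n) hm
  have hr0 := h0.trans hr
  have hH := lapseSq_horizonRadius hn hm
  have h2m : 2 * m = horizonRadius n m ^ (n - 2) := by
    rw [lapseSq, sub_eq_zero, eq_comm, div_eq_one_iff_eq (by positivity)] at hH
    exact hH
  have hx : 0 < horizonRadius n m / r := div_pos h0 hr0
  have hB := one_add_mul_le_pow (a := horizonRadius n m / r - 1) (by linarith) (n - 2)
  have hf : lapseSq n m r = 1 - (horizonRadius n m / r) ^ (n - 2) := by
    rw [lapseSq, h2m, div_pow]
  rw [add_sub_cancel] at hB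
  have h3 : ((n - 2 : ℕ) : ℝ) ≤ n := by exact_mod_cast Nat.sub_le n 2
  have h4 : 1 - horizonRadius n m / r = (r - horizonRadius n m) / r := by field_simp
  have h5 : (r - horizonRadius n m) / r ≤ (r - horizonRadius n m) / horizonRadius n m :=
    div_le_div_of_nonneg_left (by linarith) h0 hr.le
  have h6 : 0 ≤ (r - horizonRadius n m) / r := div_nonneg (by linarith) hr0.le
  calc lapseSq n m r ≤ ((n - 2 : ℕ) : ℝ) * ((r - horizonRadius n m) / r) := by
        rw [hf, ← h4]; linarith
    _ ≤ n * ((r - horizonRadius n m) / horizonRadius n m) := by gcongr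
    _ = _ := by ring

theorem norm_profileField_le (hn : 3 ≤ n) (hm : 0 < m) (y : ℝ × ℝ) :
    ‖profileField n m Λ y‖ ≤
      n / horizonRadius n m + √Λ * (n + 2) / (2 * horizonRadius n m ^ 2) := by
  have h0 := horizonRadius_pos (n := n) hm
  have hlt := horizonRadius_lt_logRadius (n := n) (m := m) y.1
  have hf := lapseSq_pos hn hm hlt
  have hf1 := lapseSq_lt_one (n := n) hm (h0.trans hlt)
  have hle := lapseSq_le_mul_sub hn hm hlt
  have hn3 : (3 : ℝ) ≤ n := by exact_mod_cast hn
  have he : logRadius n m y.1 - horizonRadius n m = Real.exp y.1 := by simp [logRadius]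
  rw [he] at hle
  have hA : 0 ≤ (n : ℝ) / horizonRadius n m := by positivity
  have hB : 0 ≤ √Λ * ((n : ℝ) + 2) / (2 * horizonRadius n m ^ 2) := by positivity
  refine (norm_prod_le_iff).2 ⟨?_, ?_⟩
  · have h1 : lapseSq n m (logRadius n m y.1) / Real.exp y.1 ≤ n / horizonRadius n m := by
      rwa [div_le_iff₀ (Real.exp_pos _)]
    have h2 := Real.abs_cos_le_one y.2
    simp only [profileField, norm_mul, Real.norm_eq_abs]
    rw [abs_of_pos (div_pos hf (Real.exp_pos _))]
    have h3 : 0 ≤ lapseSq n m (logRadius n m y.1) / Real.exp y.1 := by positivity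
    nlinarith [abs_nonneg (Real.cos y.2)]
  · simp only [profileField, norm_neg, norm_div, norm_mul, Real.norm_eq_abs]
    rw [abs_of_nonneg (Real.sqrt_nonneg _), abs_of_nonneg (Real.sqrt_nonneg _), abs_two,
      abs_of_nonneg (sq_nonneg (logRadius n m y.1))]
    have h1 : √(lapseSq n m (logRadius n m y.1)) ≤ 1 := Real.sqrt_le_one.2 hf1.le
    have h2 : |2 * lapseSq n m (logRadius n m y.1)
        - ((n : ℝ) - 2) * (1 - lapseSq n m (logRadius n m y.1))| ≤ n + 2 := by
      rw [abs_le]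
      constructor <;> nlinarith
    have h3 : √Λ * √(lapseSq n m (logRadius n m y.1)) * |2 * lapseSq n m (logRadius n m y.1)
        - ((n : ℝ) - 2) * (1 - lapseSq n m (logRadius n m y.1))| /
          (2 * logRadius n m y.1 ^ 2) ≤ √Λ * 1 * (n + 2) / (2 * horizonRadius n m ^ 2) := by
      gcongr
    rw [mul_one] at h3
    linarith

/-- Null profiles with given initial data exist for all times. -/
theorem exists_isNullProfile (hn : 3 ≤ n) (hm : 0 < m) (hΛ : 0 < Λ) {t₀ r₀ σ₀ : ℝ}
    (hr : horizonRadius n m < r₀) (hσ : σ₀ ^ 2 = profileEnergy n m Λ r₀) :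
    ∃ ρ, IsNullProfile n m Λ univ ρ ∧ ρ t₀ = r₀ ∧ deriv ρ t₀ = σ₀ := by
  have hr0 := (horizonRadius_pos hm).trans hr
  have hf := lapseSq_pos hn hm hr
  rw [profileEnergy] at hσ
  have hc2 : (σ₀ / lapseSq n m r₀) ^ 2 = 1 - Λ * lapseSq n m r₀ / r₀ ^ 2 := by
    rw [div_pow, hσ]; field_simp
  have hs2 : 0 ≤ Λ * lapseSq n m r₀ / r₀ ^ 2 := by positivity
  have hcabs := abs_le_one_iff_mul_self_le_one.2
    (show σ₀ / lapseSq n m r₀ * (σ₀ / lapseSq n m r₀) ≤ 1 by nlinarith)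
  rw [abs_le] at hcabs
  -- Writing `dr/dt = f cos θ` removes the square root of the energy equation, which is not smooth
  -- at turning points. In the variables `log (r - r_m)` and `θ` the system is smooth and bounded.
  obtain ⟨α, hα0, hαs, hα⟩ := exists_forall_hasDerivAt_of_bounded (contDiff_profileField hn hm)
    (norm_profileField_le (Λ := Λ) hn hm)
    (Real.log (r₀ - horizonRadius n m), Real.arccos (σ₀ / lapseSq n m r₀))
  have hlog0 : logRadius n m (α 0).1 = r₀ := by
    rw [hα0, logRadius, Real.exp_log (by linarith)]; ring
  have hlt : ∀ t, horizonRadius n m < logRadius n m (α t).1 :=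
    fun t => horizonRadius_lt_logRadius _
  have hpos : ∀ t, 0 < logRadius n m (α t).1 := fun t => (horizonRadius_pos hm).trans (hlt t)
  have hfpos : ∀ t, 0 < lapseSq n m (logRadius n m (α t).1) := fun t => lapseSq_pos hn hm (hlt t)
  have h1 : ∀ t, HasDerivAt (fun s => (α s).1) (profileField n m Λ (α t)).1 t := fun t =>
    (ContinuousLinearMap.fst ℝ ℝ ℝ).hasFDerivAt.comp_hasDerivAt t (hα t)
  have h2 : ∀ t, HasDerivAt (fun s => (α s).2) (profileField n m Λ (α t)).2 t := fun t =>
    (ContinuousLinearMap.snd ℝ ℝ ℝ).hasFDerivAt.comp_hasDerivAt t (hα t)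
  have hρ : ∀ t, HasDerivAt (fun s => logRadius n m (α s).1)
      (Real.cos (α t).2 * lapseSq n m (logRadius n m (α t).1)) t := by
    intro t
    refine ((h1 t).exp.const_add (horizonRadius n m)).congr_deriv ?_
    simp only [profileField]
    field_simp
  have hfd : ∀ t, HasDerivAt (fun s => lapseSq n m (logRadius n m (α s).1))
      (lapseSqDeriv n m (logRadius n m (α t).1) *
        (Real.cos (α t).2 * lapseSq n m (logRadius n m (α t).1))) t := fun t =>
    HasDerivAt.comp (h₂ := lapseSq n m) t (hasDerivAt_lapseSq (m := m) hn (hpos t)) (hρ t)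
  -- The invariant `sin θ = √(Λf)/r` is the energy equation in disguise; it holds initially by the
  -- choice of the angle and its defect has zero derivative.
  have hinv : ∀ t, Real.sin (α t).2 =
      √Λ * √(lapseSq n m (logRadius n m (α t).1)) / logRadius n m (α t).1 := by
    have hd : ∀ t, HasDerivAt (fun s => Real.sin (α s).2 -
        √Λ * √(lapseSq n m (logRadius n m (α s).1)) / logRadius n m (α s).1) 0 t := by
      intro t
      have hp := hpos t
      have hsq := Real.sqrt_pos.2 (hfpos t)
      have hsf := Real.sq_sqrt (hfpos t).le
      refine ((h2 t).sin.sub ((((hfd t).sqrt (hfpos t).ne').const_mul √Λ).div (hρ t)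
        (hpos t).ne')).congr_deriv ?_
      simp only [profileField, lapseSqDeriv]
      set f := lapseSq n m (logRadius n m (α t).1)
      set R := logRadius n m (α t).1
      set g := √f
      rw [← hsf]
      field_simp
      ring
    have hconst := is_const_of_deriv_eq_zero (fun t => (hd t).differentiableAt)
      (fun t => (hd t).deriv)
    intro t
    have h3 := hconst t 0
    have h4 : Real.sin (α 0).2 -
        √Λ * √(lapseSq n m (logRadius n m (α 0).1)) / logRadius n m (α 0).1 = 0 := by
      rw [hlog0, hα0]
      simp only
      rw [Real.sin_arccos, hc2, sub_sub_cancel, Real.sqrt_div (by positivity),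
        Real.sqrt_mul hΛ.le, Real.sqrt_sq hr0.le, sub_self]
    rw [h4, sub_eq_zero] at h3
    exact h3
  have hsin2 : ∀ t, Real.sin (α t).2 ^ 2 =
      Λ * lapseSq n m (logRadius n m (α t).1) / logRadius n m (α t).1 ^ 2 := by
    intro t
    rw [hinv, div_pow, mul_pow, Real.sq_sqrt hΛ.le, Real.sq_sqrt (hfpos t).le]
  have hshift : ∀ {g : ℝ → ℝ} {g' : ℝ → ℝ}, (∀ t, HasDerivAt g (g' t) t) →
      ∀ t, HasDerivAt (fun s => g (s - t₀)) (g' (t - t₀)) t := fun hg t => (hg _).comp_sub_const t t₀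
  have hρ' := hshift hρ
  have hderiv : deriv (fun s => logRadius n m (α (s - t₀)).1) =
      fun s => Real.cos (α (s - t₀)).2 * lapseSq n m (logRadius n m (α (s - t₀)).1) :=
    funext fun t => (hρ' t).deriv
  refine ⟨fun s => logRadius n m (α (s - t₀)).1, ⟨isOpen_univ, ?_, fun t _ => hlt _, ?_, ?_⟩, ?_, ?_⟩
  · have h3 : ContDiff ℝ ∞ (fun s : ℝ => α (s - t₀)) := hαs.comp (contDiff_id.sub contDiff_const)
    exact (contDiff_const.add (Real.contDiff_exp.comp h3.fst)).contDiffOn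
  · intro t _
    rw [hderiv, profileEnergy, mul_pow, Real.cos_sq', hsin2]
    ring
  · intro t _
    rw [hderiv]
    have h3 := hshift (fun t => (h2 t).cos.mul (hfd t)) t
    have hp := hpos (t - t₀)
    have hs := Real.sq_sqrt (hfpos (t - t₀)).le
    have hΛs := Real.sq_sqrt hΛ.le
    have h4 := h3.deriv
    simp only [Pi.mul_apply] at h4
    rw [h4, hinv]
    have hc := Real.cos_sq' (α (t - t₀)).2
    rw [hsin2] at hc
    simp only [profileField, profileAccel]
    set f := lapseSq n m (logRadius n m (α (t - t₀)).1) with hfdef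
    set R := logRadius n m (α (t - t₀)).1
    have e1 : -(√Λ * √f / R) * -(√Λ * √f * (2 * f - ((n : ℝ) - 2) * (1 - f)) / (2 * R ^ 2)) * f
        = (√Λ ^ 2 * √f ^ 2) * (2 * f - ((n : ℝ) - 2) * (1 - f)) / (2 * R ^ 3) * f := by
      field_simp
    rw [e1, hs, hΛs]
    have e2 : Real.cos (α (t - t₀)).2 * (lapseSqDeriv n m R * (Real.cos (α (t - t₀)).2 * f))
        = Real.cos (α (t - t₀)).2 ^ 2 * lapseSqDeriv n m R * f := by ring
    rw [e2, hc, lapseSqDeriv, ← hfdef]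
    field_simp
    ring
  · simp [hlog0]
  · rw [hderiv]
    simp only [sub_self, hlog0]
    rw [hα0, Real.cos_arccos hcabs.1 hcabs.2]
    field_simp

end GlobalProfile

end SchwarzschildPhoton

namespace SchwarzschildPhoton

/-! ### Slope and impact parameter of a photon surface with radial normals. -/

section Radial

open Filter Set
open scoped RealInnerProductSpace

variable {n : ℕ} {m : ℝ} {P U : Set (Coord n)} {F : Coord n → ℝ} {p q : Coord n}

/-- The radial speed `dr/dt` of the time-slices of the level sets of `F`. -/
noncomputable def levelSlope (F : Coord n → ℝ) (q : Coord n) : ℝ :=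
  -(fderiv ℝ F q (1, 0) * ‖q.2‖) / fderiv ℝ F q (0, q.2)

/-- The squared impact parameter of the null geodesics in a hypersurface of radius `r` and radial
speed `σ`. -/
noncomputable def slopeImpactSq (n : ℕ) (m r σ : ℝ) : ℝ :=
  r ^ 2 / lapseSq n m r * (1 - σ ^ 2 / lapseSq n m r ^ 2)

/-- For fixed `r`, the energy equation is solved for `Λ`. -/
theorem slopeImpactSq_profileEnergy {r Λ σ : ℝ} (hr : r ≠ 0) (hf : lapseSq n m r ≠ 0)
    (h : σ ^ 2 = profileEnergy n m Λ r) : slopeImpactSq n m r σ = Λ := by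
  rw [slopeImpactSq, h, profileEnergy]
  field_simp
  ring

theorem profileEnergy_slopeImpactSq {r σ : ℝ} (hr : r ≠ 0) (hf : lapseSq n m r ≠ 0) :
    σ ^ 2 = profileEnergy n m (slopeImpactSq n m r σ) r := by
  rw [slopeImpactSq, profileEnergy]
  field_simp
  ring

/-- A hypersurface with radial spatial normal is a graph over time and sphere directions. -/
theorem IsPhotonSurface.radial_basic (h : IsPhotonSurface n m P) (hn : 3 ≤ n) (hm : 0 < m)
    (hF : IsLocalDefiningFunction P p U F) (hp : p ∈ P)
    (hrad : ∀ w, ⟪p.2, w⟫ = 0 → (0, w) ∈ tangentVectors P p) :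
    fderiv ℝ F p (0, p.2) ≠ 0 ∧
    (∀ v, v ∈ tangentVectors P p ↔ ⟪p.2, v.2⟫ = ‖p.2‖ * levelSlope F p * v.1) ∧
    levelSlope F p ^ 2 < lapseSq n m ‖p.2‖ ^ 2 := by
  have hr := norm_pos_of_mem hm (h.subset hp)
  have hf := lapseSq_pos hn hm (h.subset hp)
  simp only [hF.mem_tangentVectors_iff hp] at hrad
  have hsplit : ∀ v : Coord n, fderiv ℝ F p v =
      v.1 * fderiv ℝ F p (1, 0) + ⟪p.2, v.2⟫ / ‖p.2‖ ^ 2 * fderiv ℝ F p (0, p.2) := by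
    intro v
    have hv : v = v.1 • ((1, 0) : Coord n) + (⟪p.2, v.2⟫ / ‖p.2‖ ^ 2) • (0, p.2)
        + (0, v.2 - (⟪p.2, v.2⟫ / ‖p.2‖ ^ 2) • p.2) := by
      ext1 <;> simp
    conv_lhs => rw [hv, map_add, map_add, map_smul, map_smul, hrad (v.2 - (⟪p.2, v.2⟫ / ‖p.2‖ ^ 2) • p.2) (by
      rw [inner_sub_right, real_inner_smul_right, real_inner_self_eq_norm_sq]
      field_simp
      ring)]
    simp
  obtain ⟨v, hv, hneg⟩ := h.timelike p hp
  rw [hF.mem_tangentVectors_iff hp] at hv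
  rw [metric_self_eq p v hr hf.ne'] at hneg
  have hang := div_nonneg (angularSq_nonneg p v) (sq_nonneg ‖p.2‖)
  have hv1 : v.1 ≠ 0 := by
    intro h0
    rw [h0] at hneg
    have : 0 ≤ ⟪p.2, v.2⟫ ^ 2 / (lapseSq n m ‖p.2‖ * ‖p.2‖ ^ 2) := by positivity
    linarith
  have hx : fderiv ℝ F p (0, p.2) ≠ 0 := by
    intro h0
    rw [hsplit, h0, mul_zero, add_zero, mul_eq_zero, or_iff_right hv1] at hv
    refine hF.regular p hF.mem (ContinuousLinearMap.ext fun z => ?_)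
    rw [hsplit, hv, h0]
    simp
  have hiff : ∀ v, v ∈ tangentVectors P p ↔ ⟪p.2, v.2⟫ = ‖p.2‖ * levelSlope F p * v.1 := by
    intro v
    rw [hF.mem_tangentVectors_iff hp, hsplit, levelSlope]
    constructor
    · intro h1
      field_simp
      field_simp at h1
      linear_combination h1
    · intro h1
      rw [h1]
      field_simp
      ring
  refine ⟨hx, hiff, ?_⟩
  rw [← hF.mem_tangentVectors_iff hp, hiff] at hv
  rw [hv] at hneg
  have h1 : (‖p.2‖ * levelSlope F p * v.1) ^ 2 / (lapseSq n m ‖p.2‖ * ‖p.2‖ ^ 2)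
      = levelSlope F p ^ 2 * v.1 ^ 2 / lapseSq n m ‖p.2‖ := by field_simp
  rw [h1] at hneg
  have h2 : levelSlope F p ^ 2 * v.1 ^ 2 / lapseSq n m ‖p.2‖ < lapseSq n m ‖p.2‖ * v.1 ^ 2 := by
    linarith
  rw [div_lt_iff₀ hf] at h2
  have h3 : levelSlope F p ^ 2 * v.1 ^ 2 < lapseSq n m ‖p.2‖ ^ 2 * v.1 ^ 2 := by
    linarith
  exact lt_of_mul_lt_mul_right h3 (sq_nonneg _)

theorem slopeImpactSq_pos {r σ : ℝ} (hr : 0 < r) (hf : 0 < lapseSq n m r)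
    (h : σ ^ 2 < lapseSq n m r ^ 2) : 0 < slopeImpactSq n m r σ := by
  have h1 : σ ^ 2 / lapseSq n m r ^ 2 < 1 := by rwa [div_lt_one (by positivity)]
  exact mul_pos (by positivity) (by linarith)

/-- A linear functional is determined on the tangent space by its values on null vectors. -/
theorem eq_mul_of_null (hn : 3 ≤ n) (hm : 0 < m) (hp : p ∈ spacetime n m) {σ c : ℝ}
    (hσ : σ ^ 2 < lapseSq n m ‖p.2‖ ^ 2) {ℓ : Coord n →L[ℝ] ℝ}
    (hℓ : ∀ v, v.1 = 1 → ⟪p.2, v.2⟫ = ‖p.2‖ * σ * v.1 → metric n m p v v = 0 → ℓ v = c)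
    {v : Coord n} (hv : ⟪p.2, v.2⟫ = ‖p.2‖ * σ * v.1) : ℓ v = c * v.1 := by
  have hr := norm_pos_of_mem hm hp
  have hf := lapseSq_pos hn hm hp
  set f := lapseSq n m ‖p.2‖ with hfdef
  have hR : 0 < f - σ ^ 2 / f := by
    rw [sub_pos, div_lt_iff₀ hf]
    linarith
  -- These are the null tangent vectors with time component one. Replacing `w` by `-w` shows that
  -- `ℓ` vanishes on the sphere directions.
  have hval : ∀ w, ⟪p.2, w⟫ = 0 → ‖w‖ ^ 2 = f - σ ^ 2 / f →
      ℓ (1, (σ / ‖p.2‖) • p.2) + ℓ (0, w) = c := by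
    intro w hw hwn
    have hsum : ((1, (σ / ‖p.2‖) • p.2 + w) : Coord n) = (1, (σ / ‖p.2‖) • p.2) + (0, w) := by
      ext1 <;> simp
    have hin : ⟪p.2, (σ / ‖p.2‖) • p.2 + w⟫ = ‖p.2‖ * σ := by
      rw [inner_add_right, real_inner_smul_right, hw, real_inner_self_eq_norm_sq]
      field_simp
      ring
    rw [← map_add, ← hsum]
    refine hℓ _ rfl (by rw [hin, mul_one]) ?_
    have hns : ⟪(σ / ‖p.2‖) • p.2 + w, (σ / ‖p.2‖) • p.2 + w⟫ = σ ^ 2 + ‖w‖ ^ 2 := by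
      rw [inner_add_right, real_inner_smul_right, real_inner_comm, hin, inner_add_left,
        real_inner_smul_left, hw, real_inner_self_eq_norm_sq]
      field_simp
      ring
    rw [metric_eq]
    simp only
    rw [hin, hns, hwn, radialCoeff, ← hfdef]
    field_simp
    ring
  have hneg : ∀ w, ℓ (0, -w) = -ℓ (0, w) := by
    intro w
    rw [← map_neg]
    congr 1
    ext1 <;> simp
  have hspace0 : ∀ w, ⟪p.2, w⟫ = 0 → ‖w‖ ^ 2 = f - σ ^ 2 / f → ℓ (0, w) = 0 := by
    intro w hw hwn
    have h1 := hval w hw hwn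
    have h2 := hval (-w) (by rw [inner_neg_right, hw, neg_zero]) (by rwa [norm_neg])
    rw [hneg] at h2
    linarith
  have hscale : ∀ w : EuclideanSpace ℝ (Fin n), w ≠ 0 →
      ‖(√(f - σ ^ 2 / f) / ‖w‖) • w‖ ^ 2 = f - σ ^ 2 / f := by
    intro w hw
    have := norm_pos_iff.2 hw
    rw [norm_smul, mul_pow, Real.norm_eq_abs, sq_abs, div_pow, Real.sq_sqrt hR.le]
    field_simp
  have hspace : ∀ w, ⟪p.2, w⟫ = 0 → ℓ (0, w) = 0 := by
    intro w hw
    rcases eq_or_ne w 0 with rfl | hw0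
    · have : ((0, 0) : Coord n) = 0 := rfl
      rw [this, map_zero]
    have h1 := hspace0 ((√(f - σ ^ 2 / f) / ‖w‖) • w)
      (by rw [real_inner_smul_right, hw, mul_zero]) (hscale w hw0)
    have h2 : ((0, (√(f - σ ^ 2 / f) / ‖w‖) • w) : Coord n)
        = (√(f - σ ^ 2 / f) / ‖w‖) • (0, w) := by ext1 <;> simp
    rw [h2, map_smul, smul_eq_mul, mul_eq_zero] at h1
    refine h1.resolve_left ?_
    have := norm_pos_iff.2 hw0
    have := Real.sqrt_pos.2 hR
    positivity
  obtain ⟨z, hz0, hz, -⟩ := exists_ne_zero_orthogonal hn p.2 p.2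
  have htime : ℓ (1, (σ / ‖p.2‖) • p.2) = c := by
    have h1 := hval ((√(f - σ ^ 2 / f) / ‖z‖) • z)
      (by rw [real_inner_smul_right, hz, mul_zero]) (hscale z hz0)
    rwa [hspace _ (by rw [real_inner_smul_right, hz, mul_zero]), add_zero] at h1
  have hv' : v = v.1 • ((1, (σ / ‖p.2‖) • p.2) : Coord n)
      + (0, v.2 - (v.1 * (σ / ‖p.2‖)) • p.2) := by
    ext1 <;> simp [smul_smul]
  rw [hv', map_add, map_smul, htime, hspace _ (by
    rw [inner_sub_right, real_inner_smul_right, hv, real_inner_self_eq_norm_sq]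
    field_simp
    ring)]
  simp [mul_comm]

theorem IsLocalDefiningFunction.differentiableAt_levelSlope (hm : 0 < m)
    (hF : IsLocalDefiningFunction P p U F) (hp : p ∈ spacetime n m)
    (hx : fderiv ℝ F p (0, p.2) ≠ 0) : DifferentiableAt ℝ (levelSlope F) p := by
  have hr := norm_pos_of_mem hm hp
  have hD := hF.contDiffAt.hasFDerivAt_fderiv.differentiableAt
  have h1 : DifferentiableAt ℝ (fun q : Coord n => fderiv ℝ F q (1, 0) * ‖q.2‖) p :=
    (hD.clm_apply (differentiableAt_const _)).mul (hasFDerivAt_radius hr).differentiableAt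
  have h2 : DifferentiableAt ℝ (fun q : Coord n => fderiv ℝ F q (0, q.2)) p :=
    hD.clm_apply ((differentiableAt_const _).prodMk differentiableAt_snd)
  have h3 := h1.neg.mul (h2.inv hx)
  exact h3.congr_of_eventuallyEq (Eventually.of_forall fun q => div_eq_mul_inv _ _)

/-- Derivatives of slope and impact parameter along a photon surface with radial normals. -/
theorem IsPhotonSurface.fderiv_levelSlope (h : IsPhotonSurface n m P) (hn : 3 ≤ n) (hm : 0 < m)
    (hrad : ∀ p ∈ P, ∀ w, ⟪p.2, w⟫ = 0 → (0, w) ∈ tangentVectors P p)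
    (hF : IsLocalDefiningFunction P p U F) (hp : p ∈ P) {v : Coord n}
    (hv : v ∈ tangentVectors P p) :
    DifferentiableAt ℝ (fun q => slopeImpactSq n m ‖q.2‖ (levelSlope F q)) p ∧
    fderiv ℝ (fun q => slopeImpactSq n m ‖q.2‖ (levelSlope F q)) p v = 0 ∧
    fderiv ℝ (levelSlope F) p v =
      profileAccel n m (slopeImpactSq n m ‖p.2‖ (levelSlope F p)) ‖p.2‖ * v.1 := by
  have hr := norm_pos_of_mem hm (h.subset hp)
  have hf := lapseSq_pos hn hm (h.subset hp)
  obtain ⟨hx, hiff, hlt⟩ := h.radial_basic hn hm hF hp (hrad p hp)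
  have hdσ := hF.differentiableAt_levelSlope hm (h.subset hp) hx
  have hdr := (hasFDerivAt_radius hr).differentiableAt
  have hdf : DifferentiableAt ℝ (fun q : Coord n => lapseSq n m ‖q.2‖) p :=
    DifferentiableAt.comp (g := lapseSq n m) p (hasDerivAt_lapseSq hn hr).differentiableAt hdr
  have hdΛ : DifferentiableAt ℝ (fun q => slopeImpactSq n m ‖q.2‖ (levelSlope F q)) p := by
    simp only [slopeImpactSq, div_eq_mul_inv]
    exact ((hdr.pow 2).mul (hdf.inv hf.ne')).mul
      ((differentiableAt_const _).sub ((hdσ.pow 2).mul ((hdf.pow 2).inv (pow_ne_zero 2 hf.ne'))))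
  -- Along a null geodesic inside `P` the slope of the surface is that of the geodesic, so
  -- conservation of the impact parameter and the radial equation become derivatives along `P`.
  have hcurve : ∀ v, v.1 = 1 → ⟪p.2, v.2⟫ = ‖p.2‖ * levelSlope F p * v.1 →
      metric n m p v v = 0 →
      fderiv ℝ (fun q => slopeImpactSq n m ‖q.2‖ (levelSlope F q)) p v = 0 ∧
      fderiv ℝ (levelSlope F) p v =
        profileAccel n m (slopeImpactSq n m ‖p.2‖ (levelSlope F p)) ‖p.2‖ := by
    intro v hv1 hvt hvn
    obtain ⟨I, γ, hγ, h0, rfl, rfl, hγP⟩ := h.exists_geodesic hn hm hF hp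
      ((hF.mem_tangentVectors_iff hp).1 ((hiff v).2 hvt)) hvn
    have hc : Tendsto γ (𝓝 0) (𝓝 (γ 0)) := (hγ.hasDerivAt h0).continuousAt
    have hI := hγ.isOpen.mem_nhds h0
    have ht : ∀ τ ∈ I, (deriv γ τ).1 ≠ 0 := by
      intro τ hτ h1
      have := hγ.energy_eq hn hm hτ h0
      rw [h1, hv1, mul_zero, mul_one] at this
      exact hf.ne this
    have hslope : ∀ᶠ τ in 𝓝 (0 : ℝ), levelSlope F (γ τ) = radialSlope (γ τ) (deriv γ τ) := by
      filter_upwards [hγP, hI, hc.eventually hF.mem_nhds] with τ h1 h2 h3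
      have hb := h.radial_basic hn hm (hF.at_mem h3) h1.1 (hrad _ h1.1)
      have h4 := (hb.2.1 _).1 h1.2
      have hr' := norm_pos_of_mem hm (hγ.mem τ h2)
      have ht' := ht τ h2
      rw [radialSlope, h4]
      field_simp
    have himpact : ∀ᶠ τ in 𝓝 (0 : ℝ), slopeImpactSq n m ‖(γ τ).2‖ (levelSlope F (γ τ)) =
        impactSq n m (γ τ) (deriv γ τ) := by
      filter_upwards [hslope, hI] with τ h1 h2
      have hr' := norm_pos_of_mem hm (hγ.mem τ h2)
      have hf' := lapseSq_pos hn hm (hγ.mem τ h2)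
      exact slopeImpactSq_profileEnergy hr'.ne' hf'.ne' (by
        rw [h1]; exact radialSlope_sq_of_null hr' hf'.ne' (hγ.null τ h2) (ht τ h2))
    have hconst : ∀ᶠ τ in 𝓝 (0 : ℝ), slopeImpactSq n m ‖(γ τ).2‖ (levelSlope F (γ τ)) =
        impactSq n m (γ 0) (deriv γ 0) := by
      filter_upwards [himpact, hI] with τ h1 h2
      rw [h1, impactSq, impactSq, hγ.angularSq_eq hn hm h2 h0, hγ.energy_eq hn hm h2 h0]
    constructor
    · have h1 := hdΛ.hasFDerivAt.comp_hasDerivAt (0 : ℝ) (hγ.hasDerivAt h0)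
      exact h1.unique ((hasDerivAt_const (0 : ℝ) _).congr_of_eventuallyEq hconst)
    · have h1 := hdσ.hasFDerivAt.comp_hasDerivAt (0 : ℝ) (hγ.hasDerivAt h0)
      have h2 := hasDerivAt_radialSlope hn hm (hγ.mem 0 h0) (hγ.hasDerivAt h0)
        (hγ.hasDerivAt_deriv hn hm h0) (hγ.null 0 h0) (ht 0 h0)
      have h3 := h1.unique (h2.congr_of_eventuallyEq hslope)
      rw [h3, hv1, one_mul, himpact.self_of_nhds]
  refine ⟨hdΛ, ?_, ?_⟩
  · simpa using eq_mul_of_null hn hm (h.subset hp) hlt (fun v h1 h2 h3 => (hcurve v h1 h2 h3).1)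
      ((hiff v).1 hv)
  · exact eq_mul_of_null hn hm (h.subset hp) hlt (fun v h1 h2 h3 => (hcurve v h1 h2 h3).2)
      ((hiff v).1 hv)

end Radial

end SchwarzschildPhoton

namespace SchwarzschildPhoton

/-! ### The radial case: comparison with global null profiles. -/

section Classification

open Filter Set
open scoped RealInnerProductSpace

variable {n : ℕ} {m : ℝ} {P U : Set (Coord n)} {F : Coord n → ℝ} {p q : Coord n}

/-- A photon surface with radial normals that touches the surface of a null profile agrees with it
locally. -/
theorem IsPhotonSurface.eventually_mem_profileSurface (h : IsPhotonSurface n m P) (hn : 3 ≤ n)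
    (hm : 0 < m) (hrad : ∀ p ∈ P, ∀ w, ⟪p.2, w⟫ = 0 → (0, w) ∈ tangentVectors P p)
    (hF : IsLocalDefiningFunction P p U F) (hp : p ∈ P) {Λ : ℝ} {ρ : ℝ → ℝ}
    (hρ : IsNullProfile n m Λ univ ρ) (hpr : ‖p.2‖ = ρ p.1)
    (hps : levelSlope F p = deriv ρ p.1) :
    ∀ᶠ q in 𝓝 p, q ∈ P → ‖q.2‖ = ρ q.1 ∧ levelSlope F q = deriv ρ q.1 := by
  have hr := norm_pos_of_mem hm (h.subset hp)
  have hf := lapseSq_pos hn hm (h.subset hp)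
  have hΛp : slopeImpactSq n m ‖p.2‖ (levelSlope F p) = Λ :=
    slopeImpactSq_profileEnergy hr.ne' hf.ne' (by rw [hps, hpr]; exact hρ.energy _ trivial)
  have hpos : ∀ᶠ q : Coord n in 𝓝 p, q ∈ spacetime n m :=
    isOpen_spacetime.mem_nhds (h.subset hp)
  have hx : ∀ᶠ q in 𝓝 p, fderiv ℝ F q (0, q.2) ≠ 0 :=
    (hF.continuousAt_fderiv_apply (X := fun q => (0, q.2)) (by fun_prop)).eventually_ne
      (h.radial_basic hn hm hF hp (hrad p hp)).1
  have hdσ : ∀ᶠ q in 𝓝 p, DifferentiableAt ℝ (levelSlope F) q := by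
    filter_upwards [hx, hF.mem_nhds, hpos] with q h1 h2 h3
    exact (hF.at_mem h2).differentiableAt_levelSlope hm h3 h1
  have hΛ : ∀ᶠ q in 𝓝 p, F q = 0 → slopeImpactSq n m ‖q.2‖ (levelSlope F q) = Λ := by
    rw [← hΛp]
    refine eventually_eq_of_fderiv_eq_zero (G := fun q => slopeImpactSq n m ‖q.2‖ (levelSlope F q))
      hF.contDiffAt (hF.eq_zero hp) (hF.regular p hF.mem) ?_ ?_
    · filter_upwards [hdσ, hpos] with q h1 h2
      have hr := norm_pos_of_mem hm h2
      have hf := lapseSq_pos hn hm h2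
      have hdr := (hasFDerivAt_radius hr).differentiableAt
      have hdf : DifferentiableAt ℝ (fun q : Coord n => lapseSq n m ‖q.2‖) q :=
        DifferentiableAt.comp (g := lapseSq n m) q (hasDerivAt_lapseSq hn hr).differentiableAt hdr
      simp only [slopeImpactSq, div_eq_mul_inv]
      exact ((hdr.pow 2).mul (hdf.inv hf.ne')).mul
        ((differentiableAt_const _).sub
          ((h1.pow 2).mul ((hdf.pow 2).inv (pow_ne_zero 2 hf.ne'))))
    · filter_upwards [hF.mem_nhds] with q hq hFq v hv
      have hqP := (hF.zero_iff q hq).2 hFq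
      exact (h.fderiv_levelSlope hn hm hrad (hF.at_mem hq) hqP
        (((hF.at_mem hq).mem_tangentVectors_iff hqP).2 hv)).2.1
  obtain ⟨K, S, hS, hK⟩ :=
    ((contDiffOn_profileAccel (n := n) (m := m) (Λ := Λ)).contDiffAt
      (Ioi_mem_nhds hr)).of_le (m := 1) (by simp) |>.exists_lipschitzOnWith
  have hS1 : ∀ᶠ q : Coord n in 𝓝 p, ‖q.2‖ ∈ S := continuous_snd.norm.continuousAt hS
  have hρd := fun t => hρ.hasDerivAt (t := t) trivial
  have hρc : ContinuousAt (fun q : Coord n => ρ q.1) p :=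
    ContinuousAt.comp (g := ρ) (hρd _).continuousAt continuousAt_fst
  have hS2 : ∀ᶠ q : Coord n in 𝓝 p, ρ q.1 ∈ S := hρc (by simpa only [← hpr] using hS)
  have hdr : ∀ q ∈ spacetime n m, HasFDerivAt (fun q : Coord n => ‖q.2‖ - ρ q.1) _ q :=
    fun q hq => hρ.hasFDerivAt_sub (norm_pos_of_mem hm hq) trivial
  have hdρ' : ∀ q : Coord n, HasFDerivAt (fun q : Coord n => deriv ρ q.1)
      (profileAccel n m Λ (ρ q.1) • ContinuousLinearMap.fst ℝ ℝ (EuclideanSpace ℝ (Fin n))) q :=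
    fun q => (hρ.hasDerivAt_deriv (t := q.1) trivial).comp_hasFDerivAt q hasFDerivAt_fst
  -- On `P`, the impact parameter is the constant `Λ`, so radius and slope change along tangent
  -- vectors exactly as `ρ` and `ρ'` do. Their differences satisfy a linear differential inequality.
  have key := eventually_eq_zero_of_fderiv_le hF.contDiffAt (hF.eq_zero hp) (hF.regular p hF.mem)
    (G := fun q : Coord n => (‖q.2‖ - ρ q.1, levelSlope F q - deriv ρ q.1)) (C := max 1 K)
    (by
      filter_upwards [hdσ, hpos] with q h1 h2
      exact (hdr q h2).differentiableAt.prodMk (h1.sub (hdρ' q).differentiableAt))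
    (by positivity)
    (by
      filter_upwards [hdσ, hpos, hF.mem_nhds, hΛ, hS1, hS2] with q h1 h2 h3 h4 h5 h6 hFq v hv
      have hqP := (hF.zero_iff q h3).2 hFq
      have hqF := hF.at_mem h3
      have hvP := (hqF.mem_tangentVectors_iff hqP).2 hv
      have hr := norm_pos_of_mem hm h2
      have hb := ((h.radial_basic hn hm hqF hqP (hrad q hqP)).2.1 v).1 hvP
      have hσ := (h.fderiv_levelSlope hn hm hrad hqF hqP hvP).2.2
      rw [h4 hFq] at hσ
      have hG : HasFDerivAt (fun q : Coord n => (‖q.2‖ - ρ q.1, levelSlope F q - deriv ρ q.1)) _ q :=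
        (hdr q h2).prodMk (h1.hasFDerivAt.sub (hdρ' q))
      rw [hG.fderiv]
      have e1 : (‖q.2‖⁻¹ • (innerSL ℝ q.2).comp
            (ContinuousLinearMap.snd ℝ ℝ (EuclideanSpace ℝ (Fin n)))
          - deriv ρ q.1 • ContinuousLinearMap.fst ℝ ℝ (EuclideanSpace ℝ (Fin n))) v
          = v.1 * (levelSlope F q - deriv ρ q.1) := by
        simp [hb]
        field_simp
      have e2 : (fderiv ℝ (levelSlope F) q - profileAccel n m Λ (ρ q.1) •
          ContinuousLinearMap.fst ℝ ℝ (EuclideanSpace ℝ (Fin n))) v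
          = v.1 * (profileAccel n m Λ ‖q.2‖ - profileAccel n m Λ (ρ q.1)) := by
        simp [hσ]
        ring
      rw [ContinuousLinearMap.prod_apply, e1, e2]
      have hv1 : |v.1| ≤ ‖v‖ := norm_fst_le v
      have hL : |profileAccel n m Λ ‖q.2‖ - profileAccel n m Λ (ρ q.1)| ≤
          K * |‖q.2‖ - ρ q.1| := by
        simpa [Real.dist_eq] using hK.dist_le_mul _ h5 _ h6
      have n1 : |‖q.2‖ - ρ q.1| ≤ ‖(‖q.2‖ - ρ q.1, levelSlope F q - deriv ρ q.1)‖ :=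
        norm_fst_le (‖q.2‖ - ρ q.1, levelSlope F q - deriv ρ q.1)
      have n2 : |levelSlope F q - deriv ρ q.1| ≤
          ‖(‖q.2‖ - ρ q.1, levelSlope F q - deriv ρ q.1)‖ :=
        norm_snd_le (‖q.2‖ - ρ q.1, levelSlope F q - deriv ρ q.1)
      set N := ‖(‖q.2‖ - ρ q.1, levelSlope F q - deriv ρ q.1)‖
      have hN : 0 ≤ N := (abs_nonneg _).trans n1
      have hC1 : (1 : ℝ) ≤ max 1 (K : ℝ) := le_max_left _ _
      have hCK : (K : ℝ) ≤ max 1 (K : ℝ) := le_max_right _ _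
      refine norm_prod_le_iff.2 ⟨?_, ?_⟩
      · rw [norm_mul, Real.norm_eq_abs, Real.norm_eq_abs]
        calc |v.1| * |levelSlope F q - deriv ρ q.1| ≤ ‖v‖ * N := by gcongr
          _ = 1 * ‖v‖ * N := by ring
          _ ≤ max 1 (K : ℝ) * ‖v‖ * N := by gcongr
      · rw [norm_mul, Real.norm_eq_abs, Real.norm_eq_abs]
        calc |v.1| * |profileAccel n m Λ ‖q.2‖ - profileAccel n m Λ (ρ q.1)|
            ≤ ‖v‖ * (K * N) := by gcongr; exact hL.trans (by gcongr)
          _ = K * ‖v‖ * N := by ring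
          _ ≤ max 1 (K : ℝ) * ‖v‖ * N := by gcongr)
    (by simp [hpr, hps])
  filter_upwards [key, hF.eventually_iff] with q h1 h2 h3
  have h4 := h1 (h2.1 h3)
  simp only [Prod.mk_eq_zero, sub_eq_zero] at h4
  exact h4

/-- A connected photon surface with radial normals is part of the surface of a null profile. -/
theorem IsPhotonSurface.subset_profileSurface (h : IsPhotonSurface n m P) (hn : 3 ≤ n)
    (hm : 0 < m) (hP : IsConnected P)
    (hrad : ∀ p ∈ P, ∀ w, ⟪p.2, w⟫ = 0 → (0, w) ∈ tangentVectors P p) :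
    ∃ Λ ρ, 0 < Λ ∧ IsNullProfile n m Λ univ ρ ∧ P ⊆ profileSurface n univ ρ := by
  obtain ⟨p, hp⟩ := hP.nonempty
  obtain ⟨U, F, hF⟩ := h.embedded p hp
  have hr := norm_pos_of_mem hm (h.subset hp)
  have hf := lapseSq_pos hn hm (h.subset hp)
  obtain ⟨-, hiff, hlt⟩ := h.radial_basic hn hm hF hp (hrad p hp)
  have hΛ := slopeImpactSq_pos hr hf hlt
  obtain ⟨ρ, hρ, hρ0, hρ1⟩ := exists_isNullProfile hn hm hΛ (t₀ := p.1) (h.subset hp)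
    (profileEnergy_slopeImpactSq (σ := levelSlope F p) hr.ne' hf.ne')
  refine ⟨_, ρ, hΛ, hρ, fun q hq => ⟨trivial, ?_⟩⟩
  have hslope : ∀ {q W G}, IsLocalDefiningFunction P q W G → q ∈ P →
      ((1, (deriv ρ q.1 / ‖q.2‖) • q.2) ∈ tangentVectors P q ↔
        levelSlope G q = deriv ρ q.1) := by
    intro q W G hG hq
    have hr := norm_pos_of_mem hm (h.subset hq)
    rw [(h.radial_basic hn hm hG hq (hrad q hq)).2.1, real_inner_smul_right,
      real_inner_self_eq_norm_sq]
    have e : deriv ρ q.1 / ‖q.2‖ * ‖q.2‖ ^ 2 = ‖q.2‖ * deriv ρ q.1 := by field_simp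
    rw [e, mul_one, mul_right_inj' hr.ne', eq_comm]
  -- Agreement of the slopes is expressed by a tangent vector, hence independently of the local
  -- defining function. Agreement to first order is open by ODE uniqueness and closed by continuity.
  have hall := hP.isPreconnected.forall_of_eventually
    (A := fun q => ‖q.2‖ = ρ q.1 ∧ (1, (deriv ρ q.1 / ‖q.2‖) • q.2) ∈ tangentVectors P q)
    (by
      rintro q hq ⟨h1, h2⟩
      obtain ⟨W, G, hG⟩ := h.embedded q hq
      rw [hslope hG hq] at h2
      filter_upwards [h.eventually_mem_profileSurface hn hm hrad hG hq hρ h1 h2, hG.mem_nhds]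
        with x hx hxW hxP
      rw [hslope (hG.at_mem hxW) hxP]
      exact hx hxP)
    (by
      intro q hq hA
      obtain ⟨W, G, hG⟩ := h.embedded q hq
      rw [hslope hG hq] at hA
      have hσ := (hG.differentiableAt_levelSlope hm (h.subset hq)
        (h.radial_basic hn hm hG hq (hrad q hq)).1).continuousAt
      have hc1 : ContinuousAt (fun x : Coord n => ρ x.1) q :=
        ContinuousAt.comp (g := ρ) (hρ.hasDerivAt trivial).continuousAt continuousAt_fst
      have hc2 : ContinuousAt (fun x : Coord n => deriv ρ x.1) q :=
        ContinuousAt.comp (g := deriv ρ) (hρ.hasDerivAt_deriv trivial).continuousAt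
          continuousAt_fst
      rcases not_and_or.1 hA with h1 | h1
      · filter_upwards [(continuous_snd.norm.continuousAt.sub hc1).eventually_ne
          (sub_ne_zero.2 h1)] with x hx _ hcon
        exact hx (sub_eq_zero.2 hcon.1)
      · filter_upwards [(hσ.sub hc2).eventually_ne (sub_ne_zero.2 h1), hG.mem_nhds]
          with x hx hxW hxP hcon
        rw [hslope (hG.at_mem hxW) hxP] at hcon
        exact hx (sub_eq_zero.2 hcon.2))
    hp ⟨hρ0.symm, (hslope hF hp).2 hρ1.symm⟩
  exact (hall q hq).1

/-- The surface of a global null profile is one of the two model surfaces. -/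
theorem IsNullProfile.isPhotonCylinder_or_isPhotonProfileSurface (hn : 3 ≤ n) (hm : 0 < m)
    {lam : ℝ} (hlam : 0 < lam) {ρ : ℝ → ℝ} (hρ : IsNullProfile n m (1 / lam ^ 2) univ ρ) :
    IsPhotonCylinder n m (profileSurface n univ ρ) lam ∨
      IsPhotonProfileSurface n m (profileSurface n univ ρ) lam := by
  by_cases hc : ∃ t₁ ∈ (univ : Set ℝ), ∃ t₂ ∈ (univ : Set ℝ), ρ t₁ ≠ ρ t₂
  · refine Or.inr ⟨univ, ρ, isOpen_univ, ordConnected_univ, hρ.smooth, hρ.horizon_lt, hc,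
      fun t ht => ?_, rfl⟩
    have hr := (horizonRadius_pos hm).trans (hρ.horizon_lt t ht)
    rw [hρ.energy t ht, profileEnergy]
    field_simp
  · push Not at hc
    have hconst : ρ = fun _ => ρ 0 := funext fun t => hc t trivial 0 trivial
    have hlt := hρ.horizon_lt 0 trivial
    have hr := (horizonRadius_pos hm).trans hlt
    have hf := lapseSq_pos hn hm hlt
    have hd : deriv ρ = fun _ => 0 := by rw [hconst]; exact deriv_const' _
    have hen := hρ.energy 0 trivial
    have hac := hρ.accel 0 trivial
    rw [hd] at hen hac
    rw [deriv_const'] at hac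
    -- For a constant profile, vanishing energy gives the formula for `lam`, and vanishing
    -- acceleration then gives `f' r = 2f`.
    have hΛ : lapseSq n m (ρ 0) = lam ^ 2 * ρ 0 ^ 2 := by
      rw [profileEnergy, zero_pow two_ne_zero, eq_comm, mul_eq_zero,
        or_iff_right (pow_ne_zero 2 hf.ne')] at hen
      field_simp at hen
      linarith
    refine Or.inl ⟨ρ 0, hlt, ?_, ?_, ?_⟩
    · rw [(hasDerivAt_lapseSq hn hr).deriv]
      rw [profileAccel] at hac
      have hl2 : 1 / lam ^ 2 = ρ 0 ^ 2 / lapseSq n m (ρ 0) := by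
        rw [hΛ]; field_simp
      rw [hl2] at hac
      field_simp at hac
      rw [zero_mul, zero_mul, eq_comm, mul_eq_zero, or_iff_right hf.ne'] at hac
      linarith
    · rw [hΛ, ← mul_pow, Real.sqrt_sq (by positivity)]
      field_simp
    · ext p
      rw [profileSurface, hconst]
      simp

end Classification

end SchwarzschildPhoton

/-- Local classification of the photon surfaces in Schwarzschild spacetime of mass `m > 0`:
every connected photon surface is part of a model, every model is a photon surface,
and every timelike hypersurface that is part of a photon surface is one. -/
theorem corollary3p3 (n : ℕ) (hn : 3 ≤ n) (m : ℝ) (hm : 0 < m) :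
    (∀ P : Set (Coord n), IsConnected P → IsPhotonSurface n m P →
      (∃ u : EuclideanSpace ℝ (Fin n), ‖u‖ = 1 ∧ P ⊆ centeredVerticalHyperplane n m u) ∨
      (∃ (Q : Set (Coord n)) (lam : ℝ), P ⊆ Q ∧ IsPhotonSurface n m Q ∧
        IsSphericallySymmetric n m Q ∧ 0 < lam ∧ HasOutwardUmbilicityFactor n m Q lam ∧
        (IsPhotonCylinder n m Q lam ∨ IsPhotonProfileSurface n m Q lam))) ∧
    (∀ u : EuclideanSpace ℝ (Fin n), ‖u‖ = 1 →
      IsPhotonSurface n m (centeredVerticalHyperplane n m u) ∧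
      IsTotallyGeodesic n m (centeredVerticalHyperplane n m u)) ∧
    (∀ (Q : Set (Coord n)) (lam : ℝ), 0 < lam →
      IsPhotonCylinder n m Q lam ∨ IsPhotonProfileSurface n m Q lam →
      IsPhotonSurface n m Q ∧ IsSphericallySymmetric n m Q ∧
        HasOutwardUmbilicityFactor n m Q lam) ∧
    (∀ P Q : Set (Coord n), IsTimelikeHypersurface n m P → IsPhotonSurface n m Q → P ⊆ Q →
      IsPhotonSurface n m P) := by
  refine ⟨fun P hPc hP => ?_, fun u hu => ⟨isPhotonSurface_hyperplane hn hm hu,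
    isTotallyGeodesic_hyperplane hn hm hu⟩, fun Q lam hlam hQ => ?_,
    fun P Q hP hQ hPQ => hQ.of_subset hP hPQ⟩
  · rcases hP.forall_radial_or_forall_static hn hm hPc.isPreconnected with h1 | h1
    · obtain ⟨Λ, ρ, hΛ, hρ, hsub⟩ := hP.subset_profileSurface hn hm hPc h1
      -- The umbilicity factor is the inverse of the common impact parameter.
      have hlam : 0 < 1 / √Λ := by positivity
      have hΛl : Λ = 1 / (1 / √Λ) ^ 2 := by
        rw [div_pow, Real.sq_sqrt hΛ.le]
        simp
      rw [hΛl] at hρ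
      exact Or.inr ⟨profileSurface n Set.univ ρ, 1 / √Λ, hsub,
        hρ.isPhotonSurface hn hm (by positivity),
        hρ.isSphericallySymmetric hn hm Set.ordConnected_univ Set.univ_nonempty, hlam,
        hρ.hasOutwardUmbilicityFactor hn hm hlam,
        hρ.isPhotonCylinder_or_isPhotonProfileSurface hn hm hlam⟩
    · exact Or.inl (hP.subset_hyperplane hn hm hPc h1)
  · obtain ⟨J, ρ, hρ, hJ, hne, rfl⟩ : ∃ J ρ, IsNullProfile n m (1 / lam ^ 2) J ρ ∧
        J.OrdConnected ∧ J.Nonempty ∧ Q = profileSurface n J ρ := by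
      rcases hQ with hQ | hQ
      · exact hQ.isNullProfile hn hm
      · exact hQ.isNullProfile hn hm hlam
    exact ⟨hρ.isPhotonSurface hn hm (by positivity), hρ.isSphericallySymmetric hn hm hJ hne,
      hρ.hasOutwardUmbilicityFactor hn hm hlam⟩
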